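/- Let $Q_1,Q_2,Q_3\in\mathbb R[u,v,w]$ be quadratic forms such that the plane quartic $\Delta=(Q_1Q_3-Q_2^2=0)\subset\mathbb P^2_{\mathbb R}$ is smooth. Call a simple closed curve in $\mathbb P^2(\mathbb R)$ that separates $\mathbb P^2(\mathbb R)$ an oval. Let the outside $U_\Delta$ be the non-orientable part of $\mathbb P^2(\mathbb R)\setminus\Delta(\mathbb R)$, that is, the union of its non-orientable connected components. Let $$W=\bigl(t_0^2Q_1+2t_0t_1Q_2+t_1^2Q_3=0\bigr)\subset\mathbb P^1_{[t_0:t_1]}\times\mathbb P^2_{[u:v:w]},$$ and let $\pi_2'\colon W\to\mathbb P^2$ be the second projection. Suppose that $\Delta(\mathbb R)$ is the disjoint union of four ovals. Then $$U_\Delta=(Q_1Q_3-Q_2^2<0)_{\mathbb R}:=\{P\in\mathbb P^2(\mathbb R) : (Q_1Q_3-Q_2^2)(P)<0\}.$$ Consequently, every real bitangent of $\Delta$ splits on $W$: if $\ell\subset\mathbb P^2_{\mathbb R}$ is a line such that $\Delta$ cuts out on $\ell_{\mathbb C}$ a divisor of the form $2D$, then the preimage $(\pi_2')^{-1}(\ell)$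 is the union of two distinct curves defined over $\mathbb R$, each of which $\pi_2'$ maps isomorphically onto $\ell$. -/

import Mathlib

noncomputable section

open MvPolynomial
open scoped LinearAlgebra.Projectivization

namespace RealQuartic

/-! ### The real projective plane -/

/-- The real projective plane `ℙ²(ℝ)`. -/
abbrev RP2 : Type := ℙ ℝ (Fin 3 → ℝ)

/-- The Euclidean topology on `ℙ²(ℝ)`: the quotient topology from `ℝ³ ∖ {0}`. -/
instance : TopologicalSpace RP2 :=
  inferInstanceAs (TopologicalSpace (Quotient (projectivizationSetoid ℝ (Fin 3 → ℝ))))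

/-- The real points of the plane curve defined by the homogeneous polynomial `f`. -/
def zeroLocus (f : MvPolynomial (Fin 3) ℝ) : Set RP2 := {P | eval P.rep f = 0}

/-- The set `(f < 0)_ℝ` of real points at which the form `f` is negative. For `f` homogeneous of
even degree this does not depend on the representative of the point. -/
def negLocus (f : MvPolynomial (Fin 3) ℝ) : Set RP2 := {P | eval P.rep f < 0}

/-- The homogeneous polynomial `f` defines a smooth plane curve: the gradient of `f` vanishes at
no complex point of the curve. -/
def IsSmoothCurve (f : MvPolynomial (Fin 3) ℝ) : Prop :=
  ∀ v : Fin 3 → ℂ, v ≠ 0 → aeval v f = 0 → ∃ i, aeval v (pderiv i f) ≠ 0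

/-! ### Ovals -/

/-- An oval in `ℙ²(ℝ)`: a simple closed curve that separates `ℙ²(ℝ)`. -/
def IsOval (C : Set RP2) : Prop := Nonempty (C ≃ₜ Circle) ∧ ¬ IsPreconnected Cᶜ

/-- The set `S` consists of exactly `n` pairwise disjoint ovals. -/
def ConsistsOfOvals (n : ℕ) (S : Set RP2) : Prop :=
  ∃ C : Fin n → Set RP2, (∀ i, IsOval (C i)) ∧ Pairwise (fun i j => Disjoint (C i) (C j)) ∧
    ⋃ i, C i = S

/-! ### Orientability of open subsets of the real projective plane -/

/-- The domain `x_i ≠ 0` of the `i`-th standard affine chart. -/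
def chartDomain (i : Fin 3) : Set RP2 := {P | P.rep i ≠ 0}

/-- The `i`-th standard affine chart: the coordinates `x_j / x_i` for `j ≠ i`, in increasing order
of `j`. -/
def chart (i : Fin 3) (P : RP2) : Fin 2 → ℝ := fun k => P.rep (i.succAbove k) / P.rep i

/-- The change of coordinates from the `i`-th to the `j`-th standard affine chart. -/
def transition (i j : Fin 3) (y : Fin 2 → ℝ) : Fin 2 → ℝ := fun k =>
  (i.insertNth 1 y : Fin 3 → ℝ) (j.succAbove k) / (i.insertNth 1 y : Fin 3 → ℝ) j

/-- The open set `U` is orientable: each affine chart can be given, over `U`, a locally constant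
sign such that, after correcting the charts by these signs, all coordinate changes over `U` have
positive Jacobian determinant. -/
def IsOrientable (U : Set RP2) : Prop :=
  ∃ ε : Fin 3 → RP2 → ℤˣ,
    (∀ i, ContinuousOn (ε i) (U ∩ chartDomain i)) ∧
    ∀ i j, ∀ P ∈ U ∩ chartDomain i ∩ chartDomain j,
      0 < ((ε i P : ℤ) : ℝ) * ((ε j P : ℤ) : ℝ) *
        (fderiv ℝ (transition i j) (chart i P)).det

/-- The outside `U_f` of the curve `f = 0`: the non-orientable part of the complement of its real
locus, that is, the points that lie in a non-orientable connected component of the complement. -/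
def outside (f : MvPolynomial (Fin 3) ℝ) : Set RP2 :=
  {P | P ∈ (zeroLocus f)ᶜ ∧ ¬ IsOrientable (connectedComponentIn (zeroLocus f)ᶜ P)}

/-! ### Bitangents and the del Pezzo surface -/

/-- The complex points of the line `l 0 * u + l 1 * v + l 2 * w = 0`. -/
def complexLine (l : Fin 3 → ℝ) : Set (ℙ ℂ (Fin 3 → ℂ)) :=
  {P | ∑ i, (l i : ℂ) * P.rep i = 0}

/-- The line with real coefficients `l` is a bitangent of the plane quartic `f = 0`: the divisor
that the quartic cuts out on the complexified line is of the form `2 D`, where `D` is the divisor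
of degree two that a quadratic form `g` cuts out (so `D = P₁ + P₂` for the two points of tangency,
which may coincide or be complex conjugate). -/
def IsRealBitangent (f : MvPolynomial (Fin 3) ℝ) (l : Fin 3 → ℝ) : Prop :=
  l ≠ 0 ∧ ∃ g h : MvPolynomial (Fin 3) ℂ, g.IsHomogeneous 2 ∧
    map (algebraMap ℝ ℂ) f = g ^ 2 + (∑ i, C (l i : ℂ) * X i) * h

/-- The complex points of the surface
`W = (t₀² Q₁ + 2 t₀ t₁ Q₂ + t₁² Q₃ = 0)` in `ℙ¹ × ℙ²`. -/
def delPezzo (Q₁ Q₂ Q₃ : MvPolynomial (Fin 3) ℝ) :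
    Set (ℙ ℂ (Fin 2 → ℂ) × ℙ ℂ (Fin 3 → ℂ)) :=
  {p | p.1.rep 0 ^ 2 * aeval p.2.rep Q₁ + 2 * p.1.rep 0 * p.1.rep 1 * aeval p.2.rep Q₂ +
    p.1.rep 1 ^ 2 * aeval p.2.rep Q₃ = 0}

/-- `Z` is (the set of complex points of) a curve in `ℙ¹ × ℙ²`, defined over `ℝ`, that the second
projection maps isomorphically onto the line `l`: it is the graph of a morphism `[A 0 : A 1]` over
`ℝ` from the line to `ℙ¹`. -/
def IsRealLineOver (l : Fin 3 → ℝ) (Z : Set (ℙ ℂ (Fin 2 → ℂ) × ℙ ℂ (Fin 3 → ℂ))) : Prop :=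
  ∃ (d : ℕ) (A : Fin 2 → MvPolynomial (Fin 3) ℝ),
    (∀ k, (A k).IsHomogeneous d) ∧
    (∀ P ∈ complexLine l, ∃ k, aeval P.rep (A k) ≠ 0) ∧
    Z = {p | p.2 ∈ complexLine l ∧
      p.1.rep 0 * aeval p.2.rep (A 1) = p.1.rep 1 * aeval p.2.rep (A 0)}

/-- The line `l` splits on `W`: its preimage in `W` under the second projection is the union of two
distinct curves defined over `ℝ`, each mapped isomorphically onto the line. -/
def SplitsOn (Q₁ Q₂ Q₃ : MvPolynomial (Fin 3) ℝ) (l : Fin 3 → ℝ) : Prop :=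
  ∃ Z₁ Z₂, IsRealLineOver l Z₁ ∧ IsRealLineOver l Z₂ ∧ Z₁ ≠ Z₂ ∧
    delPezzo Q₁ Q₂ Q₃ ∩ Prod.snd ⁻¹' complexLine l = Z₁ ∪ Z₂

end RealQuartic

end

noncomputable section

open MvPolynomial
open scoped LinearAlgebra.Projectivization

namespace RealQuartic

open Set Filter Topology

/-! ### Topology of the real projective plane -/

/-! Write `F = Q₁Q₃ - Q₂²` and `Q_t = t₀²Q₁ + 2t₀t₁Q₂ + t₁²Q₃`. The argument has three stages: the
topology of four ovals, the sign of `F` on the outside, and the factorization of `Q_t` over a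
bitangent.

Topology. An orientation of an open set amounts to an odd, locally constant sign on the cone over
it. If every component of the complement of the curve were orientable, these signs would form one
odd sign off the cone `F = 0`. Across each oval it either extends or jumps. Since the oval
separates, a jump is repaired by reversing the sign on one side, and the result would be an odd
locally constant sign on the connected space `ℝ³ ∖ {0}` (`OvalSystem.not_isOddSign`). So some
component `N` is not orientable, and `N` meets every line, because the complement of a line is
orientable. Call the part of the complement of an oval that misses `N` its inside. A line through
the insides of three ovals also passes through `N`, hence crosses the quartic at least six times,
which is impossible (`InsideSystem.not_forall_exists_mem_line`). Therefore the insides are disjoint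
and orientable, their common outside `O` is connected, `O` is the non-orientable part, and `F` has
one sign on `O` and the opposite sign on the insides.

Sign. Suppose `F > 0` on `O`. Then, up to a common sign, every `Q_t` with `t ≠ 0` is positive on
`O`, so positive somewhere on every line, and `Q_t` can be negative only in the insides. If it is
negative somewhere, it has signature `(2, 1)`, negative determinant, and a negative region lying in
a single inside. If it is nowhere negative, its determinant is nonnegative. Each inside is reached
by some `t`, because `F < 0` makes `Q_t` indefinite in `t`. Thus the binary sextic `det Q_t` would
be negative on four disjoint open subsets of `ℙ¹` and nonnegative elsewhere, which takes eight sign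
changes after a small perturbation (`not_four_arcs`). Hence `F < 0` on `O`.

Splitting. On a real bitangent `F` is a square over `ℂ`, so it is `±r²` over `ℝ`. The line meets
`O`, so the sign is minus, and `q₁q₃ = (q₂ + r)(q₂ - r)` for the restricted forms. Unique
factorization gives `Q_t = (t₀a + t₁b)(t₀c + t₁d)` over the line (`exists_factorization`), and the
two factors define the two curves. -/

/-- The projection `ℝ³ → ℙ²(ℝ)`, with a junk value at the origin. -/
def pr (v : Fin 3 → ℝ) : RP2 :=
  open Classical in if hv : v ≠ 0 then Projectivization.mk ℝ v hv else Classical.arbitrary RP2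

lemma pr_of_ne_zero {v : Fin 3 → ℝ} (hv : v ≠ 0) : pr v = Projectivization.mk ℝ v hv := by
  simp [pr, hv]

@[simp] lemma pr_rep (P : RP2) : pr P.rep = P := by
  rw [pr_of_ne_zero P.rep_nonzero, Projectivization.mk_rep]

lemma pr_smul {c : ℝ} (hc : c ≠ 0) (v : Fin 3 → ℝ) : pr (c • v) = pr v := by
  by_cases hv : v = 0
  · simp [hv]
  · rw [pr_of_ne_zero hv, pr_of_ne_zero (smul_ne_zero hc hv), Projectivization.mk_eq_mk_iff']
    exact ⟨c, rfl⟩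

lemma pr_neg (v : Fin 3 → ℝ) : pr (-v) = pr v := by
  simpa using pr_smul (c := -1) (by norm_num) v

lemma exists_smul_of_pr_eq {v w : Fin 3 → ℝ} (hv : v ≠ 0) (hw : w ≠ 0) (h : pr v = pr w) :
    ∃ c : ℝ, c ≠ 0 ∧ w = c • v := by
  rw [pr_of_ne_zero hv, pr_of_ne_zero hw, eq_comm, Projectivization.mk_eq_mk_iff'] at h
  obtain ⟨c, rfl⟩ := h
  exact ⟨c, fun h => hw (by simp [h]), rfl⟩

lemma exists_rep_pr {v : Fin 3 → ℝ} (hv : v ≠ 0) : ∃ c : ℝ, c ≠ 0 ∧ (pr v).rep = c • v :=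
  exists_smul_of_pr_eq hv (pr v).rep_nonzero (by simp)

lemma exists_pr_eq (P : RP2) : ∃ v, v ≠ 0 ∧ pr v = P := ⟨P.rep, P.rep_nonzero, pr_rep P⟩

lemma isOpen_image_pr {W : Set (Fin 3 → ℝ)} (hW : IsOpen W) (h0 : (0 : Fin 3 → ℝ) ∉ W) :
    IsOpen (pr '' W) := by
  have hq : IsQuotientMap (fun v : {v : Fin 3 → ℝ // v ≠ 0} => Projectivization.mk ℝ v.1 v.2) :=
    isQuotientMap_quot_mk
  rw [← hq.isOpen_preimage]
  have : (fun v : {v : Fin 3 → ℝ // v ≠ 0} => Projectivization.mk ℝ v.1 v.2) ⁻¹' (pr '' W) =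
      ⋃ c : {c : ℝ // c ≠ 0}, {v | c.1 • v.1 ∈ W} := by
    ext ⟨v, hv⟩
    simp only [mem_preimage, mem_image, mem_iUnion, mem_ofPred_eq]
    constructor
    · rintro ⟨w, hw, h⟩
      have hw0 : w ≠ 0 := fun h => h0 (h ▸ hw)
      rw [← pr_of_ne_zero hv] at h
      obtain ⟨c, hc, rfl⟩ := exists_smul_of_pr_eq hv hw0 h.symm
      exact ⟨⟨c, hc⟩, hw⟩
    · rintro ⟨⟨c, hc⟩, h⟩
      exact ⟨_, h, by rw [pr_smul hc, pr_of_ne_zero hv]⟩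
  rw [this]
  exact isOpen_iUnion fun c => hW.preimage (by fun_prop)

lemma continuousAt_pr {v : Fin 3 → ℝ} (hv : v ≠ 0) : ContinuousAt pr v := by
  have hc : Continuous (fun v : {v : Fin 3 → ℝ // v ≠ 0} => Projectivization.mk ℝ v.1 v.2) :=
    continuous_quot_mk
  have : ContinuousOn pr {v | v ≠ 0} := by
    rw [continuousOn_iff_continuous_domRestrict]
    refine hc.congr ?_
    rintro ⟨w, hw⟩
    exact (pr_of_ne_zero hw).symm
  exact this.continuousAt (isOpen_ne.mem_nhds hv)

/-- The projection off the origin is both continuous and open. This is what lets every local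
statement on the plane be checked on the cone. -/
lemma map_pr_nhds {v : Fin 3 → ℝ} (hv : v ≠ 0) : map pr (𝓝 v) = 𝓝 (pr v) := by
  refine le_antisymm (continuousAt_pr hv) fun s hs => ?_
  obtain ⟨W, hWs, hW, hvW⟩ := mem_nhds_iff.1 (inter_mem (mem_map.1 hs) (isOpen_ne.mem_nhds hv))
  refine mem_of_superset ((isOpen_image_pr hW fun h => (hWs h).2 rfl).mem_nhds ⟨v, hvW, rfl⟩) ?_
  rintro _ ⟨w, hw, rfl⟩
  exact (hWs hw).1

lemma eventually_nhds_pr {v : Fin 3 → ℝ} (hv : v ≠ 0) {p : RP2 → Prop} :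
    (∀ᶠ P in 𝓝 (pr v), p P) ↔ ∀ᶠ w in 𝓝 v, p (pr w) := by
  rw [← map_pr_nhds hv, eventually_map]

lemma continuousOn_pr : ContinuousOn pr {v | v ≠ 0} :=
  fun _ hv => (continuousAt_pr hv).continuousWithinAt

/-- A function on the projective plane is continuous as soon as its pullback is. -/
lemma continuousAt_of_comp_pr {Y : Type*} [TopologicalSpace Y] {g : RP2 → Y} {v : Fin 3 → ℝ}
    (hv : v ≠ 0) (h : ContinuousAt (fun w => g (pr w)) v) : ContinuousAt g (pr v) := by
  unfold ContinuousAt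
  rw [← map_pr_nhds hv, tendsto_map'_iff]
  exact h

lemma isConnected_ne_zero : IsConnected {v : Fin 3 → ℝ | v ≠ 0} :=
  isConnected_compl_singleton_of_one_lt_rank (by simp) 0

instance : PreconnectedSpace RP2 := by
  refine ⟨?_⟩
  have := isConnected_ne_zero.isPreconnected.image pr continuousOn_pr
  convert this
  ext P
  simpa using exists_pr_eq P

/-- Needed so that the components of the complement of the curve are open. -/
instance : LocallyConnectedSpace RP2 := by
  rw [locallyConnectedSpace_iff_connected_subsets]
  intro P U hU
  obtain ⟨v, hv, rfl⟩ := exists_pr_eq P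
  rw [← map_pr_nhds hv, mem_map] at hU
  obtain ⟨V, hV, hVc, hVU⟩ := locallyConnectedSpace_iff_connected_subsets.1
    inferInstance v _ (inter_mem hU (isOpen_ne.mem_nhds hv))
  refine ⟨pr '' V, ?_, hVc.image _ (continuousOn_pr.mono fun w hw => (hVU hw).2), ?_⟩
  · rw [← map_pr_nhds hv]; exact image_mem_map hV
  · rintro _ ⟨w, hw, rfl⟩; exact (hVU hw).1

/-- The products `x_i x_j / |x|²` as functions on the projective plane. -/
def veronese (P : RP2) (i j : Fin 3) : ℝ := P.rep i * P.rep j / ∑ k, P.rep k ^ 2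

lemma sum_sq_pos {v : Fin 3 → ℝ} (hv : v ≠ 0) : 0 < ∑ k, v k ^ 2 := by
  obtain ⟨i, hi⟩ := Function.ne_iff.1 hv
  exact Finset.sum_pos' (fun _ _ => sq_nonneg _) ⟨i, Finset.mem_univ _, by
    have : v i ≠ 0 := hi
    positivity⟩

lemma veronese_pr {v : Fin 3 → ℝ} (hv : v ≠ 0) (i j : Fin 3) :
    veronese (pr v) i j = v i * v j / ∑ k, v k ^ 2 := by
  obtain ⟨c, hc, h⟩ := exists_rep_pr hv
  simp only [veronese, h, Pi.smul_apply, smul_eq_mul, mul_pow, ← Finset.mul_sum]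
  have := (sum_sq_pos hv).ne'
  field_simp

lemma continuous_veronese (i j : Fin 3) : Continuous fun P => veronese P i j := by
  rw [continuous_iff_continuousAt]
  intro P
  obtain ⟨v, hv, rfl⟩ := exists_pr_eq P
  refine continuousAt_of_comp_pr hv ?_
  have : ContinuousAt (fun w : Fin 3 → ℝ => w i * w j / ∑ k, w k ^ 2) v :=
    ContinuousAt.div (by fun_prop)
      (continuous_finsetSum _ fun k _ => by fun_prop).continuousAt (sum_sq_pos hv).ne'
  refine this.congr ?_
  filter_upwards [isOpen_ne.mem_nhds hv] with w hw using (veronese_pr hw i j).symm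

/-- The row of the matrix `x xᵀ / |x|²` at an index with `x_i ≠ 0` recovers `x` up to scale, so
`veronese` is a continuous injection into a Hausdorff space. Hausdorffness makes the ovals, which
are compact, closed. -/
instance : T2Space RP2 := by
  refine T2Space.of_injective_continuous (f := veronese) ?_ ?_
  · intro P Q h
    obtain ⟨i, hi⟩ := Function.ne_iff.1 P.rep_nonzero
    have hP := sum_sq_pos P.rep_nonzero
    have hQ := sum_sq_pos Q.rep_nonzero
    have key : ∀ j, P.rep i * P.rep j / ∑ k, P.rep k ^ 2 = Q.rep i * Q.rep j / ∑ k, Q.rep k ^ 2 :=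
      fun j => congrFun (congrFun h i) j
    set a := ∑ k, P.rep k ^ 2
    set b := ∑ k, Q.rep k ^ 2
    have hi' : P.rep i ≠ 0 := hi
    have hPQ : P.rep = ((a / b) * Q.rep i / P.rep i) • Q.rep := by
      ext j
      have := key j
      rw [div_eq_div_iff hP.ne' hQ.ne'] at this
      simp only [Pi.smul_apply, smul_eq_mul]
      field_simp
      linarith
    have hc : (a / b) * Q.rep i / P.rep i ≠ 0 := by
      intro h0
      rw [h0, zero_smul] at hPQ
      exact P.rep_nonzero hPQ
    rw [← pr_rep P, ← pr_rep Q, hPQ, pr_smul hc, pr_rep]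
  · exact continuous_pi fun i => continuous_pi fun j => continuous_veronese i j

/-! ### Orientability -/

lemma det_fderiv_of_components {g : (Fin 2 → ℝ) → Fin 2 → ℝ} {y : Fin 2 → ℝ} {a b c d : ℝ}
    (h0 : HasFDerivAt (fun z => g z 0)
      (a • ContinuousLinearMap.proj (R := ℝ) (φ := fun _ : Fin 2 => ℝ) 0 +
        b • ContinuousLinearMap.proj (R := ℝ) (φ := fun _ : Fin 2 => ℝ) 1) y)
    (h1 : HasFDerivAt (fun z => g z 1)
      (c • ContinuousLinearMap.proj (R := ℝ) (φ := fun _ : Fin 2 => ℝ) 0 +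
        d • ContinuousLinearMap.proj (R := ℝ) (φ := fun _ : Fin 2 => ℝ) 1) y) :
    (fderiv ℝ g y).det = a * d - b * c := by
  have h : HasFDerivAt g (LinearMap.toContinuousLinearMap (Matrix.toLin' !![a, b; c, d])) y := by
    rw [hasFDerivAt_pi']
    intro i
    fin_cases i
    · refine h0.congr_fderiv ?_
      ext z
      simp [Matrix.toLin'_apply, dotProduct, Fin.sum_univ_two]
    · refine h1.congr_fderiv ?_
      ext z
      simp [Matrix.toLin'_apply, dotProduct, Fin.sum_univ_two]
  rw [h.fderiv]
  simp [ContinuousLinearMap.det, LinearMap.det_toLin', Matrix.det_fin_two]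

lemma hasFDerivAt_one_div_coord {y : Fin 2 → ℝ} (j : Fin 2) (hy : y j ≠ 0) :
    HasFDerivAt (fun z : Fin 2 → ℝ => 1 / z j)
      (-(1 / y j ^ 2) • ContinuousLinearMap.proj (R := ℝ) (φ := fun _ : Fin 2 => ℝ) j) y := by
  have hj : HasFDerivAt (fun z : Fin 2 → ℝ => z j)
    (ContinuousLinearMap.proj (R := ℝ) (φ := fun _ : Fin 2 => ℝ) j) y := hasFDerivAt_apply j y
  have := (hasDerivAt_inv hy).comp_hasFDerivAt y hj
  refine HasFDerivAt.congr_fderiv (by simpa [Function.comp_def] using this) ?_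
  ext z
  simp

lemma hasFDerivAt_coord_div {y : Fin 2 → ℝ} (i j : Fin 2) (hy : y j ≠ 0) :
    HasFDerivAt (fun z : Fin 2 → ℝ => z i / z j)
      ((y j)⁻¹ • ContinuousLinearMap.proj (R := ℝ) (φ := fun _ : Fin 2 => ℝ) i -
        (y i / y j ^ 2) • ContinuousLinearMap.proj (R := ℝ) (φ := fun _ : Fin 2 => ℝ) j) y := by
  have hi : HasFDerivAt (fun z : Fin 2 → ℝ => z i)
    (ContinuousLinearMap.proj (R := ℝ) (φ := fun _ : Fin 2 => ℝ) i) y := hasFDerivAt_apply i y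
  have := hi.fun_mul (hasFDerivAt_one_div_coord j hy)
  simp only [mul_one_div] at this
  refine this.congr_fderiv ?_
  ext z
  simp
  ring

/-- This is the shape of a change between two distinct standard charts. The Jacobian matrix is
triangular up to the order of its rows and columns, and the two signs record that order. -/
lemma det_fderiv_of_eq_div {g : (Fin 2 → ℝ) → Fin 2 → ℝ} {y : Fin 2 → ℝ} (k : Fin 2) (m : Fin 2)
    (hy : y k ≠ 0) (h : ∀ z, g z m = 1 / z k) (h' : ∀ z, g z (1 - m) = z (1 - k) / z k) :
    (fderiv ℝ g y).det = (-1) ^ (k : ℕ) * (-1) ^ (m : ℕ) * (-1 / y k ^ 3) := by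
  have h0 := hasFDerivAt_one_div_coord k hy
  have h1 := hasFDerivAt_coord_div (1 - k) k hy
  rw [← funext h] at h0
  rw [← funext h'] at h1
  fin_cases k <;> fin_cases m <;> simp only [Fin.zero_eta, Fin.mk_one, sub_self, sub_zero] at *
  · rw [det_fderiv_of_components (a := -(1 / y 0 ^ 2)) (b := 0) (c := - (y 1 / y 0 ^ 2))
      (d := (y 0)⁻¹) (h0.congr_fderiv (by ext z; simp)) (h1.congr_fderiv (by ext z; simp; ring))]
    simp; field_simp
  · rw [det_fderiv_of_components (c := -(1 / y 0 ^ 2)) (d := 0) (a := - (y 1 / y 0 ^ 2))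
      (b := (y 0)⁻¹) (h1.congr_fderiv (by ext z; simp; ring)) (h0.congr_fderiv (by ext z; simp))]
    simp; field_simp
  · rw [det_fderiv_of_components (b := -(1 / y 1 ^ 2)) (a := 0) (d := - (y 0 / y 1 ^ 2))
      (c := (y 1)⁻¹) (h0.congr_fderiv (by ext z; simp)) (h1.congr_fderiv (by ext z; simp; ring))]
    simp; field_simp
  · rw [det_fderiv_of_components (d := -(1 / y 1 ^ 2)) (c := 0) (b := - (y 0 / y 1 ^ 2))
      (a := (y 1)⁻¹) (h1.congr_fderiv (by ext z; simp; ring)) (h0.congr_fderiv (by ext z; simp))]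
    simp; field_simp

/-- The sign of the Jacobian determinant of a coordinate change. -/
lemma det_fderiv_transition (i j : Fin 3) (P : RP2) (hi : P.rep i ≠ 0) (hj : P.rep j ≠ 0) :
    (fderiv ℝ (transition i j) (chart i P)).det =
      (-1) ^ (i : ℕ) * (-1) ^ (j : ℕ) * (P.rep i / P.rep j) ^ 3 := by
  have hid : ∀ i, transition i i = id := by
    intro i
    ext y k
    simp [transition]
  by_cases hij : i = j
  · subst hij
    rw [hid, fderiv_id]
    simp [ContinuousLinearMap.det, div_self hi, ← mul_pow]
  obtain ⟨k, rfl⟩ := Fin.exists_succAbove_eq (Ne.symm hij)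
  obtain ⟨m, hm⟩ := Fin.exists_succAbove_eq hij
  have hy : chart i P k ≠ 0 := div_ne_zero hj hi
  rw [det_fderiv_of_eq_div k m hy]
  · have : chart i P k = P.rep (i.succAbove k) / P.rep i := rfl
    -- For `i < j` one has `k = j - 1` and `m = i`; for `j < i`, `k = j` and `m = i - 1`. Either way
    -- the shift by one produces a sign that cancels the one in `-1 / y³`.
    have hs : (-1 : ℝ) ^ (i : ℕ) * (-1) ^ (i.succAbove k : ℕ) = - ((-1) ^ (k : ℕ) * (-1) ^ (m : ℕ)) := by
      clear hy this
      fin_cases i <;> fin_cases k <;> fin_cases m <;> simp_all [Fin.succAbove]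
    rw [hs, this]
    field_simp
  · intro z
    simp [transition, hm]
  · intro z
    have : (i.succAbove k).succAbove (1 - m) = i.succAbove (1 - k) := by
      clear hy
      fin_cases i <;> fin_cases k <;> fin_cases m <;> simp_all [Fin.succAbove]
    simp [transition, this]

/-- Up to positive factors the Jacobian is the product of `(-1)^i x_i` and `(-1)^j x_j`. So an
orientation is a choice of chart signs for which all the numbers `ε_i (-1)^i x_i` have the same
sign. -/
lemma jacobian_pos_iff (i j : Fin 3) (P : RP2) (hi : P.rep i ≠ 0) (hj : P.rep j ≠ 0) (a b : ℤˣ) :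
    0 < ((a : ℤ) : ℝ) * ((b : ℤ) : ℝ) * (fderiv ℝ (transition i j) (chart i P)).det ↔
      0 < (((a : ℤ) : ℝ) * (-1) ^ (i : ℕ) * P.rep i) * (((b : ℤ) : ℝ) * (-1) ^ (j : ℕ) * P.rep j) := by
  rw [det_fderiv_transition i j P hi hj]
  have : ((a : ℤ) : ℝ) * ((b : ℤ) : ℝ) * ((-1) ^ (i : ℕ) * (-1) ^ (j : ℕ) * (P.rep i / P.rep j) ^ 3) =
     ((((a : ℤ) : ℝ) * (-1) ^ (i : ℕ) * P.rep i) * (((b : ℤ) : ℝ) * (-1) ^ (j : ℕ) * P.rep j)) *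
      (P.rep i ^ 2 / P.rep j ^ 4) := by
    field_simp
  rw [this, mul_pos_iff_of_pos_right]
  positivity

/-- The sign of a real number, as a unit of `ℤ`. -/
def unitSign (x : ℝ) : ℤˣ := open Classical in if 0 < x then 1 else -1

lemma unitSign_of_pos {x : ℝ} (h : 0 < x) : unitSign x = 1 := by simp [unitSign, h]

lemma unitSign_of_neg {x : ℝ} (h : x < 0) : unitSign x = -1 := by simp [unitSign, h.le]

lemma unitSign_mul_pos {x : ℝ} (h : x ≠ 0) : 0 < ((unitSign x : ℤ) : ℝ) * x := by
  rcases h.lt_or_gt with h | h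
  · simp [unitSign_of_neg h, h]
  · simp [unitSign_of_pos h, h]

lemma unitSign_eq_of_mul_pos {x y : ℝ} (h : 0 < x * y) : unitSign x = unitSign y := by
  rcases mul_pos_iff.1 h with h | h
  · rw [unitSign_of_pos h.1, unitSign_of_pos h.2]
  · rw [unitSign_of_neg h.1, unitSign_of_neg h.2]

lemma unitSign_neg {x : ℝ} (h : x ≠ 0) : unitSign (-x) = -unitSign x := by
  rcases h.lt_or_gt with h | h
  · rw [unitSign_of_neg h, unitSign_of_pos (neg_pos.2 h), neg_neg]
  · rw [unitSign_of_pos h, unitSign_of_neg (neg_lt_zero.2 h)]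

lemma unitSign_mul {c x : ℝ} (hc : c ≠ 0) (hx : x ≠ 0) :
    unitSign (c * x) = unitSign c * unitSign x := by
  rcases hc.lt_or_gt with h | h
  · rw [unitSign_of_neg h, neg_one_mul, ← unitSign_neg hx]
    exact unitSign_eq_of_mul_pos (by have := mul_self_pos.2 hx; nlinarith)
  · rw [unitSign_of_pos h, one_mul]
    exact unitSign_eq_of_mul_pos (by have := mul_self_pos.2 hx; nlinarith)

lemma eventually_unitSign_eq {Y : Type*} [TopologicalSpace Y] {g : Y → ℝ} {y : Y}
    (hg : ContinuousAt g y) (h : g y ≠ 0) : ∀ᶠ z in 𝓝 y, unitSign (g z) = unitSign (g y) := by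
  have : ∀ᶠ z in 𝓝 y, 0 < g z * g y :=
    (hg.mul continuousAt_const).eventually (lt_mem_nhds (mul_self_pos.2 h))
  exact this.mono fun z hz => unitSign_eq_of_mul_pos hz

/-- A set that misses a line is orientable. -/
lemma isOrientable_of_forall_ne_zero {U : Set RP2} (l : Fin 3 → ℝ)
    (hU : ∀ P ∈ U, l ⬝ᵥ P.rep ≠ 0) : IsOrientable U := by
  -- The sum equals `(l ⬝ᵥ x) x_i / |x|²`. Its sign is that of `x_i` for the representative with `l
  -- ⬝ᵥ x > 0`, written so that it is visibly continuous and independent of the representative.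
  refine ⟨fun i P => unitSign ((-1) ^ (i : ℕ) * (∑ j, l j * veronese P j i)), ?_, ?_⟩
  all_goals
    have key : ∀ P : RP2, ∀ i, (∑ j, l j * veronese P j i) =
        (l ⬝ᵥ P.rep) * P.rep i / ∑ k, P.rep k ^ 2 := by
      intro P i
      simp only [veronese, dotProduct, Finset.sum_mul, Finset.sum_div]
      exact Finset.sum_congr rfl fun j _ => by ring
    have hne : ∀ P ∈ U, ∀ i, P.rep i ≠ 0 →
        (-1 : ℝ) ^ (i : ℕ) * (∑ j, l j * veronese P j i) ≠ 0 := by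
      intro P hP i hi
      rw [key]
      have := hU P hP
      have := sum_sq_pos P.rep_nonzero
      positivity
  · intro i P hP
    refine ContinuousAt.continuousWithinAt ?_
    have hc : Continuous fun P : RP2 => (-1 : ℝ) ^ (i : ℕ) * (∑ j, l j * veronese P j i) :=
      continuous_const.mul (continuous_finsetSum _ fun j _ =>
        continuous_const.mul (continuous_veronese j i))
    have := eventually_unitSign_eq hc.continuousAt (hne P hP.1 i hP.2)
    exact (continuousAt_const (y := unitSign _)).congr (this.mono fun z hz => hz.symm)
  · rintro i j P ⟨⟨hP, hi⟩, hj⟩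
    rw [jacobian_pos_iff i j P hi hj]
    have h : ∀ i, P.rep i ≠ 0 → 0 < ((unitSign ((-1) ^ (i : ℕ) * (∑ j, l j * veronese P j i)) : ℤ) : ℝ) *
        (-1) ^ (i : ℕ) * P.rep i * (l ⬝ᵥ P.rep) := by
      intro i hi
      have h1 := unitSign_mul_pos (hne P hP i hi)
      have h2 := sum_sq_pos P.rep_nonzero
      nth_rewrite 2 [key] at h1
      have h3 := mul_pos h1 h2
      field_simp at h3
      linarith
    have := mul_pos (h i hi) (h j hj)
    have hl : 0 < (l ⬝ᵥ P.rep) ^ 2 := by have := hU P hP; positivity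
    refine pos_of_mul_pos_left (b := (l ⬝ᵥ P.rep) ^ 2) ?_ hl.le
    linarith

/-- An orientation of an open set is an odd, locally constant sign on the cone over it. -/
lemma IsOrientable.exists_sign {K : Set RP2} (hK : IsOrientable K) (hKo : IsOpen K) :
    ∃ s : (Fin 3 → ℝ) → ℤˣ, ∀ v, v ≠ 0 → pr v ∈ K →
      (∀ c : ℝ, c ≠ 0 → s (c • v) = unitSign c * s v) ∧ ∀ᶠ x in 𝓝 v, s x = s v := by
  obtain ⟨ε, hε, hpos⟩ := hK
  choose! idx hidx using fun (v : Fin 3 → ℝ) (hv : v ≠ 0) => Function.ne_iff.1 hv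
  -- By `jacobian_pos_iff` the value does not depend on the index, among the `i` with `v i ≠ 0`. It
  -- is odd in `v` because `ε i` depends only on the projective point.
  let u : Fin 3 → (Fin 3 → ℝ) → ℤˣ := fun i v => ε i (pr v) * unitSign ((-1) ^ (i : ℕ) * v i)
  have hu : ∀ v, v ≠ 0 → pr v ∈ K → ∀ i j, v i ≠ 0 → v j ≠ 0 → u i v = u j v := by
    intro v hv hvK i j hi hj
    obtain ⟨c, hc, h⟩ := exists_rep_pr hv
    have hi' : (pr v).rep i ≠ 0 := by simp [h, hc, hi]
    have hj' : (pr v).rep j ≠ 0 := by simp [h, hc, hj]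
    have := hpos i j (pr v) ⟨⟨hvK, hi'⟩, hj'⟩
    rw [jacobian_pos_iff i j _ hi' hj', h] at this
    simp only [Pi.smul_apply, smul_eq_mul] at this
    simp only [u]
    have hsi := unitSign_mul_pos (x := (-1) ^ (i : ℕ) * v i) (by simp [hi])
    have hsj := unitSign_mul_pos (x := (-1) ^ (j : ℕ) * v j) (by simp [hj])
    have hp := mul_pos (mul_pos this hsi) hsj
    have hp' : 0 < ((ε i (pr v) : ℤ) : ℝ) * ((unitSign ((-1) ^ (i : ℕ) * v i) : ℤ) : ℝ) *
        (((ε j (pr v) : ℤ) : ℝ) * ((unitSign ((-1) ^ (j : ℕ) * v j) : ℤ) : ℝ)) := by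
      refine pos_of_mul_pos_left
        (b := c ^ 2 * ((-1) ^ (i : ℕ) * v i) ^ 2 * ((-1) ^ (j : ℕ) * v j) ^ 2) ?_ (by positivity)
      linarith
    generalize ε i (pr v) = a at *
    generalize ε j (pr v) = b at *
    generalize unitSign ((-1) ^ (i : ℕ) * v i) = a' at *
    generalize unitSign ((-1) ^ (j : ℕ) * v j) = b' at *
    rcases Int.units_eq_one_or a with rfl | rfl <;> rcases Int.units_eq_one_or b with rfl | rfl <;>
      rcases Int.units_eq_one_or a' with rfl | rfl <;>
      rcases Int.units_eq_one_or b' with rfl | rfl <;> first | rfl | norm_num at hp'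
  refine ⟨fun v => u (idx v) v, fun v hv hvK => ⟨fun c hc => ?_, ?_⟩⟩
  · have hcv : c • v ≠ 0 := smul_ne_zero hc hv
    have hi : v (idx v) ≠ 0 := hidx v hv
    have h0 : (-1 : ℝ) ^ (idx v : ℕ) * v (idx v) ≠ 0 := by simp [hi]
    have h1 := hu (c • v) hcv (by rwa [pr_smul hc]) _ (idx v) (hidx _ hcv) (by simp [hc, hi])
    simp only [h1]
    simp only [u, pr_smul hc, Pi.smul_apply, smul_eq_mul]
    rw [mul_left_comm _ c, unitSign_mul hc h0, mul_left_comm]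
  · have hi : v (idx v) ≠ 0 := hidx v hv
    set i := idx v
    have hev : ∀ᶠ x in 𝓝 v, u i x = u i v := by
      have h1 : ∀ᶠ x in 𝓝 v, unitSign ((-1) ^ (i : ℕ) * x i) = unitSign ((-1) ^ (i : ℕ) * v i) :=
        eventually_unitSign_eq (g := fun x : Fin 3 → ℝ => (-1) ^ (i : ℕ) * x i)
          (continuous_const.mul (continuous_apply i)).continuousAt (by simp [hi])
      have h2 : ∀ᶠ x in 𝓝 v, ε i (pr x) = ε i (pr v) := by
        have hn : K ∩ chartDomain i ∈ 𝓝 (pr v) := by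
          refine inter_mem (hKo.mem_nhds hvK) ((eventually_nhds_pr hv).2 ?_)
          filter_upwards [(continuousAt_apply i v).eventually_ne hi, isOpen_ne.mem_nhds hv]
            with x hx hx0
          obtain ⟨c, hc, h⟩ := exists_rep_pr hx0
          rw [h]
          exact mul_ne_zero hc hx
        exact (eventually_nhds_pr hv).1 (((hε i).continuousAt hn).eventually
          ((isOpen_discrete {ε i (pr v)}).mem_nhds rfl))
      filter_upwards [h1, h2] with x h1 h2
      simp only [u, h1, h2]
    have h3 : ∀ᶠ x in 𝓝 v, x i ≠ 0 := (continuousAt_apply i v).eventually_ne hi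
    have h4 : ∀ᶠ x in 𝓝 v, pr x ∈ K := (continuousAt_pr hv).eventually (hKo.mem_nhds hvK)
    filter_upwards [hev, h3, h4, isOpen_ne.mem_nhds hv] with x h h3 h4 h5
    rw [← h]
    exact hu x h5 h4 _ _ (hidx x h5) h3

/-! ### Forms and their sign -/

lemma aeval_smul_of_isHomogeneous {σ R A : Type*} [CommSemiring R] [CommSemiring A] [Algebra R A]
    {Q : MvPolynomial σ R} {n : ℕ} (hQ : Q.IsHomogeneous n) (c : A) (v : σ → A) :
    aeval (c • v) Q = c ^ n * aeval v Q := by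
  simp only [aeval_def, eval₂_eq, Finset.mul_sum]
  refine Finset.sum_congr rfl fun d hd => ?_
  have hd' : d.degree = n := by
    by_contra h
    exact (mem_support_iff.1 hd) (hQ.coeff_eq_zero h)
  simp only [Pi.smul_apply, smul_eq_mul, mul_pow, Finset.prod_mul_distrib]
  rw [Finset.prod_pow_eq_pow_sum, ← hd', Finsupp.degree_apply]
  ring

lemma eval_smul_of_isHomogeneous {σ R : Type*} [CommSemiring R]
    {Q : MvPolynomial σ R} {n : ℕ} (hQ : Q.IsHomogeneous n) (c : R) (v : σ → R) :
    eval (c • v) Q = c ^ n * eval v Q := by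
  simpa [coe_aeval_eq_eval] using aeval_smul_of_isHomogeneous hQ c v

/-- The set of real points at which the form `F` is positive. -/
def posLocus (F : MvPolynomial (Fin 3) ℝ) : Set RP2 := {P | 0 < eval P.rep F}

lemma exists_eval_rep_pr {F : MvPolynomial (Fin 3) ℝ} (hF : F.IsHomogeneous 4)
    {v : Fin 3 → ℝ} (hv : v ≠ 0) :
    ∃ c : ℝ, 0 < c ∧ eval (pr v).rep F = c * eval v F := by
  obtain ⟨c, hc, h⟩ := exists_rep_pr hv
  exact ⟨c ^ 4, by positivity, by rw [h, eval_smul_of_isHomogeneous hF]⟩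

lemma pr_mem_zeroLocus {F : MvPolynomial (Fin 3) ℝ} (hF : F.IsHomogeneous 4)
    {v : Fin 3 → ℝ} (hv : v ≠ 0) :
    pr v ∈ zeroLocus F ↔ eval v F = 0 := by
  obtain ⟨c, hc, h⟩ := exists_eval_rep_pr hF hv
  simp [zeroLocus, h, hc.ne']

lemma pr_mem_posLocus {F : MvPolynomial (Fin 3) ℝ} (hF : F.IsHomogeneous 4)
    {v : Fin 3 → ℝ} (hv : v ≠ 0) :
    pr v ∈ posLocus F ↔ 0 < eval v F := by
  obtain ⟨c, hc, h⟩ := exists_eval_rep_pr hF hv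
  simp [posLocus, h, hc]

lemma pr_mem_negLocus {F : MvPolynomial (Fin 3) ℝ} (hF : F.IsHomogeneous 4)
    {v : Fin 3 → ℝ} (hv : v ≠ 0) :
    pr v ∈ negLocus F ↔ eval v F < 0 := by
  obtain ⟨c, hc, h⟩ := exists_eval_rep_pr hF hv
  simp only [negLocus, mem_ofPred_eq, h]
  exact ⟨fun h => by_contra fun h' => absurd (mul_nonneg hc.le (not_lt.1 h')) (not_le.2 h),
    fun h => mul_neg_of_pos_of_neg hc h⟩

lemma continuous_eval (F : MvPolynomial (Fin 3) ℝ) : Continuous fun v => eval v F :=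
  MvPolynomial.continuous_eval F

lemma isOpen_of_forall_pr {S : Set RP2} (h : ∀ v, v ≠ 0 → pr v ∈ S → ∀ᶠ w in 𝓝 v, pr w ∈ S) :
    IsOpen S := by
  rw [isOpen_iff_mem_nhds]
  intro P hP
  obtain ⟨v, hv, rfl⟩ := exists_pr_eq P
  exact (eventually_nhds_pr hv).2 (h v hv hP)

lemma isOpen_posLocus {F : MvPolynomial (Fin 3) ℝ} (hF : F.IsHomogeneous 4) :
    IsOpen (posLocus F) := by
  refine isOpen_of_forall_pr fun v hv h => ?_
  rw [pr_mem_posLocus hF hv] at h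
  filter_upwards [(continuous_eval F).continuousAt.eventually (lt_mem_nhds h),
    isOpen_ne.mem_nhds hv] with w hw hw0
  exact (pr_mem_posLocus hF hw0).2 hw

lemma posLocus_neg (F : MvPolynomial (Fin 3) ℝ) : posLocus (-F) = negLocus F := by
  simp [posLocus, negLocus]

lemma isOpen_negLocus {F : MvPolynomial (Fin 3) ℝ} (hF : F.IsHomogeneous 4) :
    IsOpen (negLocus F) := posLocus_neg F ▸ isOpen_posLocus hF.neg

lemma mem_trichotomy (F : MvPolynomial (Fin 3) ℝ) (P : RP2) :
    P ∈ posLocus F ∨ P ∈ negLocus F ∨ P ∈ zeroLocus F := by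
  rcases lt_trichotomy (eval P.rep F) 0 with h | h | h
  · exact .inr (.inl h)
  · exact .inr (.inr h)
  · exact .inl h

lemma compl_zeroLocus (F : MvPolynomial (Fin 3) ℝ) :
    (zeroLocus F)ᶜ = posLocus F ∪ negLocus F := by
  ext P
  simp only [zeroLocus, posLocus, negLocus, mem_compl_iff, mem_ofPred_eq, mem_union]
  rw [← ne_eq, ne_iff_lt_or_gt, or_comm]

lemma disjoint_posLocus_negLocus (F : MvPolynomial (Fin 3) ℝ) :
    Disjoint (posLocus F) (negLocus F) :=
  disjoint_left.2 fun P (hp : 0 < eval P.rep F) (hn : eval P.rep F < 0) => lt_asymm hp hn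

/-! ### The two sides of a smooth curve -/

/-- The set `H` has a single local branch at `c`: arbitrarily small neighbourhoods of `c` meet `H`
in a connected set. -/
def IsSideAt {X : Type*} [TopologicalSpace X] (H : Set X) (c : X) : Prop :=
  ∀ V ∈ 𝓝 c, ∃ W ∈ 𝓝 c, W ⊆ V ∧ IsConnected (W ∩ H)

lemma IsSideAt.frequently {X : Type*} [TopologicalSpace X] {H : Set X} {c : X}
    (h : IsSideAt H c) : ∃ᶠ x in 𝓝 c, x ∈ H := by
  rw [frequently_iff]
  intro V hV
  obtain ⟨W, -, hWV, ⟨x, hx⟩, -⟩ := h V hV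
  exact ⟨x, hWV hx.1, hx.2⟩

/-- The implicit function theorem gives a local chart in which `f` is the first coordinate. There
the positive side of a small ball is the intersection of the ball with a half-space, which is
convex. -/
lemma isSideAt_pos_of_hasStrictFDerivAt {E : Type*} [NormedAddCommGroup E] [NormedSpace ℝ E]
    [CompleteSpace E] {f : E → ℝ} {f' : E →L[ℝ] ℝ} {a : E} (hf : HasStrictFDerivAt f f' a)
    (hf' : f' ≠ 0) (ha : f a = 0) : IsSideAt {x | 0 < f x} a := by
  intro V hV
  have hr : f'.range = ⊤ := LinearMap.range_eq_top.2 (LinearMap.surjective fun h0 =>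
    hf' (ContinuousLinearMap.coe_injective h0))
  set e := hf.implicitToOpenPartialHomeomorph f f' hr
  have hea : e a = (0, 0) := by rw [hf.implicitToOpenPartialHomeomorph_self hr, ha]
  have has : a ∈ e.source := hf.mem_implicitToOpenPartialHomeomorph_source hr
  have het : e a ∈ e.target := e.map_source has
  have hsymm : e.symm (e a) = a := e.left_inv has
  have hVt : e.target ∩ e.symm ⁻¹' V ∈ 𝓝 (e a) := by
    refine inter_mem (e.open_target.mem_nhds het) ?_
    exact (e.symm.continuousAt (by simpa using het)).preimage_mem_nhds (by rwa [hsymm])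
  obtain ⟨r, hr0, hrV⟩ := Metric.mem_nhds_iff.1 hVt
  have hB : Metric.ball (e a) r ⊆ e.target := fun z hz => (hrV hz).1
  refine ⟨e.symm '' Metric.ball (e a) r, ?_, ?_, ?_⟩
  · have := e.symm.image_mem_nhds (x := e a) (by simpa using het) (Metric.ball_mem_nhds _ hr0)
    rwa [hsymm] at this
  · rintro _ ⟨z, hz, rfl⟩
    exact (hrV hz).2
  · have hfe : ∀ z ∈ e.target, f (e.symm z) = z.1 := by
      intro z hz
      conv_rhs => rw [← e.right_inv hz]
      rfl
    have himg : e.symm '' Metric.ball (e a) r ∩ {x | 0 < f x} =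
        e.symm '' (Metric.ball (e a) r ∩ {z | 0 < z.1}) := by
      ext x
      constructor
      · rintro ⟨⟨z, hz, rfl⟩, hx⟩
        exact ⟨z, ⟨hz, by simpa [hfe z (hB hz)] using hx⟩, rfl⟩
      · rintro ⟨z, ⟨hz, hz'⟩, rfl⟩
        exact ⟨⟨z, hz, rfl⟩, by simpa [hfe z (hB hz)] using hz'⟩
    rw [himg]
    have hconn : IsConnected (Metric.ball (e a) r ∩ {z | 0 < z.1}) := by
      refine ⟨⟨((r / 2 : ℝ), 0), ?_, ?_⟩, ?_⟩
      · rw [hea, Metric.mem_ball, dist_eq_norm]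
        simp [Prod.norm_def, abs_of_pos hr0, hr0]
      · simpa using hr0
      · refine Convex.isPreconnected ((convex_ball _ _).inter ?_)
        exact convex_halfSpace_gt (f := fun z : ℝ × f'.ker => z.1)
          ⟨fun _ _ => rfl, fun _ _ => rfl⟩ 0
    exact hconn.image _ (e.symm.continuousOn.mono fun z hz => by simpa using hB hz.1)

lemma exists_hasStrictFDerivAt_eval (F : MvPolynomial (Fin 3) ℝ) (v : Fin 3 → ℝ) :
    ∃ f' : (Fin 3 → ℝ) →L[ℝ] ℝ, HasStrictFDerivAt (fun w => eval w F) f' v ∧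
      ∀ i, f' (Pi.single i 1) = eval v (pderiv i F) := by
  induction F using MvPolynomial.induction_on with
  | C a => exact ⟨0, by simpa using hasStrictFDerivAt_const a v, by simp⟩
  | add p q hp hq =>
    obtain ⟨p', hp, hp'⟩ := hp
    obtain ⟨q', hq, hq'⟩ := hq
    exact ⟨p' + q', by simpa using hp.fun_add hq, by simp [hp', hq']⟩
  | mul_X p j hp =>
    obtain ⟨p', hp, hp'⟩ := hp
    have hX : HasStrictFDerivAt (fun w : Fin 3 → ℝ => w j)
      (ContinuousLinearMap.proj (R := ℝ) (φ := fun _ : Fin 3 => ℝ) j) v :=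
      hasStrictFDerivAt_apply j v
    refine ⟨_, by simpa using hp.fun_mul hX, fun i => ?_⟩
    simp [hp', pderiv_X, Pi.single_apply]
    split_ifs <;> simp_all

lemma IsSideAt.pr {H : Set RP2} {K : Set (Fin 3 → ℝ)} {v : Fin 3 → ℝ} (hv : v ≠ 0)
    (hHK : ∀ w, w ≠ 0 → (pr w ∈ H ↔ w ∈ K)) (h : IsSideAt K v) : IsSideAt H (pr v) := by
  intro V hV
  rw [← map_pr_nhds hv, mem_map] at hV
  obtain ⟨W, hW, hWV, hc⟩ := h _ (inter_mem hV (isOpen_ne.mem_nhds hv))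
  refine ⟨RealQuartic.pr '' W, ?_, ?_, ?_⟩
  · rw [← map_pr_nhds hv]; exact image_mem_map hW
  · rintro _ ⟨w, hw, rfl⟩; exact (hWV hw).1
  · convert hc.image RealQuartic.pr (continuousOn_pr.mono fun w hw => (hWV hw.1).2)
    ext P
    constructor
    · rintro ⟨⟨w, hw, rfl⟩, hP⟩
      exact ⟨w, ⟨hw, (hHK w (hWV hw).2).1 hP⟩, rfl⟩
    · rintro ⟨w, ⟨hw, hw'⟩, rfl⟩
      exact ⟨⟨w, hw, rfl⟩, (hHK w (hWV hw).2).2 hw'⟩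

section Smooth

variable {F : MvPolynomial (Fin 3) ℝ}

lemma IsSmoothCurve.exists_pderiv_ne_zero (hs : IsSmoothCurve F) {v : Fin 3 → ℝ} (hv : v ≠ 0)
    (h : eval v F = 0) : ∃ i, eval v (pderiv i F) ≠ 0 := by
  have key : ∀ G : MvPolynomial (Fin 3) ℝ, aeval (fun i => (v i : ℂ)) G = (eval v G : ℂ) := by
    intro G
    have := aeval_algebraMap_apply ℂ v G
    simpa [coe_aeval_eq_eval, Function.comp_def] using this
  obtain ⟨i, hi⟩ := hs (fun i => (v i : ℂ)) (fun h0 => hv (by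
    ext i; simpa using congrFun h0 i)) (by rw [key, h]; simp)
  exact ⟨i, fun h0 => hi (by rw [key, h0]; simp)⟩

lemma IsSmoothCurve.neg (hs : IsSmoothCurve F) : IsSmoothCurve (-F) := by
  intro v hv h
  obtain ⟨i, hi⟩ := hs v hv (by simpa using h)
  exact ⟨i, by simpa using hi⟩

lemma IsSmoothCurve.isSideAt_pos_cone (hs : IsSmoothCurve F) {v : Fin 3 → ℝ} (hv : v ≠ 0)
    (h : eval v F = 0) : IsSideAt {w | 0 < eval w F} v := by
  obtain ⟨f', hf', hd⟩ := exists_hasStrictFDerivAt_eval F v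
  obtain ⟨i, hi⟩ := hs.exists_pderiv_ne_zero hv h
  exact isSideAt_pos_of_hasStrictFDerivAt hf' (fun h0 => hi (by rw [← hd, h0]; rfl)) h

lemma IsSmoothCurve.isSideAt_neg_cone (hs : IsSmoothCurve F) {v : Fin 3 → ℝ} (hv : v ≠ 0)
    (h : eval v F = 0) : IsSideAt {w | eval w F < 0} v := by
  simpa using hs.neg.isSideAt_pos_cone hv (by simpa using h)

lemma IsSmoothCurve.isSideAt_posLocus (hs : IsSmoothCurve F) (hF : F.IsHomogeneous 4) {P : RP2}
    (h : P ∈ zeroLocus F) : IsSideAt (posLocus F) P := by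
  obtain ⟨v, hv, rfl⟩ := exists_pr_eq P
  exact (hs.isSideAt_pos_cone hv ((pr_mem_zeroLocus hF hv).1 h)).pr hv
    fun w hw => pr_mem_posLocus hF hw

lemma IsSmoothCurve.isSideAt_negLocus (hs : IsSmoothCurve F) (hF : F.IsHomogeneous 4) {P : RP2}
    (h : P ∈ zeroLocus F) : IsSideAt (negLocus F) P := by
  obtain ⟨v, hv, rfl⟩ := exists_pr_eq P
  exact (hs.isSideAt_neg_cone hv ((pr_mem_zeroLocus hF hv).1 h)).pr hv
    fun w hw => pr_mem_negLocus hF hw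

end Smooth

/-- Along a connected set `C`, a side `H` lies in only one of two disjoint open sets. -/
lemma side_subset_or_subset {X : Type*} [TopologicalSpace X] {C H A B : Set X}
    (hC : IsPreconnected C) (hH : ∀ c ∈ C, IsSideAt H c) (hA : IsOpen A) (hB : IsOpen B)
    (hAB : Disjoint A B) (hcov : ∀ c ∈ C, ∀ᶠ x in 𝓝 c, x ∈ H → x ∈ A ∪ B) :
    (∀ c ∈ C, ∀ᶠ x in 𝓝 c, x ∈ H → x ∈ A) ∨ (∀ c ∈ C, ∀ᶠ x in 𝓝 c, x ∈ H → x ∈ B) := by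
  have hop : ∀ A : Set X, IsOpen {c | ∀ᶠ x in 𝓝 c, x ∈ H → x ∈ A} := fun A => 
    isOpen_setOfPred_eventually_nhds
  -- The side has a single branch at each point of `C`, so locally it lies in `A` or in `B`. Both
  -- conditions on the point are open; a point satisfying both would have nearby elements of `H` in
  -- `A ∩ B`. Connectedness of `C` then leaves only one alternative.
  have hcov' : C ⊆ {c | ∀ᶠ x in 𝓝 c, x ∈ H → x ∈ A} ∪ {c | ∀ᶠ x in 𝓝 c, x ∈ H → x ∈ B} := by
    intro c hc
    obtain ⟨W, hW, hWV, hWc⟩ := hH c hc _ (hcov c hc)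
    rcases hWc.isPreconnected.subset_or_subset hA hB hAB (fun x hx => hWV hx.1 hx.2) with h | h
    · exact .inl (mem_of_superset hW fun x hx hxH => h ⟨hx, hxH⟩)
    · exact .inr (mem_of_superset hW fun x hx hxH => h ⟨hx, hxH⟩)
  by_contra hcon
  rw [not_or] at hcon
  obtain ⟨c, hc⟩ := not_forall.1 hcon.1
  obtain ⟨d, hd⟩ := not_forall.1 hcon.2
  rw [Classical.not_imp] at hc hd
  obtain ⟨x, hx, hxA, hxB⟩ := hC _ _ (hop A) (hop B) hcov'
    ⟨d, hd.1, (hcov' hd.1).resolve_right hd.2⟩ ⟨c, hc.1, (hcov' hc.1).resolve_left hc.2⟩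
  obtain ⟨y, hy, hyA, hyB⟩ := ((hH x hx).frequently.and_eventually
    (Filter.Eventually.and hxA hxB)).exists
  exact disjoint_left.1 hAB (hyA hy) (hyB hy)

/-! ### Curves that are unions of separating ovals -/

/-- The real locus of the smooth quartic `F` is the union of the disjoint ovals `C i`, and the
complement of `C i` is the union of the open sets `Dp i` and `Dn i`, of which the first contains
the positive side and the second the negative side of `C i`. -/
structure OvalSystem (F : MvPolynomial (Fin 3) ℝ) (C Dp Dn : Fin 4 → Set RP2) : Prop where
  isHomogeneous : F.IsHomogeneous 4
  smooth : IsSmoothCurve F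
  isPreconnected : ∀ i, IsPreconnected (C i)
  nonempty : ∀ i, (C i).Nonempty
  isClosed : ∀ i, IsClosed (C i)
  disjoint : Pairwise fun i j => Disjoint (C i) (C j)
  iUnion_eq : ⋃ i, C i = zeroLocus F
  isOpen_Dp : ∀ i, IsOpen (Dp i)
  isOpen_Dn : ∀ i, IsOpen (Dn i)
  disjoint_Dp_Dn : ∀ i, Disjoint (Dp i) (Dn i)
  union_eq : ∀ i, Dp i ∪ Dn i = (C i)ᶜ
  pos_side : ∀ i, ∀ c ∈ C i, ∀ᶠ x in 𝓝 c, x ∈ posLocus F → x ∈ Dp i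
  neg_side : ∀ i, ∀ c ∈ C i, ∀ᶠ x in 𝓝 c, x ∈ negLocus F → x ∈ Dn i

lemma eventually_mem_of_mem_zeroLocus {F : MvPolynomial (Fin 3) ℝ} {C : Fin 4 → Set RP2}
    (hcl : ∀ i, IsClosed (C i)) (hdisj : Pairwise fun i j => Disjoint (C i) (C j))
    (hU : ⋃ i, C i = zeroLocus F) {i : Fin 4} {c : RP2} (hc : c ∈ C i) :
    ∀ᶠ x in 𝓝 c, x ∈ zeroLocus F → x ∈ C i := by
  have : ∀ᶠ x in 𝓝 c, ∀ j, j ≠ i → x ∉ C j := by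
    rw [eventually_all]
    intro j
    by_cases hj : j = i
    · simp [hj]
    · filter_upwards [(hcl j).isOpen_compl.mem_nhds (disjoint_left.1 (hdisj (Ne.symm hj)) hc)]
        with x hx _ using hx
  filter_upwards [this] with x hx hxF
  rw [← hU, mem_iUnion] at hxF
  obtain ⟨j, hj⟩ := hxF
  by_cases hji : j = i
  · exact hji ▸ hj
  · exact absurd hj (hx j hji)

/-- Take a separation of the complement of an oval `C i`. Each sign's side of the curve lies in one
part all along `C i`. If both sides lay in the same part `A`, then `A ∪ C i` would be open and would
form, with the other part, a separation of the whole projective plane. So the parts can be named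
after the sign of `F` next to the oval; they need not be connected. -/
lemma exists_ovalSystem {F : MvPolynomial (Fin 3) ℝ} (hF : F.IsHomogeneous 4)
    (hs : IsSmoothCurve F) (ho : ConsistsOfOvals 4 (zeroLocus F)) :
    ∃ C Dp Dn, OvalSystem F C Dp Dn := by
  obtain ⟨C, hC, hdisj, hU⟩ := ho
  have hconn : ∀ i, IsConnected (C i) := by
    intro i
    obtain ⟨φ⟩ := (hC i).1
    have : ConnectedSpace (C i) := φ.symm.surjective.connectedSpace φ.symm.continuous
    exact isConnected_iff_connectedSpace.2 this
  have hcl : ∀ i, IsClosed (C i) := by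
    intro i
    obtain ⟨φ⟩ := (hC i).1
    have : CompactSpace (C i) := φ.symm.compactSpace
    exact (isCompact_iff_compactSpace.2 this).isClosed
  have hCF : ∀ i, C i ⊆ zeroLocus F := fun i => hU ▸ subset_iUnion C i
  have hposC : ∀ i, posLocus F ⊆ (C i)ᶜ := fun i P hP hPC =>
    (compl_zeroLocus F ▸ Or.inl hP : P ∈ (zeroLocus F)ᶜ) (hCF i hPC)
  have hnegC : ∀ i, negLocus F ⊆ (C i)ᶜ := fun i P hP hPC =>
    (compl_zeroLocus F ▸ Or.inr hP : P ∈ (zeroLocus F)ᶜ) (hCF i hPC)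
  -- The two sides cannot lie in the same part of a separation of the complement.
  have not_same : ∀ i, ∀ A B : Set RP2, IsOpen A → IsOpen B → Disjoint A B → A ∪ B = (C i)ᶜ →
      B.Nonempty → (∀ c ∈ C i, ∀ᶠ x in 𝓝 c, x ∈ posLocus F → x ∈ A) →
      (∀ c ∈ C i, ∀ᶠ x in 𝓝 c, x ∈ negLocus F → x ∈ A) → False := by
    intro i A B hA hB hAB hcov hBn hp hn
    have hopen : IsOpen (A ∪ C i) := by
      rw [isOpen_iff_mem_nhds]
      rintro x (hx | hx)
      · exact mem_of_superset (hA.mem_nhds hx) subset_union_left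
      · filter_upwards [hp x hx, hn x hx, eventually_mem_of_mem_zeroLocus hcl hdisj hU hx]
          with y h1 h2 h3
        rcases mem_trichotomy F y with h | h | h
        · exact .inl (h1 h)
        · exact .inl (h2 h)
        · exact .inr (h3 h)
    obtain ⟨x, -, hx, hx'⟩ := (isPreconnected_univ (α := RP2)) _ _ hopen hB
      (fun x _ => by
        by_cases hxC : x ∈ C i
        · exact .inl (.inr hxC)
        · rcases (hcov ▸ hxC : x ∈ A ∪ B) with h | h
          · exact .inl (.inl h)
          · exact .inr h)
      (by
        obtain ⟨c, hc⟩ := (hconn i).nonempty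
        exact ⟨c, mem_univ c, .inr hc⟩)
      (by simpa using hBn)
    rcases hx with hx | hx
    · exact disjoint_left.1 hAB hx hx'
    · exact (hcov ▸ (Or.inr hx' : x ∈ A ∪ B) : x ∈ (C i)ᶜ) hx
  have key : ∀ i, ∃ Dp Dn : Set RP2, IsOpen Dp ∧ IsOpen Dn ∧ Disjoint Dp Dn ∧
      Dp ∪ Dn = (C i)ᶜ ∧ (∀ c ∈ C i, ∀ᶠ x in 𝓝 c, x ∈ posLocus F → x ∈ Dp) ∧
      ∀ c ∈ C i, ∀ᶠ x in 𝓝 c, x ∈ negLocus F → x ∈ Dn := by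
    intro i
    have := (hC i).2
    rw [IsPreconnected] at this
    push Not at this
    obtain ⟨A, B, hA, hB, hcov, ⟨a, haC, haA⟩, ⟨b, hbC, hbB⟩, hAB⟩ := this
    have hA' := hA.inter (hcl i).isOpen_compl
    have hB' := hB.inter (hcl i).isOpen_compl
    have hdis : Disjoint (A ∩ (C i)ᶜ) (B ∩ (C i)ᶜ) := by
      rw [disjoint_left]
      rintro x ⟨hx, hxC⟩ ⟨hx', -⟩
      exact (hAB ▸ ⟨hxC, hx, hx'⟩ : x ∈ (∅ : Set RP2))
    have hun : A ∩ (C i)ᶜ ∪ B ∩ (C i)ᶜ = (C i)ᶜ := by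
      rw [← union_inter_distrib_right]
      exact inter_eq_right.2 hcov
    have hun' : B ∩ (C i)ᶜ ∪ A ∩ (C i)ᶜ = (C i)ᶜ := by rw [union_comm, hun]
    have hp := side_subset_or_subset (hconn i).isPreconnected
      (fun c hc => hs.isSideAt_posLocus hF (hCF i hc)) hA' hB' hdis
      (fun c _ => Eventually.of_forall fun x hx => hun.ge (hposC i hx))
    have hn := side_subset_or_subset (hconn i).isPreconnected
      (fun c hc => hs.isSideAt_negLocus hF (hCF i hc)) hA' hB' hdis
      (fun c _ => Eventually.of_forall fun x hx => hun.ge (hnegC i hx))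
    rcases hp with hp | hp <;> rcases hn with hn | hn
    · exact (not_same i _ _ hA' hB' hdis hun ⟨b, hbB, hbC⟩ hp hn).elim
    · exact ⟨_, _, hA', hB', hdis, hun, hp, hn⟩
    · exact ⟨_, _, hB', hA', hdis.symm, hun', hp, hn⟩
    · exact (not_same i _ _ hB' hA' hdis.symm hun' ⟨a, haA, haC⟩ hp hn).elim
  choose Dp Dn h1 h2 h3 h4 h5 h6 using key
  exact ⟨C, Dp, Dn, hF, hs, fun i => (hconn i).isPreconnected, fun i => (hconn i).nonempty, hcl,
    hdisj, hU, h1, h2, h3, h4, h5, h6⟩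

namespace OvalSystem

variable {F : MvPolynomial (Fin 3) ℝ} {C Dp Dn : Fin 4 → Set RP2}

lemma subset_zeroLocus (h : OvalSystem F C Dp Dn) (i : Fin 4) : C i ⊆ zeroLocus F :=
  h.iUnion_eq ▸ subset_iUnion C i

lemma isClosed_zeroLocus (h : OvalSystem F C Dp Dn) : IsClosed (zeroLocus F) :=
  h.iUnion_eq ▸ isClosed_iUnion_of_finite h.isClosed

end OvalSystem

/-! ### Existence of a non-orientable component -/

/-- The sign `s` extends continuously over the zero `v` of `F`. -/
def AgreesAt (F : MvPolynomial (Fin 3) ℝ) (s : (Fin 3 → ℝ) → ℤˣ) (v : Fin 3 → ℝ) : Prop :=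
  ∃ ε, ∀ᶠ x in 𝓝 v, eval x F ≠ 0 → s x = ε

/-- The sign `s` changes with the sign of `F` at the zero `v` of `F`. -/
def DisagreesAt (F : MvPolynomial (Fin 3) ℝ) (s : (Fin 3 → ℝ) → ℤˣ) (v : Fin 3 → ℝ) : Prop :=
  ∃ ε, ∀ᶠ x in 𝓝 v, (0 < eval x F → s x = ε) ∧ (eval x F < 0 → s x = -ε)

/-- An odd, locally constant sign on the complement of the cone over the curve `F = 0`. -/
structure IsOddSign (F : MvPolynomial (Fin 3) ℝ) (s : (Fin 3 → ℝ) → ℤˣ) : Prop where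
  smul : ∀ v, eval v F ≠ 0 → ∀ c : ℝ, c ≠ 0 → s (c • v) = unitSign c * s v
  eventually_eq : ∀ v, eval v F ≠ 0 → ∀ᶠ x in 𝓝 v, s x = s v

lemma eventually_nhds_smul {c : ℝ} (hc : c ≠ 0) {v : Fin 3 → ℝ} {p : (Fin 3 → ℝ) → Prop}
    (h : ∀ᶠ x in 𝓝 v, p (c • x)) : ∀ᶠ x in 𝓝 (c • v), p x := by
  have : Tendsto (fun x : Fin 3 → ℝ => c⁻¹ • x) (𝓝 (c • v)) (𝓝 v) := by
    have := (continuous_const_smul c⁻¹).tendsto (c • v)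
    rwa [inv_smul_smul₀ hc] at this
  filter_upwards [this.eventually h] with x hx
  rwa [smul_inv_smul₀ hc] at hx

section Sign

variable {F : MvPolynomial (Fin 3) ℝ} {s : (Fin 3 → ℝ) → ℤˣ}

lemma AgreesAt.smul (hF : F.IsHomogeneous 4) (hs : IsOddSign F s) {v : Fin 3 → ℝ}
    (h : AgreesAt F s v) {c : ℝ} (hc : c ≠ 0) : AgreesAt F s (c • v) := by
  obtain ⟨ε, h⟩ := h
  refine ⟨unitSign c * ε, eventually_nhds_smul hc ?_⟩
  filter_upwards [h] with x hx hxF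
  rw [eval_smul_of_isHomogeneous hF] at hxF
  have hx0 : eval x F ≠ 0 := right_ne_zero_of_mul hxF
  rw [hs.smul x hx0 c hc, hx hx0]

lemma DisagreesAt.smul (hF : F.IsHomogeneous 4) (hs : IsOddSign F s) {v : Fin 3 → ℝ}
    (h : DisagreesAt F s v) {c : ℝ} (hc : c ≠ 0) : DisagreesAt F s (c • v) := by
  obtain ⟨ε, h⟩ := h
  refine ⟨unitSign c * ε, eventually_nhds_smul hc ?_⟩
  have hc4 : 0 < c ^ 4 := by positivity
  filter_upwards [h] with x hx
  rw [eval_smul_of_isHomogeneous hF]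
  constructor
  · intro hxF
    have hx0 := (mul_pos_iff_of_pos_left hc4).1 hxF
    rw [hs.smul x hx0.ne' c hc, hx.1 hx0]
  · intro hxF
    have hx0 : eval x F < 0 := by
      by_contra h'
      exact absurd (mul_nonneg hc4.le (not_lt.1 h')) (not_le.2 hxF)
    rw [hs.smul x hx0.ne c hc, hx.2 hx0, mul_neg]

/-- A locally constant sign is constant on the single branch of `{F > 0}` at `v` and on that of `{F
< 0}`, and two units of `ℤ` are equal or opposite. -/
lemma agreesAt_or_disagreesAt (hsm : IsSmoothCurve F) (hs : IsOddSign F s) {v : Fin 3 → ℝ}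
    (hv : v ≠ 0) (h : eval v F = 0) : AgreesAt F s v ∨ DisagreesAt F s v := by
  have hopen : ∀ ε, IsOpen {x | eval x F ≠ 0 ∧ s x = ε} := by
    intro ε
    rw [isOpen_iff_mem_nhds]
    rintro x ⟨hx, hxε⟩
    filter_upwards [hs.eventually_eq x hx, (continuous_eval F).continuousAt.eventually_ne hx]
      with y hy hy0 using ⟨hy0, hy.trans hxε⟩
  have key : ∀ H : Set (Fin 3 → ℝ), (∀ x ∈ H, eval x F ≠ 0) → IsSideAt H v →
      ∃ ε, ∀ᶠ x in 𝓝 v, x ∈ H → s x = ε := by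
    intro H hH hside
    rcases side_subset_or_subset (C := {v}) isPreconnected_singleton (by simpa using hside)
      (hopen 1) (hopen (-1))
      (disjoint_left.2 fun x hx hx' => by simpa [hx.2] using hx'.2)
      (by
        rintro c -
        refine Eventually.of_forall fun x hx => ?_
        rcases Int.units_eq_one_or (s x) with h | h
        · exact .inl ⟨hH x hx, h⟩
        · exact .inr ⟨hH x hx, h⟩) with h | h
    · exact ⟨1, (h v rfl).mono fun x hx hxH => (hx hxH).2⟩
    · exact ⟨-1, (h v rfl).mono fun x hx hxH => (hx hxH).2⟩
  obtain ⟨a, ha⟩ := key _ (fun x (hx : 0 < eval x F) => hx.ne') (hsm.isSideAt_pos_cone hv h)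
  obtain ⟨b, hb⟩ := key _ (fun x (hx : eval x F < 0) => hx.ne) (hsm.isSideAt_neg_cone hv h)
  by_cases hab : b = a
  · subst hab
    refine .inl ⟨b, ?_⟩
    filter_upwards [ha, hb] with x hxa hxb hx
    rcases hx.lt_or_gt with hx | hx
    · exact hxb hx
    · exact hxa hx
  · have hab : b = -a := (Int.units_ne_iff_eq_neg).1 hab
    refine .inr ⟨a, ?_⟩
    filter_upwards [ha, hb] with x hxa hxb
    exact ⟨hxa, fun hx => hab ▸ hxb hx⟩

lemma not_agreesAt_and_disagreesAt (hsm : IsSmoothCurve F) {v : Fin 3 → ℝ}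
    (hv : v ≠ 0) (h : eval v F = 0) (h1 : AgreesAt F s v) (h2 : DisagreesAt F s v) : False := by
  obtain ⟨a, ha⟩ := h1
  obtain ⟨b, hb⟩ := h2
  obtain ⟨x, hx, hxa, hxb⟩ := ((hsm.isSideAt_pos_cone hv h).frequently.and_eventually
    (ha.and hb)).exists
  obtain ⟨y, hy, hya, hyb⟩ := ((hsm.isSideAt_neg_cone hv h).frequently.and_eventually
    (ha.and hb)).exists
  have e1 : a = b := (hxa (ne_of_gt hx)).symm.trans (hxb.1 hx)
  have e2 : a = -b := (hya (ne_of_lt hy)).symm.trans (hyb.2 hy)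
  rw [e1] at e2
  rcases Int.units_eq_one_or b with rfl | rfl <;> simp at e2

/-- A sign that extends over the whole curve would be an odd locally constant sign on
`ℝ³ ∖ {0}`. -/
lemma IsOddSign.exists_not_agreesAt (hF : F.IsHomogeneous 4) (hsm : IsSmoothCurve F)
    (hs : IsOddSign F s) : ∃ v, v ≠ 0 ∧ eval v F = 0 ∧ ¬ AgreesAt F s v := by
  by_contra! hcon
  have hall : ∀ v, v ≠ 0 → AgreesAt F s v := by
    intro v hv
    by_cases h : eval v F = 0
    · exact hcon v hv h
    · exact ⟨s v, (hs.eventually_eq v h).mono fun x hx _ => hx⟩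
  have hfreq : ∀ v, v ≠ 0 → ∃ᶠ x in 𝓝 v, eval x F ≠ 0 := by
    intro v hv
    by_cases h : eval v F = 0
    · exact (hsm.isSideAt_pos_cone hv h).frequently.mono fun x hx => ne_of_gt hx
    · exact ((continuous_eval F).continuousAt.eventually_ne h).frequently
  -- The points at which the extended sign is `ε`. These two open sets cover `ℝ³ ∖ {0}` and the
  -- antipodal map exchanges them, so both are nonempty; connectedness gives a point in both, near
  -- which `s` would be both `1` and `-1`.
  let S : ℤˣ → Set (Fin 3 → ℝ) := fun ε => {v | ∀ᶠ x in 𝓝 v, eval x F ≠ 0 → s x = ε}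
  have hopen : ∀ ε, IsOpen (S ε) := fun ε => isOpen_setOfPred_eventually_nhds
  have hneg : ∀ ε v, v ∈ S ε → -v ∈ S (-ε) := by
    intro ε v hv
    have : ∀ᶠ x in 𝓝 ((-1 : ℝ) • v), eval x F ≠ 0 → s x = -ε := by
      refine eventually_nhds_smul (by norm_num) ?_
      filter_upwards [hv] with x hx hxF
      rw [eval_smul_of_isHomogeneous hF] at hxF
      have hx0 : eval x F ≠ 0 := right_ne_zero_of_mul hxF
      rw [hs.smul x hx0 _ (by norm_num), hx hx0, unitSign_of_neg (by norm_num), neg_one_mul]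
    rwa [neg_one_smul] at this
  have hcov : ∀ v, v ≠ 0 → v ∈ S 1 ∨ v ∈ S (-1) := by
    intro v hv
    obtain ⟨ε, hε⟩ := hall v hv
    rcases Int.units_eq_one_or ε with rfl | rfl
    · exact .inl hε
    · exact .inr hε
  have h1 : (1 : Fin 3 → ℝ) ≠ 0 := one_ne_zero
  have hne : ({v | v ≠ 0} ∩ S 1).Nonempty ∧ ({v | v ≠ 0} ∩ S (-1)).Nonempty := by
    rcases hcov 1 h1 with h | h
    · exact ⟨⟨1, h1, h⟩, ⟨-1, neg_ne_zero.2 h1, hneg _ _ h⟩⟩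
    · exact ⟨⟨-1, neg_ne_zero.2 h1, by simpa using hneg _ _ h⟩, ⟨1, h1, h⟩⟩
  obtain ⟨v, hv, hv1, hv2⟩ := isConnected_ne_zero.isPreconnected _ _ (hopen 1) (hopen (-1))
    hcov hne.1 hne.2
  obtain ⟨x, hx, hx1, hx2⟩ := ((hfreq v hv).and_eventually (Filter.Eventually.and hv1 hv2)).exists
  have := (hx1 hx).symm.trans (hx2 hx)
  simp at this

end Sign

/-! ### Repairing a sign along the ovals -/

namespace OvalSystem

variable {F : MvPolynomial (Fin 3) ℝ} {C Dp Dn : Fin 4 → Set RP2}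

lemma ne_zero_of_eval_ne_zero (h : OvalSystem F C Dp Dn) {v : Fin 3 → ℝ} (hv : eval v F ≠ 0) :
    v ≠ 0 := by
  rintro rfl
  have := eval_smul_of_isHomogeneous h.isHomogeneous 0 (0 : Fin 3 → ℝ)
  simp only [zero_smul] at this
  rw [this] at hv
  simp at hv

lemma pr_mem_Dp_or_Dn (h : OvalSystem F C Dp Dn) {P : RP2} {i : Fin 4} (hP : P ∉ C i) :
    P ∈ Dp i ∨ P ∈ Dn i := (h.union_eq i).ge hP

lemma not_mem_of_eval_ne_zero (h : OvalSystem F C Dp Dn) {v : Fin 3 → ℝ} (hv : eval v F ≠ 0)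
    (i : Fin 4) : pr v ∉ C i := fun hc =>
  hv ((pr_mem_zeroLocus h.isHomogeneous (h.ne_zero_of_eval_ne_zero hv)).1
    (h.subset_zeroLocus i hc))

open Classical in
/-- The sign `s`, reversed on the negative side of an oval. -/
def flipSign (D : Set RP2) (s : (Fin 3 → ℝ) → ℤˣ) (v : Fin 3 → ℝ) : ℤˣ :=
  if pr v ∈ D then -s v else s v

/-- Away from `C i`, membership in `Dn i` is locally constant. Reversing the sign there therefore
does not affect whether it extends across the other ovals. -/
lemma eventually_flipSign (h : OvalSystem F C Dp Dn) {s : (Fin 3 → ℝ) → ℤˣ} {i : Fin 4}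
    {v : Fin 3 → ℝ} (hv0 : v ≠ 0) (hv : pr v ∉ C i) :
    ∃ δ : ℤˣ, ∀ᶠ x in 𝓝 v, flipSign (Dn i) s x = δ * s x := by
  rcases h.pr_mem_Dp_or_Dn hv with hD | hD
  · refine ⟨1, ?_⟩
    filter_upwards [(continuousAt_pr hv0).eventually ((h.isOpen_Dp i).mem_nhds hD)] with x hx
    simp [flipSign, disjoint_left.1 (h.disjoint_Dp_Dn i) hx]
  · refine ⟨-1, ?_⟩
    filter_upwards [(continuousAt_pr hv0).eventually ((h.isOpen_Dn i).mem_nhds hD)] with x hx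
    have hx : pr x ∈ Dn i := hx
    simp [flipSign, hx]

lemma isOddSign_flipSign (h : OvalSystem F C Dp Dn) {s : (Fin 3 → ℝ) → ℤˣ} (hs : IsOddSign F s)
    (i : Fin 4) : IsOddSign F (flipSign (Dn i) s) := by
  refine ⟨fun v hv c hc => ?_, fun v hv => ?_⟩
  · by_cases hD : pr v ∈ Dn i <;> simp [flipSign, pr_smul hc, hs.smul v hv c hc, hD]
  · obtain ⟨δ, hδ⟩ := h.eventually_flipSign (s := s) (h.ne_zero_of_eval_ne_zero hv)
      (h.not_mem_of_eval_ne_zero hv i)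
    filter_upwards [hδ, hs.eventually_eq v hv] with x hx hx'
    rw [hx, hx', hδ.self_of_nhds]

/-- The ovals are treated one at a time. Agreement and disagreement are open conditions, so on a
connected oval one of them holds throughout. A disagreement is turned into an agreement by `flipSign
(Dn i)`, since `Dn i` contains the negative side of the oval and misses its positive side. The sign
stays odd because the set on which it is reversed is pulled back from the projective plane. -/
lemma exists_isOddSign_agreesAt (h : OvalSystem F C Dp Dn) {s : (Fin 3 → ℝ) → ℤˣ}
    (hs : IsOddSign F s) (J : Finset (Fin 4)) :
    ∃ s', IsOddSign F s' ∧ ∀ i ∈ J, ∀ v, v ≠ 0 → pr v ∈ C i → AgreesAt F s' v := by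
  have hF := h.isHomogeneous
  induction J using Finset.induction_on with
  | empty => exact ⟨s, hs, by simp⟩
  | insert i J hi ih =>
    obtain ⟨s, hs, hJ⟩ := ih
    have hzero : ∀ v, v ≠ 0 → pr v ∈ C i → eval v F = 0 := fun v hv hvC =>
      (pr_mem_zeroLocus hF hv).1 (h.subset_zeroLocus i hvC)
    have hopen : ∀ p : ℤˣ → (Fin 3 → ℝ) → Prop,
        IsOpen (pr '' {v | v ≠ 0 ∧ ∃ ε, ∀ᶠ x in 𝓝 v, p ε x}) := by
      intro p
      refine isOpen_image_pr ?_ (by simp)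
      have : {v : Fin 3 → ℝ | ∃ ε, ∀ᶠ x in 𝓝 v, p ε x} = ⋃ ε, {v | ∀ᶠ x in 𝓝 v, p ε x} := by ext; simp
      refine isOpen_ne.inter (t := {v | ∃ ε, ∀ᶠ x in 𝓝 v, p ε x}) ?_
      rw [this]
      exact isOpen_iUnion fun ε => isOpen_setOfPred_eventually_nhds
    have hA : IsOpen (pr '' {v | v ≠ 0 ∧ AgreesAt F s v}) := hopen _
    have hB : IsOpen (pr '' {v | v ≠ 0 ∧ DisagreesAt F s v}) := hopen _
    have hdich : (∀ v, v ≠ 0 → pr v ∈ C i → AgreesAt F s v) ∨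
        (∀ v, v ≠ 0 → pr v ∈ C i → DisagreesAt F s v) := by
      by_contra hcon
      rw [not_or] at hcon
      push Not at hcon
      obtain ⟨⟨v, hv, hvC, hvA⟩, ⟨w, hw, hwC, hwB⟩⟩ := hcon
      have hvB := (agreesAt_or_disagreesAt h.smooth hs hv (hzero v hv hvC)).resolve_left hvA
      have hwA := (agreesAt_or_disagreesAt h.smooth hs hw (hzero w hw hwC)).resolve_right hwB
      obtain ⟨P, hPC, ⟨x, ⟨hx0, hx⟩, rfl⟩, ⟨y, ⟨hy0, hy⟩, hxy⟩⟩ := h.isPreconnected i _ _ hA hB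
        (by
          intro P hP
          obtain ⟨u, hu, rfl⟩ := exists_pr_eq P
          exact (agreesAt_or_disagreesAt h.smooth hs hu (hzero u hu hP)).imp
            (fun h => ⟨u, ⟨hu, h⟩, rfl⟩) (fun h => ⟨u, ⟨hu, h⟩, rfl⟩))
        ⟨_, hwC, w, ⟨hw, hwA⟩, rfl⟩ ⟨_, hvC, v, ⟨hv, hvB⟩, rfl⟩
      obtain ⟨c, hc, rfl⟩ := exists_smul_of_pr_eq hy0 hx0 hxy
      exact not_agreesAt_and_disagreesAt h.smooth hx0 (hzero _ hx0 hPC) hx (hy.smul hF hs hc)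
    rcases hdich with hd | hd
    · refine ⟨s, hs, fun j hj => ?_⟩
      rcases Finset.mem_insert.1 hj with rfl | hj
      · exact hd
      · exact hJ j hj
    · refine ⟨flipSign (Dn i) s, h.isOddSign_flipSign hs i, fun j hj v hv hvC => ?_⟩
      rcases Finset.mem_insert.1 hj with rfl | hjJ
      · obtain ⟨ε, hε⟩ := hd v hv hvC
        refine ⟨ε, ?_⟩
        filter_upwards [hε, (continuousAt_pr hv).eventually (h.pos_side j _ hvC),
          (continuousAt_pr hv).eventually (h.neg_side j _ hvC)] with x hx hp hn hxF
        have hx0 := h.ne_zero_of_eval_ne_zero hxF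
        rcases hxF.lt_or_gt with hlt | hgt
        · have := hn ((pr_mem_negLocus hF hx0).2 hlt)
          simp [flipSign, this, hx.2 hlt]
        · have := hp ((pr_mem_posLocus hF hx0).2 hgt)
          simp [flipSign, disjoint_left.1 (h.disjoint_Dp_Dn j) this, hx.1 hgt]
      · obtain ⟨δ, hδ⟩ := h.eventually_flipSign (s := s) (i := i) hv
          (disjoint_left.1 (h.disjoint (i := j) (j := i) (by rintro rfl; exact hi hjJ)) hvC)
        obtain ⟨ε, hε⟩ := hJ j hjJ v hv hvC
        refine ⟨δ * ε, ?_⟩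
        filter_upwards [hδ, hε] with x hx hx' hxF
        rw [hx, hx' hxF]

lemma not_isOddSign (h : OvalSystem F C Dp Dn) (s : (Fin 3 → ℝ) → ℤˣ) : ¬ IsOddSign F s := by
  intro hs
  obtain ⟨s', hs', hag⟩ := h.exists_isOddSign_agreesAt hs Finset.univ
  obtain ⟨v, hv, hvF, hn⟩ := hs'.exists_not_agreesAt h.isHomogeneous h.smooth
  have : pr v ∈ ⋃ i, C i := h.iUnion_eq ▸ (pr_mem_zeroLocus h.isHomogeneous hv).2 hvF
  obtain ⟨i, hi⟩ := mem_iUnion.1 this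
  exact hn (hag i (Finset.mem_univ i) v hv hi)

/-- Some component of the complement of the curve is not orientable. -/
lemma exists_not_isOrientable (h : OvalSystem F C Dp Dn) : ∃ P ∈ (zeroLocus F)ᶜ,
    ¬ IsOrientable (connectedComponentIn (zeroLocus F)ᶜ P) := by
  by_contra! hcon
  have hopen : ∀ P, IsOpen (connectedComponentIn (zeroLocus F)ᶜ P) := fun P =>
    h.isClosed_zeroLocus.isOpen_compl.connectedComponentIn
  -- The sign is indexed by the component itself, not by a base point, so that nearby points of one
  -- component share the same choice. Sets that are not components get the junk value `1`.
  have hex : ∀ K : Set RP2, ∃ s : (Fin 3 → ℝ) → ℤˣ,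
      (∃ P ∈ (zeroLocus F)ᶜ, K = connectedComponentIn (zeroLocus F)ᶜ P) →
      ∀ v, v ≠ 0 → pr v ∈ K →
      (∀ c : ℝ, c ≠ 0 → s (c • v) = unitSign c * s v) ∧ ∀ᶠ x in 𝓝 v, s x = s v := by
    intro K
    by_cases hK : ∃ P ∈ (zeroLocus F)ᶜ, K = connectedComponentIn (zeroLocus F)ᶜ P
    · obtain ⟨P, hP, rfl⟩ := hK
      obtain ⟨s, hs⟩ := (hcon P hP).exists_sign (hopen P)
      exact ⟨s, fun _ => hs⟩
    · exact ⟨1, fun h => absurd h hK⟩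
  choose s hs using hex
  refine h.not_isOddSign (fun v => s (connectedComponentIn (zeroLocus F)ᶜ (pr v)) v)
    ⟨fun v hv c hc => ?_, fun v hv => ?_⟩
  all_goals
    have hv0 := h.ne_zero_of_eval_ne_zero hv
    have hvF : pr v ∈ (zeroLocus F)ᶜ := fun h' => hv ((pr_mem_zeroLocus h.isHomogeneous hv0).1 h')
    have hvK := mem_connectedComponentIn hvF
    have hsv := hs _ ⟨_, hvF, rfl⟩ v hv0 hvK
  · simp only [pr_smul hc]
    exact hsv.1 c hc
  · filter_upwards [hsv.2, (continuousAt_pr hv0).eventually ((hopen _).mem_nhds hvK)] with x hx hxK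
    rw [← connectedComponentIn_eq hxK, hx]

end OvalSystem

/-! ### Interiors of the ovals -/

/-- The complement of each oval `C i` is split into an inside `D i` and an outside `D' i` that
contains a set `N` which meets every line. -/
structure InsideSystem (F : MvPolynomial (Fin 3) ℝ) (C D D' : Fin 4 → Set RP2) (N : Set RP2) :
    Prop where
  isHomogeneous : F.IsHomogeneous 4
  smooth : IsSmoothCurve F
  isPreconnected : ∀ i, IsPreconnected (C i)
  nonempty : ∀ i, (C i).Nonempty
  isClosed : ∀ i, IsClosed (C i)
  disjoint : Pairwise fun i j => Disjoint (C i) (C j)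
  iUnion_eq : ⋃ i, C i = zeroLocus F
  isOpen_D : ∀ i, IsOpen (D i)
  isOpen_D' : ∀ i, IsOpen (D' i)
  disjoint_D_D' : ∀ i, Disjoint (D i) (D' i)
  union_eq : ∀ i, D i ∪ D' i = (C i)ᶜ
  sides : ∀ i,
    (∀ c ∈ C i, ∀ᶠ x in 𝓝 c, (x ∈ posLocus F → x ∈ D i) ∧ (x ∈ negLocus F → x ∈ D' i)) ∨
    (∀ c ∈ C i, ∀ᶠ x in 𝓝 c, (x ∈ posLocus F → x ∈ D' i) ∧ (x ∈ negLocus F → x ∈ D i))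
  subset_compl : N ⊆ (zeroLocus F)ᶜ
  subset_D' : ∀ i, N ⊆ D' i
  exists_mem_line : ∀ l : Fin 3 → ℝ, l ≠ 0 → ∃ P ∈ N, l ⬝ᵥ P.rep = 0

/-- The set `N` is a non-orientable component. Being connected and disjoint from each oval, it lies
in one of the two parts `Dp i`, `Dn i`, and this part is declared the outside. It meets every line
because a set that misses a line is orientable. -/
lemma OvalSystem.exists_insideSystem {F : MvPolynomial (Fin 3) ℝ} {C Dp Dn : Fin 4 → Set RP2}
    (h : OvalSystem F C Dp Dn) : ∃ D D' P, P ∈ (zeroLocus F)ᶜ ∧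
      ¬ IsOrientable (connectedComponentIn (zeroLocus F)ᶜ P) ∧
      InsideSystem F C D D' (connectedComponentIn (zeroLocus F)ᶜ P) := by
  obtain ⟨P, hP, hor⟩ := h.exists_not_isOrientable
  set N := connectedComponentIn (zeroLocus F)ᶜ P
  have hNF : N ⊆ (zeroLocus F)ᶜ := connectedComponentIn_subset _ _
  have hN : ∀ i, N ⊆ Dp i ∨ N ⊆ Dn i := fun i =>
    isPreconnected_connectedComponentIn.subset_or_subset (h.isOpen_Dp i) (h.isOpen_Dn i)
      (h.disjoint_Dp_Dn i) ((hNF.trans (compl_subset_compl.2 (h.subset_zeroLocus i))).trans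
        (h.union_eq i).ge)
  have key : ∀ i, ∃ D D' : Set RP2, IsOpen D ∧ IsOpen D' ∧ Disjoint D D' ∧ D ∪ D' = (C i)ᶜ ∧
      ((∀ c ∈ C i, ∀ᶠ x in 𝓝 c, (x ∈ posLocus F → x ∈ D) ∧ (x ∈ negLocus F → x ∈ D')) ∨
      (∀ c ∈ C i, ∀ᶠ x in 𝓝 c, (x ∈ posLocus F → x ∈ D') ∧ (x ∈ negLocus F → x ∈ D))) ∧
      N ⊆ D' := by
    intro i
    rcases hN i with hi | hi
    · exact ⟨Dn i, Dp i, h.isOpen_Dn i, h.isOpen_Dp i, (h.disjoint_Dp_Dn i).symm,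
        by rw [union_comm, h.union_eq i],
        .inr fun c hc => (h.pos_side i c hc).and (h.neg_side i c hc), hi⟩
    · exact ⟨Dp i, Dn i, h.isOpen_Dp i, h.isOpen_Dn i, h.disjoint_Dp_Dn i, h.union_eq i,
        .inl fun c hc => (h.pos_side i c hc).and (h.neg_side i c hc), hi⟩
  choose D D' h1 h2 h3 h4 h5 h6 using key
  refine ⟨D, D', P, hP, hor, h.isHomogeneous, h.smooth, h.isPreconnected, h.nonempty, h.isClosed,
    h.disjoint, h.iUnion_eq, h1, h2, h3, h4, h5, hNF, h6, fun l _ => ?_⟩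
  by_contra! hcon
  exact hor (isOrientable_of_forall_ne_zero l hcon)

/-- With `b` as the point at infinity of the line, every other point has an affine coordinate `t`
and is represented by `a + t • b`. -/
lemma exists_eq_add_smul_of_dotProduct_eq_zero {l b : Fin 3 → ℝ} (hl : l ≠ 0) (hb : b ≠ 0)
    (hlb : l ⬝ᵥ b = 0) : ∃ a : Fin 3 → ℝ, ∀ w, l ⬝ᵥ w = 0 → ∃ x y : ℝ, w = x • a + y • b := by
  let L : Module.Dual ℝ (Fin 3 → ℝ) := dotProductBilin ℝ ℝ l
  have hL : ∀ w, L w = l ⬝ᵥ w := fun w => rfl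
  have hL0 : L ≠ 0 := by
    intro h
    refine hl (dotProduct_self_eq_zero.1 ?_)
    rw [← hL, h]; rfl
  have hrank : Module.finrank ℝ (LinearMap.ker L) = 2 := by
    have := Module.Dual.finrank_ker_add_one_of_ne_zero hL0
    simp at this
    omega
  have hlt : Submodule.span ℝ {b} < LinearMap.ker L := by
    refine lt_of_le_of_ne ?_ ?_
    · rw [Submodule.span_singleton_le_iff_mem]
      exact hlb
    · intro h
      rw [← h, finrank_span_singleton hb] at hrank
      omega
  obtain ⟨a, haL, hab⟩ := SetLike.exists_of_lt hlt
  refine ⟨a, fun w hw => ?_⟩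
  have hind : LinearIndependent ℝ ![a, b] := by
    rw [LinearIndependent.pair_symm_iff, LinearIndependent.pair_iff' hb]
    intro c hc
    exact hab (Submodule.mem_span_singleton.2 ⟨c, hc⟩)
  have hspan : Submodule.span ℝ (Set.range ![a, b]) = LinearMap.ker L := by
    refine Submodule.eq_of_le_of_finrank_eq ?_ ?_
    · rw [Submodule.span_le]
      rintro _ ⟨i, rfl⟩
      fin_cases i
      · exact haL
      · exact hlb
    · rw [finrank_span_eq_card hind, hrank]; rfl
  have : w ∈ Submodule.span ℝ (Set.range ![a, b]) := hspan ▸ hw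
  rw [Matrix.range_cons, Matrix.range_cons, Matrix.range_empty, union_empty,
    singleton_union, Submodule.mem_span_pair] at this
  obtain ⟨x, y, h⟩ := this
  exact ⟨x, y, h.symm⟩

namespace InsideSystem

variable {F : MvPolynomial (Fin 3) ℝ} {C D D' : Fin 4 → Set RP2} {N : Set RP2}

lemma subset_zeroLocus (h : InsideSystem F C D D' N) (i : Fin 4) : C i ⊆ zeroLocus F :=
  h.iUnion_eq ▸ subset_iUnion C i

lemma eventually_mem (h : InsideSystem F C D D' N) {i : Fin 4} {c : RP2} (hc : c ∈ C i) :
    ∀ᶠ x in 𝓝 c, x ∈ zeroLocus F → x ∈ C i :=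
  eventually_mem_of_mem_zeroLocus h.isClosed h.disjoint h.iUnion_eq hc

lemma not_mem_C_of_mem_D (h : InsideSystem F C D D' N) {i : Fin 4} {P : RP2} (hP : P ∈ D i) :
    P ∉ C i := (h.union_eq i).le (.inl hP)

lemma not_mem_C_of_mem_D' (h : InsideSystem F C D D' N) {i : Fin 4} {P : RP2} (hP : P ∈ D' i) :
    P ∉ C i := (h.union_eq i).le (.inr hP)

/-- A line through the inside of an oval meets the oval on the way out. -/
lemma exists_pos_crossing (h : InsideSystem F C D D' N) {i : Fin 4} {u b : Fin 3 → ℝ}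
    (hu0 : u ≠ 0) (hb0 : b ≠ 0) (hu : pr u ∈ D i) (hb : pr b ∈ D' i) :
    ∃ m : ℝ, 0 < m ∧ pr (u + m • b) ∈ C i := by
  -- The segment from `u` to `b` avoids the origin, since otherwise `u` and `b` would represent the
  -- same projective point, in `D i` and in `D' i`. It must cross `C i`, strictly between its ends;
  -- rescaling by `1 / (1 - t)` gives the form `u + m • b`.
  let γ : ℝ → Fin 3 → ℝ := fun t => (1 - t) • u + t • b
  have hγ0 : ∀ t, γ t ≠ 0 := by
    intro t ht
    have ht' : t • b = (-(1 - t)) • u := by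
      rw [neg_smul]; exact eq_neg_of_add_eq_zero_right ht
    have ht0 : t ≠ 0 := by
      rintro rfl
      simp only [γ, sub_zero, one_smul, zero_smul, add_zero] at ht
      exact hu0 ht
    have ht1 : -(1 - t) ≠ 0 := by
      intro h1
      rw [h1, zero_smul] at ht'
      exact smul_ne_zero ht0 hb0 ht'
    refine disjoint_left.1 (h.disjoint_D_D' i) hu ?_
    rwa [← pr_smul ht1 u, ← ht', pr_smul ht0]
  have hcont : Continuous fun t => pr (γ t) :=
    continuous_iff_continuousAt.2 fun t =>
      ContinuousAt.comp (f := γ) (continuousAt_pr (hγ0 t)) (by fun_prop)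
  have hpre : IsPreconnected ((fun t => pr (γ t)) '' Icc (0 : ℝ) 1) :=
    isPreconnected_Icc.image _ hcont.continuousOn
  have hγu : γ 0 = u := by simp [γ]
  have hγb : γ 1 = b := by simp [γ]
  have : ∃ t ∈ Icc (0 : ℝ) 1, pr (γ t) ∈ C i := by
    by_contra! hcon
    obtain ⟨x, -, hx, hx'⟩ := hpre _ _ (h.isOpen_D i) (h.isOpen_D' i)
      (by rintro _ ⟨t, ht, rfl⟩; exact (h.union_eq i).ge (hcon t ht))
      ⟨_, ⟨0, by simp, rfl⟩, by simpa [hγu] using hu⟩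
      ⟨_, ⟨1, by simp, rfl⟩, by simpa [hγb] using hb⟩
    exact disjoint_left.1 (h.disjoint_D_D' i) hx hx'
  obtain ⟨t, ⟨ht0, ht1⟩, ht⟩ := this
  have ht0' : 0 < t := lt_of_le_of_ne ht0 fun h0 => by
    rw [← h0, hγu] at ht
    exact h.not_mem_C_of_mem_D hu ht
  have ht1' : t < 1 := lt_of_le_of_ne ht1 fun h1 => by
    rw [h1, hγb] at ht
    exact h.not_mem_C_of_mem_D' hb ht
  have h1t : 0 < 1 - t := by linarith
  refine ⟨t / (1 - t), by positivity, ?_⟩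
  rw [← pr_smul h1t.ne']
  convert ht using 2
  simp only [γ, smul_add, smul_smul]
  congr 2
  field_simp

/-- Replacing `b` by `-b` keeps the projective point and runs along the complementary arc of the
line. -/
lemma exists_neg_crossing (h : InsideSystem F C D D' N) {i : Fin 4} {u b : Fin 3 → ℝ}
    (hu0 : u ≠ 0) (hb0 : b ≠ 0) (hu : pr u ∈ D i) (hb : pr b ∈ D' i) :
    ∃ m : ℝ, m < 0 ∧ pr (u + m • b) ∈ C i := by
  obtain ⟨m, hm, h⟩ := h.exists_pos_crossing (b := -b) hu0 (neg_ne_zero.2 hb0) hu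
    (by rwa [pr_neg])
  exact ⟨-m, by linarith, by simpa using h⟩

/-- A line meets the insides of at most two of the ovals. -/
lemma not_forall_exists_mem_line (h : InsideSystem F C D D' N) {l : Fin 3 → ℝ} (hl : l ≠ 0)
    {e : Fin 3 → Fin 4} (he : Function.Injective e) :
    ¬ ∀ m, ∃ P ∈ D (e m), l ⬝ᵥ P.rep = 0 := by
  intro hD
  choose P hP hlP using hD
  -- A point of `N` on the line is placed at infinity. Each inside that the line meets then yields
  -- two finite zeros of the quartic, one on either side of the chosen point. Three insides yield
  -- six zeros of a polynomial of degree at most four.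
  obtain ⟨Q, hQ, hlQ⟩ := h.exists_mem_line l hl
  set b := Q.rep with hbdef
  have hb0 : b ≠ 0 := Q.rep_nonzero
  have hQb : pr b = Q := pr_rep Q
  obtain ⟨a, ha⟩ := exists_eq_add_smul_of_dotProduct_eq_zero hl hb0 hlQ
  have hbF : eval b F ≠ 0 := fun h0 => h.subset_compl hQ h0
  -- The points of the insides in the affine coordinate of the line.
  have hpt : ∀ m, ∃ t : ℝ, a + t • b ≠ 0 ∧ pr (a + t • b) ∈ D (e m) := by
    intro m
    obtain ⟨x, y, hxy⟩ := ha _ (hlP m)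
    have hx : x ≠ 0 := by
      rintro rfl
      rw [zero_smul, zero_add] at hxy
      have hy : y ≠ 0 := by
        rintro rfl
        exact (P m).rep_nonzero (by simpa using hxy)
      refine disjoint_left.1 (h.disjoint_D_D' (e m)) (hP m) ?_
      rw [← pr_rep (P m), hxy, pr_smul hy, hQb]
      exact h.subset_D' _ hQ
    have hab : a + (y / x) • b = x⁻¹ • (P m).rep := by
      rw [hxy, smul_add, smul_smul, smul_smul, inv_mul_cancel₀ hx, one_smul, div_eq_inv_mul]
    refine ⟨y / x, ?_, ?_⟩
    · rw [hab]
      exact smul_ne_zero (inv_ne_zero hx) (P m).rep_nonzero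
    · rw [hab, pr_smul (inv_ne_zero hx), pr_rep]
      exact hP m
  choose t ht0 htD using hpt
  have hroots : ∀ m, ∃ r : Bool → ℝ, r true ≠ r false ∧ ∀ β, pr (a + r β • b) ∈ C (e m) := by
    intro m
    have hbD' : pr b ∈ D' (e m) := hQb ▸ h.subset_D' _ hQ
    obtain ⟨x, hx, hxC⟩ := h.exists_pos_crossing (ht0 m) hb0 (htD m) hbD'
    obtain ⟨y, hy, hyC⟩ := h.exists_neg_crossing (ht0 m) hb0 (htD m) hbD'
    refine ⟨fun β => if β then t m + x else t m + y, ?_, ?_⟩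
    · simp only [if_true, Bool.false_eq_true, if_false]
      intro h'
      linarith
    · rintro (_ | _)
      · simpa [add_smul, add_assoc] using hyC
      · simpa [add_smul, add_assoc] using hxC
  choose r hr hrC using hroots
  -- The restriction of the quartic to the line.
  let p : Polynomial ℝ := aeval (fun i => Polynomial.C (a i) + Polynomial.C (b i) * Polynomial.X) F
  have hpe : ∀ x, p.eval x = eval (a + x • b) F := by
    intro x
    simp only [p]
    rw [← Polynomial.coe_aeval_eq_eval, comp_aeval_apply, ← coe_aeval_eq_eval]
    refine congrArg (fun g : Fin 3 → ℝ => aeval g F) (funext fun i => ?_)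
    simp only [map_add, map_mul, Polynomial.aeval_C, Polynomial.aeval_X, Pi.add_apply,
      Pi.smul_apply, smul_eq_mul, Algebra.algebraMap_self, RingHom.id_apply]
    ring
  have hdeg : p.natDegree ≤ 4 := by
    have := aeval_natDegree_le (m := 4) (n := 1) F h.isHomogeneous.totalDegree_le
      (fun i => Polynomial.C (a i) + Polynomial.C (b i) * Polynomial.X) (fun i => by compute_degree)
    simpa using this
  -- The quartic does not vanish at `b`, hence not at `b + x • a` for small `x ≠ 0`, and this vector
  -- is `x` times the point with coordinate `x⁻¹`.
  have hp0 : p ≠ 0 := by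
    intro hp0
    have hc : ContinuousAt (fun x : ℝ => eval (b + x • a) F) 0 :=
      ((continuous_eval F).comp (by fun_prop : Continuous fun x : ℝ => b + x • a)).continuousAt
    have h1 : ∀ᶠ x : ℝ in 𝓝[≠] 0, eval (b + x • a) F ≠ 0 :=
      (hc.eventually_ne (by simpa using hbF)).filter_mono nhdsWithin_le_nhds
    obtain ⟨x, hx, hx0⟩ := (h1.and self_mem_nhdsWithin).exists
    have hx0 : x ≠ 0 := hx0
    apply hx
    have : b + x • a = x • (a + x⁻¹ • b) := by
      rw [smul_add, smul_smul, mul_inv_cancel₀ hx0, one_smul, add_comm]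
    rw [this, eval_smul_of_isHomogeneous h.isHomogeneous, ← hpe, hp0]
    simp
  have hinj : Function.Injective fun q : Fin 3 × Bool => r q.1 q.2 := by
    rintro ⟨m, β⟩ ⟨m', β'⟩ hq
    simp only at hq
    have hmm : m = m' := by
      by_contra hne
      have h1 := hrC m β
      rw [hq] at h1
      exact disjoint_left.1 (h.disjoint (he.ne hne)) h1 (hrC m' β')
    subst hmm
    cases β <;> cases β'
    · rfl
    · exact absurd hq.symm (hr m)
    · exact absurd hq (hr m)
    · rfl
  have hsub : Finset.univ.image (fun q : Fin 3 × Bool => r q.1 q.2) ⊆ p.roots.toFinset := by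
    intro x hx
    obtain ⟨q, -, rfl⟩ := Finset.mem_image.1 hx
    rw [Multiset.mem_toFinset, Polynomial.mem_roots hp0, Polynomial.IsRoot.def, hpe]
    have hz := h.subset_zeroLocus _ (hrC q.1 q.2)
    -- At the origin `pr` has a junk value, but the form vanishes there anyway.
    by_cases h0 : a + r q.1 q.2 • b = 0
    · rw [h0]
      have := eval_smul_of_isHomogeneous h.isHomogeneous 0 (0 : Fin 3 → ℝ)
      simpa using this
    · exact (pr_mem_zeroLocus h.isHomogeneous h0).1 hz
  have hcard := Finset.card_le_card hsub
  rw [Finset.card_image_of_injective _ hinj] at hcard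
  have h1 := (Multiset.toFinset_card_le p.roots).trans (Polynomial.card_roots' p)
  simp at hcard
  omega

end InsideSystem

lemma exists_line_through (v w : Fin 3 → ℝ) : ∃ l : Fin 3 → ℝ, l ≠ 0 ∧ l ⬝ᵥ v = 0 ∧ l ⬝ᵥ w = 0 := by
  let L : (Fin 3 → ℝ) →ₗ[ℝ] (Fin 2 → ℝ) := Matrix.mulVecLin !![v 0, v 1, v 2; w 0, w 1, w 2]
  obtain ⟨l, hl, hl0⟩ := Submodule.exists_mem_ne_zero_of_ne_bot
    (LinearMap.ker_ne_bot_of_finrank_lt (f := L) (by simp))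
  have h := congrFun (LinearMap.mem_ker.1 hl)
  refine ⟨l, hl0, ?_, ?_⟩
  · simpa [L, Matrix.vecHead, Matrix.vecTail, dotProduct, Fin.sum_univ_three, mul_comm, add_assoc] using h 0
  · simpa [L, Matrix.vecHead, Matrix.vecTail, dotProduct, Fin.sum_univ_three, mul_comm, add_assoc] using h 1

/-! ### Disjointness of the insides and connectedness of the common outside -/

namespace InsideSystem

variable {F : MvPolynomial (Fin 3) ℝ} {C D D' : Fin 4 → Set RP2} {N : Set RP2}

lemma zeroLocus_neg (F : MvPolynomial (Fin 3) ℝ) : zeroLocus (-F) = zeroLocus F := by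
  simp [zeroLocus]

lemma negLocus_neg (F : MvPolynomial (Fin 3) ℝ) : negLocus (-F) = posLocus F := by
  simp [posLocus, negLocus]

/-- Exchanges the two signs, so that only a positive outside needs to be analysed. -/
lemma neg (h : InsideSystem F C D D' N) : InsideSystem (-F) C D D' N where
  isHomogeneous := h.isHomogeneous.neg
  smooth := h.smooth.neg
  isPreconnected := h.isPreconnected
  nonempty := h.nonempty
  isClosed := h.isClosed
  disjoint := h.disjoint
  iUnion_eq := by rw [zeroLocus_neg, h.iUnion_eq]
  isOpen_D := h.isOpen_D
  isOpen_D' := h.isOpen_D'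
  disjoint_D_D' := h.disjoint_D_D'
  union_eq := h.union_eq
  sides i := by
    rw [posLocus_neg, negLocus_neg]
    exact (h.sides i).symm.imp (fun h c hc => (h c hc).mono fun x hx => hx.symm)
      (fun h c hc => (h c hc).mono fun x hx => hx.symm)
  subset_compl := by rw [zeroLocus_neg]; exact h.subset_compl
  subset_D' := h.subset_D'
  exists_mem_line := h.exists_mem_line

lemma frequently_mem_D (h : InsideSystem F C D D' N) {i : Fin 4} {c : RP2} (hc : c ∈ C i) :
    ∃ᶠ x in 𝓝 c, x ∈ D i := by
  have hz := h.subset_zeroLocus i hc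
  rcases h.sides i with hs | hs
  · exact ((h.smooth.isSideAt_posLocus h.isHomogeneous hz).frequently.and_eventually
      (hs c hc)).mono fun x hx => hx.2.1 hx.1
  · exact ((h.smooth.isSideAt_negLocus h.isHomogeneous hz).frequently.and_eventually
      (hs c hc)).mono fun x hx => hx.2.2 hx.1

lemma nonempty_D (h : InsideSystem F C D D' N) (i : Fin 4) : (D i).Nonempty := by
  obtain ⟨c, hc⟩ := h.nonempty i
  exact (h.frequently_mem_D hc).exists

/-- The line through a common point of two insides and a point of a third inside would meet three
insides. -/
lemma disjoint_D (h : InsideSystem F C D D' N) {i j : Fin 4} (hij : i ≠ j) :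
    Disjoint (D i) (D j) := by
  rw [disjoint_left]
  intro P hi hj
  obtain ⟨k, hki, hkj⟩ : ∃ k, k ≠ i ∧ k ≠ j := by
    clear hi hj; revert i j; decide
  obtain ⟨Q, hQ⟩ := h.nonempty_D k
  obtain ⟨l, hl, hlP, hlQ⟩ := exists_line_through P.rep Q.rep
  refine h.not_forall_exists_mem_line hl (e := ![i, j, k]) ?_ ?_
  · intro x y
    fin_cases x <;> fin_cases y <;> simp [hij, hki, hkj, hij.symm, hki.symm, hkj.symm]
  · intro m
    fin_cases m
    · exact ⟨P, hi, hlP⟩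
    · exact ⟨P, hj, hlP⟩
    · exact ⟨Q, hQ, hlQ⟩

/-- Every point of `C j` is a limit of points of `D j`, so the open set `D i` would meet `D j`. -/
lemma disjoint_D_C (h : InsideSystem F C D D' N) (i j : Fin 4) : Disjoint (D i) (C j) := by
  rw [disjoint_left]
  intro P hi hj
  by_cases hij : i = j
  · subst hij
    exact h.not_mem_C_of_mem_D hi hj
  · obtain ⟨x, hx, hx'⟩ := ((h.frequently_mem_D hj).and_eventually
      ((h.isOpen_D i).mem_nhds hi)).exists
    exact disjoint_left.1 (h.disjoint_D hij) hx' hx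

lemma D_subset_compl (h : InsideSystem F C D D' N) (i : Fin 4) : D i ⊆ (zeroLocus F)ᶜ := by
  intro P hP hz
  rw [← h.iUnion_eq, mem_iUnion] at hz
  obtain ⟨j, hj⟩ := hz
  exact disjoint_left.1 (h.disjoint_D_C i j) hP hj

/-- A line through points of two other insides cannot meet `D i`, and a set that misses a line is
orientable. -/
lemma isOrientable_of_subset_D (h : InsideSystem F C D D' N) {i : Fin 4} {U : Set RP2}
    (hU : U ⊆ D i) : IsOrientable U := by
  obtain ⟨j, k, hji, hki, hjk⟩ : ∃ j k, j ≠ i ∧ k ≠ i ∧ j ≠ k := by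
    clear hU; revert i; decide
  obtain ⟨P, hP⟩ := h.nonempty_D j
  obtain ⟨Q, hQ⟩ := h.nonempty_D k
  obtain ⟨l, hl, hlP, hlQ⟩ := exists_line_through P.rep Q.rep
  refine isOrientable_of_forall_ne_zero l fun R hR hlR => ?_
  refine h.not_forall_exists_mem_line hl (e := ![i, j, k]) ?_ ?_
  · intro x y
    fin_cases x <;> fin_cases y <;> simp [hji, hki, hjk, hji.symm, hki.symm, hjk.symm]
  · intro m
    fin_cases m
    · exact ⟨R, hU hR, hlR⟩
    · exact ⟨P, hP, hlP⟩
    · exact ⟨Q, hQ, hlQ⟩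

lemma isOpen_iInter_D' (h : InsideSystem F C D D' N) : IsOpen (⋂ i, D' i) :=
  isOpen_iInter_of_finite h.isOpen_D'

lemma mem_cases (h : InsideSystem F C D D' N) (P : RP2) :
    P ∈ ⋂ i, D' i ∨ ∃ i, P ∈ C i ∪ D i := by
  by_contra! hcon
  refine hcon.1 (mem_iInter.2 fun i => ?_)
  have h1 := hcon.2 i
  rw [mem_union, not_or] at h1
  exact ((h.union_eq i).ge h1.1).resolve_left h1.2

lemma iInter_D'_subset_compl (h : InsideSystem F C D D' N) : ⋂ i, D' i ⊆ (zeroLocus F)ᶜ := by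
  intro P hP hz
  rw [← h.iUnion_eq, mem_iUnion] at hz
  obtain ⟨j, hj⟩ := hz
  exact h.not_mem_C_of_mem_D' (mem_iInter.1 hP j) hj

/-- A point of `C i` lies outside all the other ovals, and this is an open condition. Near the oval,
only its own outside matters. -/
lemma eventually_mem_iInter_D' (h : InsideSystem F C D D' N) {i : Fin 4} {c : RP2}
    (hc : c ∈ C i) : ∀ᶠ x in 𝓝 c, x ∈ D' i → x ∈ ⋂ i, D' i := by
  have : ∀ᶠ x in 𝓝 c, ∀ j, j ≠ i → x ∈ D' j := by
    rw [eventually_all]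
    intro j
    by_cases hj : j = i
    · simp [hj]
    · have hcj : c ∈ D' j := ((h.union_eq j).ge
        (disjoint_left.1 (h.disjoint (Ne.symm hj)) hc)).resolve_left
        fun hD => disjoint_left.1 (h.disjoint_D_C j i) hD hc
      filter_upwards [(h.isOpen_D' j).mem_nhds hcj] with x hx _ using hx
  filter_upwards [this] with x hx hxi
  refine mem_iInter.2 fun j => ?_
  by_cases hj : j = i
  · exact hj ▸ hxi
  · exact hx j hj

/-- Near `C i` the set `D' i` coincides with one of the two loci `F > 0`, `F < 0`, which has a
single local branch at every point of the curve. -/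
lemma outer_side_subset_or_subset (h : InsideSystem F C D D' N) {A B : Set RP2} (hA : IsOpen A)
    (hB : IsOpen B) (hAB : Disjoint A B) (hcov : ⋂ i, D' i ⊆ A ∪ B) (i : Fin 4) :
    (∀ c ∈ C i, ∀ᶠ x in 𝓝 c, x ∈ D' i → x ∈ A) ∨ (∀ c ∈ C i, ∀ᶠ x in 𝓝 c, x ∈ D' i → x ∈ B) := by
  have key : ∀ H : Set RP2, (∀ c ∈ C i, IsSideAt H c) →
      (∀ c ∈ C i, ∀ᶠ x in 𝓝 c, x ∈ H ↔ x ∈ D' i) → 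
      (∀ c ∈ C i, ∀ᶠ x in 𝓝 c, x ∈ D' i → x ∈ A) ∨
      (∀ c ∈ C i, ∀ᶠ x in 𝓝 c, x ∈ D' i → x ∈ B) := by
    intro H hH hHD
    refine (side_subset_or_subset (h.isPreconnected i) hH hA hB hAB fun c hc => ?_).imp ?_ ?_
    · filter_upwards [hHD c hc, h.eventually_mem_iInter_D' hc] with x h1 h2 hx
      exact hcov (h2 (h1.1 hx))
    all_goals
      intro hs c hc
      filter_upwards [hs c hc, hHD c hc] with x h1 h2 hx
      exact h1 (h2.2 hx)
  rcases h.sides i with hs | hs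
  · refine key (negLocus F) (fun c hc => h.smooth.isSideAt_negLocus h.isHomogeneous
      (h.subset_zeroLocus i hc)) fun c hc => ?_
    filter_upwards [hs c hc, h.eventually_mem hc] with x h1 h2
    refine ⟨h1.2, fun hx => ?_⟩
    rcases mem_trichotomy F x with hp | hn | hz
    · exact absurd hx (disjoint_left.1 (h.disjoint_D_D' i) (h1.1 hp))
    · exact hn
    · exact absurd (h2 hz) (h.not_mem_C_of_mem_D' hx)
  · refine key (posLocus F) (fun c hc => h.smooth.isSideAt_posLocus h.isHomogeneous
      (h.subset_zeroLocus i hc)) fun c hc => ?_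
    filter_upwards [hs c hc, h.eventually_mem hc] with x h1 h2
    refine ⟨h1.1, fun hx => ?_⟩
    rcases mem_trichotomy F x with hp | hn | hz
    · exact hp
    · exact absurd hx (disjoint_left.1 (h.disjoint_D_D' i) (h1.2 hn))
    · exact absurd (h2 hz) (h.not_mem_C_of_mem_D' hx)

/-- A neighbourhood of a point of `C i` consists of `C i`, its inside and its outer side. Filling in
an oval whose outer side already lies in `A` thus preserves openness. -/
lemma isOpen_union_ovals (h : InsideSystem F C D D' N) {A : Set RP2} (hA : IsOpen A)
    {I : Set (Fin 4)} (hI : ∀ i ∈ I, ∀ c ∈ C i, ∀ᶠ x in 𝓝 c, x ∈ D' i → x ∈ A) :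
    IsOpen (A ∪ ⋃ i ∈ I, (C i ∪ D i)) := by
  rw [isOpen_iff_mem_nhds]
  rintro x (hx | hx)
  · exact mem_of_superset (hA.mem_nhds hx) subset_union_left
  · obtain ⟨i, hi, hx⟩ := mem_iUnion₂.1 hx
    rcases hx with hx | hx
    · filter_upwards [hI i hi x hx] with y hy
      by_cases hyC : y ∈ C i
      · exact .inr (mem_iUnion₂.2 ⟨i, hi, .inl hyC⟩)
      · rcases (h.union_eq i).ge hyC with hyD | hyD
        · exact .inr (mem_iUnion₂.2 ⟨i, hi, .inr hyD⟩)
        · exact .inl (hy hyD)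
    · filter_upwards [(h.isOpen_D i).mem_nhds hx] with y hy
      exact .inr (mem_iUnion₂.2 ⟨i, hi, .inr hy⟩)

/-- The common outside of all ovals is connected. -/
lemma isPreconnected_iInter_D' (h : InsideSystem F C D D' N) : IsPreconnected (⋂ i, D' i) := by
  intro A B hA hB hcov hAn hBn
  by_contra hcon
  set O := ⋂ i, D' i
  have hO := h.isOpen_iInter_D'
  have hAB : Disjoint (A ∩ O) (B ∩ O) := disjoint_left.2 fun x hx hx' =>
    hcon ⟨x, hx.2, hx.1, hx'.1⟩
  have hcov' : O ⊆ A ∩ O ∪ B ∩ O := fun x hx => (hcov hx).imp (⟨·, hx⟩) (⟨·, hx⟩)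
  have hdich := h.outer_side_subset_or_subset (hA.inter hO) (hB.inter hO) hAB hcov'
  -- A separation of the common outside extends to one of the projective plane: each oval, together
  -- with its inside, is assigned to the part that contains its outer side.
  let I : Set (Fin 4) := {i | ∀ c ∈ C i, ∀ᶠ x in 𝓝 c, x ∈ D' i → x ∈ A ∩ O}
  have hU := h.isOpen_union_ovals (hA.inter hO) (I := I) (fun i hi => hi)
  have hV := h.isOpen_union_ovals (hB.inter hO) (I := Iᶜ) (fun i hi => (hdich i).resolve_left hi)
  have hOdisj : ∀ x ∈ O, ∀ i, x ∉ C i ∪ D i := by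
    rintro x hx i (hi | hi)
    · exact h.not_mem_C_of_mem_D' (mem_iInter.1 hx i) hi
    · exact disjoint_left.1 (h.disjoint_D_D' i) hi (mem_iInter.1 hx i)
  obtain ⟨x, -, hx, hx'⟩ := (isPreconnected_univ (α := RP2)) _ _ hU hV
    (by
      intro x _
      rcases h.mem_cases x with hx | ⟨i, hx⟩
      · exact (hcov' hx).imp .inl .inl
      · by_cases hi : i ∈ I
        · exact .inl (.inr (mem_iUnion₂.2 ⟨i, hi, hx⟩))
        · exact .inr (.inr (mem_iUnion₂.2 ⟨i, hi, hx⟩)))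
    (by obtain ⟨x, hx, hx'⟩ := hAn; exact ⟨x, mem_univ x, .inl ⟨hx', hx⟩⟩)
    (by obtain ⟨x, hx, hx'⟩ := hBn; exact ⟨x, mem_univ x, .inl ⟨hx', hx⟩⟩)
  rcases hx with hx | hx <;> rcases hx' with hx' | hx'
  · exact disjoint_left.1 hAB hx hx'
  · obtain ⟨i, -, hi⟩ := mem_iUnion₂.1 hx'
    exact hOdisj x hx.2 i hi
  · obtain ⟨i, -, hi⟩ := mem_iUnion₂.1 hx
    exact hOdisj x hx'.2 i hi
  · obtain ⟨i, hiI, hi⟩ := mem_iUnion₂.1 hx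
    obtain ⟨j, hjI, hj⟩ := mem_iUnion₂.1 hx'
    have hij : i ≠ j := fun hij => hjI (hij ▸ hiI)
    rcases hi with hi | hi <;> rcases hj with hj | hj
    · exact disjoint_left.1 (h.disjoint hij) hi hj
    · exact disjoint_left.1 (h.disjoint_D_C j i) hj hi
    · exact disjoint_left.1 (h.disjoint_D_C i j) hi hj
    · exact disjoint_left.1 (h.disjoint_D hij) hi hj

/-- Next to `C i` the positive points lie in `D' i`, so the points of `D i` with `F > 0` do not
accumulate at the oval. They form a clopen set that misses `C i`, which is empty because the
projective plane is connected. -/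
lemma D_subset_negLocus (h : InsideSystem F C D D' N) (hO : ⋂ i, D' i ⊆ posLocus F) (i : Fin 4) :
    D i ⊆ negLocus F := by
  have hside : ∀ c ∈ C i, ∀ᶠ x in 𝓝 c, x ∈ posLocus F → x ∈ D' i := by
    rcases h.sides i with hs | hs
    -- In this case there would be negative points near `c` in the common outside, where `F > 0`.
    · obtain ⟨c, hc⟩ := h.nonempty i
      obtain ⟨x, hx, hxO, hs⟩ := ((h.smooth.isSideAt_negLocus h.isHomogeneous
        (h.subset_zeroLocus i hc)).frequently.and_eventually
        ((h.eventually_mem_iInter_D' hc).and (hs c hc))).exists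
      exact absurd hx (disjoint_left.1 (disjoint_posLocus_negLocus F) (hO (hxO (hs.2 hx))))
    · exact fun c hc => (hs c hc).mono fun x hx => hx.1
  have hcl : IsClopen (D i ∩ posLocus F) := by
    refine ⟨⟨?_⟩, (h.isOpen_D i).inter (isOpen_posLocus h.isHomogeneous)⟩
    rw [isOpen_iff_mem_nhds]
    intro x hx
    by_cases hxC : x ∈ C i
    · filter_upwards [hside x hxC] with y hy hy'
      exact disjoint_left.1 (h.disjoint_D_D' i) hy'.1 (hy hy'.2)
    rcases (h.union_eq i).ge hxC with hxD | hxD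
    · have hxn : x ∈ negLocus F := by
        rcases mem_trichotomy F x with hp | hn | hz
        · exact absurd ⟨hxD, hp⟩ hx
        · exact hn
        · exact absurd hz (h.D_subset_compl i hxD)
      filter_upwards [(isOpen_negLocus h.isHomogeneous).mem_nhds hxn] with y hy hy'
      exact disjoint_left.1 (disjoint_posLocus_negLocus F) hy'.2 hy
    · filter_upwards [(h.isOpen_D' i).mem_nhds hxD] with y hy hy'
      exact disjoint_left.1 (h.disjoint_D_D' i) hy'.1 hy
  have hempty : D i ∩ posLocus F = ∅ := by
    rcases isClopen_iff.1 hcl with he | he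
    · exact he
    · obtain ⟨c, hc⟩ := h.nonempty i
      exact absurd hc (h.not_mem_C_of_mem_D (he.ge (mem_univ c)).1)
  intro x hx
  rcases mem_trichotomy F x with hp | hn | hz
  · exact absurd (hempty.le ⟨hx, hp⟩) (notMem_empty x)
  · exact hn
  · exact absurd hz (h.D_subset_compl i hx)

lemma eq_posLocus_and_eq_negLocus (h : InsideSystem F C D D' N) (hO : ⋂ i, D' i ⊆ posLocus F) :
    ⋂ i, D' i = posLocus F ∧ ⋃ i, D i = negLocus F := by
  have hD := h.D_subset_negLocus hO
  have hcases : ∀ x ∈ (zeroLocus F)ᶜ, x ∈ ⋂ i, D' i ∨ ∃ i, x ∈ D i := by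
    intro x hx
    refine (h.mem_cases x).imp id ?_
    rintro ⟨i, hi⟩
    exact ⟨i, hi.resolve_left fun hC => hx (h.subset_zeroLocus i hC)⟩
  constructor
  · refine subset_antisymm hO fun x hx => (hcases x ?_).resolve_right ?_
    · rw [compl_zeroLocus]; exact .inl hx
    · rintro ⟨i, hi⟩
      exact disjoint_left.1 (disjoint_posLocus_negLocus F) hx (hD i hi)
  · refine subset_antisymm (iUnion_subset hD) fun x hx => mem_iUnion.2 ((hcases x ?_).resolve_left ?_)
    · rw [compl_zeroLocus]; exact .inr hx
    · exact fun hxO => disjoint_left.1 (disjoint_posLocus_negLocus F) (hO hxO) hx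

end InsideSystem

/-- The topology of a smooth quartic with four ovals: the outside `O` is connected and meets every
line, and the rest of the complement of the curve has four parts, of the opposite sign. -/
lemma exists_outside_and_insides {F : MvPolynomial (Fin 3) ℝ} (hF : F.IsHomogeneous 4)
    (hs : IsSmoothCurve F) (ho : ConsistsOfOvals 4 (zeroLocus F)) :
    ∃ (D : Fin 4 → Set RP2) (O : Set RP2), (∀ i, IsOpen (D i)) ∧ (∀ i, (D i).Nonempty) ∧
      (Pairwise fun i j => Disjoint (D i) (D j)) ∧ IsPreconnected O ∧
      (∀ l : Fin 3 → ℝ, l ≠ 0 → ∃ P ∈ O, l ⬝ᵥ P.rep = 0) ∧ outside F = O ∧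
      (O = posLocus F ∧ ⋃ i, D i = negLocus F ∨ O = negLocus F ∧ ⋃ i, D i = posLocus F) := by
  obtain ⟨C, Dp, Dn, hsys⟩ := exists_ovalSystem hF hs ho
  obtain ⟨D, D', P, hP, hor, h⟩ := hsys.exists_insideSystem
  set N := connectedComponentIn (zeroLocus F)ᶜ P with hN
  have hNO : N ⊆ ⋂ i, D' i := fun x hx => mem_iInter.2 fun i => h.subset_D' i hx
  have hPN : P ∈ N := mem_connectedComponentIn hP
  refine ⟨D, ⋂ i, D' i, h.isOpen_D, h.nonempty_D, fun i j hij => h.disjoint_D hij,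
    h.isPreconnected_iInter_D', fun l hl => ?_, ?_, ?_⟩
  · obtain ⟨Q, hQ, hlQ⟩ := h.exists_mem_line l hl
    exact ⟨Q, hNO hQ, hlQ⟩
  · ext Q
    constructor
    · rintro ⟨hQ, hQor⟩
      refine (h.mem_cases Q).resolve_right ?_
      rintro ⟨i, hi⟩
      have hQD := hi.resolve_left fun hC => hQ (h.subset_zeroLocus i hC)
      refine hQor (h.isOrientable_of_subset_D (i := i) ?_)
      refine isPreconnected_connectedComponentIn.subset_left_of_subset_union (h.isOpen_D i)
        (h.isOpen_D' i) (h.disjoint_D_D' i) ?_ ⟨Q, mem_connectedComponentIn hQ, hQD⟩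
      exact ((connectedComponentIn_subset _ _).trans
        (compl_subset_compl.2 (h.subset_zeroLocus i))).trans (h.union_eq i).ge
    · intro hQ
      refine ⟨h.iInter_D'_subset_compl hQ, ?_⟩
      have hPQ : P ∈ connectedComponentIn (zeroLocus F)ᶜ Q :=
        h.isPreconnected_iInter_D'.subset_connectedComponentIn hQ h.iInter_D'_subset_compl
          (hNO hPN)
      rw [connectedComponentIn_eq hPQ]
      exact hor
  · rcases h.isPreconnected_iInter_D'.subset_or_subset (isOpen_posLocus hF) (isOpen_negLocus hF)
      (disjoint_posLocus_negLocus F) (compl_zeroLocus F ▸ h.iInter_D'_subset_compl) with hO | hO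
    · exact .inl (h.eq_posLocus_and_eq_negLocus hO)
    · have := h.neg.eq_posLocus_and_eq_negLocus (by rwa [posLocus_neg])
      rw [posLocus_neg, InsideSystem.negLocus_neg] at this
      exact .inr this

/-! ### Pencils of conics -/

/-- The intermediate value theorem puts a root in each of the `n` consecutive intervals. -/
lemma le_natDegree_of_alternating {p : Polynomial ℝ} (hp : p ≠ 0) {n : ℕ} {a : Fin (n + 1) → ℝ}
    (ha : StrictMono a) (hs : ∀ i : Fin n, p.eval (a i.castSucc) * p.eval (a i.succ) < 0) :
    n ≤ p.natDegree := by
  have hroot : ∀ i : Fin n, ∃ x ∈ Ioo (a i.castSucc) (a i.succ), p.eval x = 0 := by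
    intro i
    have hlt : a i.castSucc < a i.succ := ha (Fin.castSucc_lt_succ)
    have hc : ContinuousOn (fun x => p.eval x) (Icc (a i.castSucc) (a i.succ)) :=
      p.continuous.continuousOn
    rcases mul_neg_iff.1 (hs i) with ⟨h1, h2⟩ | ⟨h1, h2⟩
    · exact intermediate_value_Ioo' hlt.le hc ⟨h2, h1⟩
    · exact intermediate_value_Ioo hlt.le hc ⟨h1, h2⟩
  choose r hr hr0 using hroot
  have hmono : StrictMono r := by
    intro i j hij
    have h1 : a i.succ ≤ a j.castSucc := ha.monotone (Fin.succ_le_castSucc_iff.2 hij)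
    exact ((hr i).2.trans_le h1).trans (hr j).1
  have hsub : Finset.univ.image r ⊆ p.roots.toFinset := by
    intro x hx
    obtain ⟨i, -, rfl⟩ := Finset.mem_image.1 hx
    rw [Multiset.mem_toFinset, Polynomial.mem_roots hp]
    exact hr0 i
  have hcard := Finset.card_le_card hsub
  rw [Finset.card_image_of_injective _ hmono.injective, Finset.card_univ, Fintype.card_fin] at hcard
  exact hcard.trans ((Multiset.toFinset_card_le p.roots).trans (Polynomial.card_roots' p))

/-- A symmetric form that is negative somewhere and positive somewhere on every plane has
signature `(2, 1)`, hence negative determinant. -/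
lemma det_neg_of_forall_plane {M : Matrix (Fin 3) (Fin 3) ℝ} (hM : M.IsSymm) {x : Fin 3 → ℝ}
    (hx : x ⬝ᵥ M.mulVec x < 0) (hpl : ∀ l : Fin 3 → ℝ, l ≠ 0 → ∃ y, l ⬝ᵥ y = 0 ∧ 0 < y ⬝ᵥ M.mulVec y) :
    M.det < 0 := by
  have hsymm : ∀ u v : Fin 3 → ℝ, u ⬝ᵥ M.mulVec v = v ⬝ᵥ M.mulVec u := by
    intro u v
    rw [Matrix.dotProduct_mulVec, ← Matrix.mulVec_transpose, hM.eq, dotProduct_comm]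
  -- Gram–Schmidt for the form: `y` is positive and orthogonal to `x`, and `u` is positive and
  -- orthogonal to `y`. Removing from `u` its component `z - u` along the negative vector `x` can
  -- only increase its value, so `x, y, z` are orthogonal with signs `-, +, +`. Their independence
  -- is not needed: `(det R)² det M < 0` already decides the sign.
  obtain ⟨y, hxy, hy⟩ := hpl (M.mulVec x) (by rintro h; rw [h] at hx; simp at hx)
  obtain ⟨u, hyu, hu⟩ := hpl (M.mulVec y) (by rintro h; rw [h] at hy; simp at hy)
  rw [dotProduct_comm] at hxy hyu
  set b := u ⬝ᵥ M.mulVec x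
  set q := x ⬝ᵥ M.mulVec x
  set z := u - (b / q) • x with hz
  have hxz : z ⬝ᵥ M.mulVec x = 0 := by
    rw [hz, sub_dotProduct, smul_dotProduct, smul_eq_mul]
    change b - b / q * q = 0
    rw [div_mul_cancel₀ _ hx.ne, sub_self]
  have hyz : z ⬝ᵥ M.mulVec y = 0 := by
    rw [hz, sub_dotProduct, smul_dotProduct, hyu, hsymm x y, hxy]
    simp
  have hzz : 0 < z ⬝ᵥ M.mulVec z := by
    have : z ⬝ᵥ M.mulVec z = z ⬝ᵥ M.mulVec u := by
      conv_lhs => rw [hz, Matrix.mulVec_sub, Matrix.mulVec_smul, dotProduct_sub, dotProduct_smul,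
        ← hz, hxz]
      simp
    rw [this, hsymm, hz, Matrix.mulVec_sub, Matrix.mulVec_smul, dotProduct_sub, dotProduct_smul]
    change 0 < _ - b / q * b
    have : b / q * b ≤ 0 := by
      rw [div_mul_eq_mul_div]
      exact div_nonpos_of_nonneg_of_nonpos (mul_self_nonneg b) hx.le
    linarith
  let R : Matrix (Fin 3) (Fin 3) ℝ := Matrix.of ![x, y, z]
  have hentry : ∀ i j, (R * M * R.transpose) i j = R i ⬝ᵥ M.mulVec (R j) := by
    intro i j
    rw [Matrix.mul_assoc, Matrix.mul_apply']
    rfl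
  have hdet : (R * M * R.transpose).det = q * (y ⬝ᵥ M.mulVec y) * (z ⬝ᵥ M.mulVec z) := by
    rw [Matrix.det_fin_three]
    simp only [hentry]
    have e0 : R 0 = x := rfl
    have e1 : R 1 = y := rfl
    have e2 : R 2 = z := rfl
    rw [e0, e1, e2, hsymm x y, hsymm x z, hsymm y z, hxy, hxz, hyz]
    ring
  rw [Matrix.det_mul, Matrix.det_mul, Matrix.det_transpose] at hdet
  have hneg : q * (y ⬝ᵥ M.mulVec y) * (z ⬝ᵥ M.mulVec z) < 0 :=
    mul_neg_of_neg_of_pos (mul_neg_of_neg_of_pos hx hy) hzz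
  by_contra! hcon
  have : 0 ≤ R.det * M.det * R.det := by
    rw [mul_right_comm]
    exact mul_nonneg (mul_self_nonneg _) hcon
  linarith

/-- The member with parameter `t` of the quadratic family spanned by `A₁`, `A₂`, `A₃`. -/
def pencil (A₁ A₂ A₃ : Matrix (Fin 3) (Fin 3) ℝ) (t : ℝ × ℝ) : Matrix (Fin 3) (Fin 3) ℝ :=
  t.1 ^ 2 • A₁ + (2 * t.1 * t.2) • A₂ + t.2 ^ 2 • A₃

section Pencil

variable (A₁ A₂ A₃ : Matrix (Fin 3) (Fin 3) ℝ)

lemma pencil_smul (c : ℝ) (t : ℝ × ℝ) :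
    pencil A₁ A₂ A₃ (c • t) = c ^ 2 • pencil A₁ A₂ A₃ t := by
  simp only [pencil, Prod.smul_fst, Prod.smul_snd, smul_eq_mul, smul_add, smul_smul]
  congr 2 <;> ring_nf

lemma det_pencil_smul (c : ℝ) (t : ℝ × ℝ) :
    (pencil A₁ A₂ A₃ (c • t)).det = c ^ 6 * (pencil A₁ A₂ A₃ t).det := by
  rw [pencil_smul, Matrix.det_smul, Fintype.card_fin]
  ring

lemma continuous_pencil : Continuous (pencil A₁ A₂ A₃) := by
  unfold pencil
  fun_prop

/-- The added term dehomogenizes the definite sextic form `δ (t₁² + t₂²)³`, so the degree bound six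
survives the perturbation. -/
lemma exists_polynomial_det_pencil (δ : ℝ) : ∃ p : Polynomial ℝ, p.natDegree ≤ 6 ∧
    ∀ x, p.eval x = (pencil A₁ A₂ A₃ (1, x)).det + δ * (1 + x ^ 2) ^ 3 := by
  let e : Matrix (Fin 3) (Fin 3) (Polynomial ℝ) := Matrix.of fun i j =>
    Polynomial.C (A₁ i j) + Polynomial.C (2 * A₂ i j) * Polynomial.X +
      Polynomial.C (A₃ i j) * Polynomial.X ^ 2
  have he : ∀ i j, (e i j).natDegree ≤ 2 := by
    intro i j
    simp only [e, Matrix.of_apply]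
    compute_degree
  refine ⟨e.det + Polynomial.C δ * (1 + Polynomial.X ^ 2) ^ 3, ?_, ?_⟩
  · refine Polynomial.natDegree_add_le_of_degree_le ?_ (by compute_degree)
    rw [Matrix.det_apply]
    refine Polynomial.natDegree_sum_le_of_forall_le _ _ fun σ _ => ?_
    refine (Polynomial.natDegree_smul_le _ _).trans ?_
    refine (Polynomial.natDegree_prod_le _ _).trans ?_
    exact (Finset.sum_le_sum fun i _ => he (σ i) i).trans (by simp)
  · intro x
    have : (e.det).eval x = (pencil A₁ A₂ A₃ (1, x)).det := by
      rw [← Polynomial.coe_evalRingHom, RingHom.map_det]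
      congr 1
      ext i j
      simp [e, pencil]
      ring
    simp [this]

variable {A₁ A₂ A₃}

/-- A segment that joins two members of a disjoint family of open sets leaves their union. -/
lemma exists_mem_segment_notMem {E : Type*} [AddCommGroup E] [Module ℝ E] [TopologicalSpace E]
    [ContinuousAdd E] [ContinuousSMul ℝ E] {ι : Type*} {T : ι → Set E} (hT : ∀ i, IsOpen (T i))
    (hd : Pairwise fun i j => Disjoint (T i) (T j)) {i j : ι} (hij : i ≠ j) {a b : E}
    (ha : a ∈ T i) (hb : b ∈ T j) : ∃ t ∈ segment ℝ a b, ∀ k, t ∉ T k := by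
  by_contra! hcon
  obtain ⟨x, -, hx, hx'⟩ := (convex_segment a b).isPreconnected (T i) (⋃ k ∈ {k | k ≠ i}, T k)
    (hT i) (isOpen_biUnion fun k _ => hT k)
    (by
      intro t ht
      obtain ⟨k, hk⟩ := hcon t ht
      by_cases hki : k = i
      · exact .inl (hki ▸ hk)
      · exact .inr (mem_biUnion (show k ∈ {k | k ≠ i} from hki) hk))
    ⟨a, left_mem_segment ℝ a b, ha⟩
    ⟨b, right_mem_segment ℝ a b, mem_biUnion (show j ∈ {k | k ≠ i} from hij.symm) hb⟩
  obtain ⟨k, hk, hxk⟩ := mem_iUnion₂.1 hx'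
  exact disjoint_left.1 (hd (Ne.symm hk)) hx hxk

/-- The discriminant of the pencil, a binary form of degree six, is negative on at most three
arcs of the projective line. -/
lemma not_four_arcs {T : Fin 4 → Set (ℝ × ℝ)} (hT : ∀ i, IsOpen (T i))
    (hne : ∀ i, (T i).Nonempty) (hd : Pairwise fun i j => Disjoint (T i) (T j))
    (hsmul : ∀ i, ∀ t ∈ T i, ∀ c : ℝ, c ≠ 0 → c • t ∈ T i)
    (hneg : ∀ i, ∀ t ∈ T i, (pencil A₁ A₂ A₃ t).det < 0)
    (hnn : ∀ t, (∀ i, t ∉ T i) → 0 ≤ (pencil A₁ A₂ A₃ t).det) : False := by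
  -- Each open set `T i` contains a point away from infinity, obtained by moving the first
  -- coordinate slightly.
  have hex : ∀ i, ∃ s : ℝ, ((1 : ℝ), s) ∈ T i := by
    intro i
    obtain ⟨t, ht⟩ := hne i
    have hc : Continuous fun x : ℝ => (t.1 + x, t.2) := by fun_prop
    have h1 : ∀ᶠ x : ℝ in 𝓝[≠] 0, (t.1 + x, t.2) ∈ T i :=
      (hc.continuousAt.eventually ((hT i).mem_nhds (by simpa using ht))).filter_mono
        nhdsWithin_le_nhds
    have h2 : ∀ᶠ x : ℝ in 𝓝[≠] 0, t.1 + x ≠ 0 := by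
      by_cases h0 : t.1 = 0
      · filter_upwards [self_mem_nhdsWithin] with x hx
        simpa [h0] using hx
      · have : ContinuousAt (fun x : ℝ => t.1 + x) 0 := by fun_prop
        exact (this.eventually_ne (by simpa using h0)).filter_mono nhdsWithin_le_nhds
    obtain ⟨x, hx, hx0⟩ := (h1.and h2).exists
    refine ⟨t.2 / (t.1 + x), ?_⟩
    have := hsmul i _ hx (t.1 + x)⁻¹ (inv_ne_zero hx0)
    simpa [hx0, div_eq_inv_mul] using this
  choose s₀ hs₀ using hex
  have hs₀inj : Function.Injective s₀ := by
    intro i j hij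
    by_contra hne
    have := hs₀ i
    rw [hij] at this
    exact disjoint_left.1 (hd hne) this (hs₀ j)
  -- Order the four arcs along the affine line.
  obtain ⟨T, s, hT, hd, hsmul, hneg, hnn, hs, hmono⟩ : ∃ (T : Fin 4 → Set (ℝ × ℝ)) (s : Fin 4 → ℝ),
      (∀ i, IsOpen (T i)) ∧ (Pairwise fun i j => Disjoint (T i) (T j)) ∧
      (∀ i, ∀ t ∈ T i, ∀ c : ℝ, c ≠ 0 → c • t ∈ T i) ∧
      (∀ i, ∀ t ∈ T i, (pencil A₁ A₂ A₃ t).det < 0) ∧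
      (∀ t, (∀ i, t ∉ T i) → 0 ≤ (pencil A₁ A₂ A₃ t).det) ∧
      (∀ i, ((1 : ℝ), s i) ∈ T i) ∧ StrictMono s := by
    let σ := Tuple.sort s₀
    refine ⟨fun i => T (σ i), s₀ ∘ σ, fun i => hT _, fun i j hij => hd (σ.injective.ne hij),
      fun i => hsmul _, fun i => hneg _, fun t ht => hnn t fun i => ?_, fun i => hs₀ _,
      (Tuple.monotone_sort s₀).strictMono_of_injective (hs₀inj.comp σ.injective)⟩
    simpa using ht (σ.symm i)
  -- A small positive perturbation of the discriminant.
  obtain ⟨δ, hδ, hδs⟩ : ∃ δ : ℝ, 0 < δ ∧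
      ∀ i, (pencil A₁ A₂ A₃ (1, s i)).det + δ * (1 + s i ^ 2) ^ 3 < 0 := by
    have : ∀ᶠ δ : ℝ in 𝓝[>] 0, ∀ i, (pencil A₁ A₂ A₃ (1, s i)).det + δ * (1 + s i ^ 2) ^ 3 < 0 := by
      rw [eventually_all]
      intro i
      have hc : ContinuousAt (fun δ : ℝ => (pencil A₁ A₂ A₃ (1, s i)).det + δ * (1 + s i ^ 2) ^ 3) 0 :=
        by fun_prop
      exact (hc.eventually (gt_mem_nhds (by simpa using hneg i _ (hs i)))).filter_mono
        nhdsWithin_le_nhds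
    obtain ⟨δ, h1, h2⟩ := (this.and self_mem_nhdsWithin).exists
    exact ⟨δ, h2, h1⟩
  obtain ⟨p, hpdeg, hpe⟩ := exists_polynomial_det_pencil A₁ A₂ A₃ δ
  have hps : ∀ i, p.eval (s i) < 0 := fun i => by rw [hpe]; exact hδs i
  have hp0 : p ≠ 0 := by
    rintro rfl
    simpa using hps 0
  -- A segment between two arcs contains a point in none of them. There the discriminant is only
  -- known to be nonnegative; the perturbation makes it strictly positive while it stays negative at
  -- the points `s i`.
  have hbetween : ∀ i j, i < j → ∃ r ∈ Ioo (s i) (s j), 0 < p.eval r := by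
    intro i j hij
    have hlt := hmono hij
    obtain ⟨t, ht, htT⟩ := exists_mem_segment_notMem hT hd hij.ne (hs i) (hs j)
    obtain ⟨a, b, ha, hb, hab, rfl⟩ := ht
    have hval : a • ((1 : ℝ), s i) + b • ((1 : ℝ), s j) = (1, a * s i + b * s j) := by
      ext <;> simp [hab]
    rw [hval] at htT
    have hpos : 0 < p.eval (a * s i + b * s j) := by
      rw [hpe]
      have := hnn _ htT
      positivity
    have hi : a * s i + b * s j ≠ s i := fun h => by rw [h] at hpos; exact lt_asymm hpos (hps i)
    have hj : a * s i + b * s j ≠ s j := fun h => by rw [h] at hpos; exact lt_asymm hpos (hps j)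
    refine ⟨_, ⟨lt_of_le_of_ne ?_ hi.symm, lt_of_le_of_ne ?_ hj⟩, hpos⟩
    · have : a * s i + b * s j - s i = b * (s j - s i) := by
        rw [show a = 1 - b by linarith]; ring
      have := mul_nonneg hb (sub_nonneg.2 hlt.le)
      linarith
    · have : s j - (a * s i + b * s j) = a * (s j - s i) := by
        rw [show b = 1 - a by linarith]; ring
      have := mul_nonneg ha (sub_nonneg.2 hlt.le)
      linarith
  obtain ⟨r0, hr0, hr0p⟩ := hbetween 0 1 (by decide)
  obtain ⟨r1, hr1, hr1p⟩ := hbetween 1 2 (by decide)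
  obtain ⟨r2, hr2, hr2p⟩ := hbetween 2 3 (by decide)
  -- The remaining gap passes through infinity. The segment from `(1, s 3)` to `-(1, s 0)`, the
  -- latter representing the same projective point as `(1, s 0)`, traverses it, and `G` is the
  -- perturbed discriminant along this segment in homogeneous form.
  have houter : ∃ r, (r < s 0 ∨ s 3 < r) ∧ 0 < p.eval r := by
    have hlt : s 0 < s 3 := hmono (by decide)
    let G : ℝ → ℝ := fun x => (pencil A₁ A₂ A₃ (1 - 2 * x, s 3 - x * (s 3 + s 0))).det +
      δ * ((1 - 2 * x) ^ 2 + (s 3 - x * (s 3 + s 0)) ^ 2) ^ 3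
    have hGc : Continuous G := by
      have h1 : Continuous fun x : ℝ => pencil A₁ A₂ A₃ (1 - 2 * x, s 3 - x * (s 3 + s 0)) :=
        (continuous_pencil A₁ A₂ A₃).comp (by fun_prop)
      exact h1.matrix_det.add (by fun_prop)
    have hGp : ∀ x, 1 - 2 * x ≠ 0 →
        G x = (1 - 2 * x) ^ 6 * p.eval ((s 3 - x * (s 3 + s 0)) / (1 - 2 * x)) := by
      intro x hx
      have h1 : ((1 - 2 * x, s 3 - x * (s 3 + s 0)) : ℝ × ℝ) =
          (1 - 2 * x) • (1, (s 3 - x * (s 3 + s 0)) / (1 - 2 * x)) := by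
        ext
        · simp
        · simp [mul_div_cancel₀ _ hx]
      simp only [G]
      rw [hpe, h1, det_pencil_smul]
      field_simp
    obtain ⟨t, ht, htT⟩ := exists_mem_segment_notMem hT hd (show (3 : Fin 4) ≠ 0 by decide) (hs 3)
      (hsmul 0 _ (hs 0) (-1) (by norm_num))
    obtain ⟨a, b, ha, hb, hab, rfl⟩ := ht
    have ha' : a = 1 - b := by linarith
    subst ha'
    have hval : (1 - b) • ((1 : ℝ), s 3) + b • ((-1 : ℝ) • ((1 : ℝ), s 0)) =
        (1 - 2 * b, s 3 - b * (s 3 + s 0)) := by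
      ext
      · simp; ring
      · simp; ring
    rw [hval] at htT
    have hGb : 0 < G b := by
      have h0 := hnn _ htT
      have h1 : 0 < (1 - 2 * b) ^ 2 + (s 3 - b * (s 3 + s 0)) ^ 2 := by
        by_cases hb2 : 1 - 2 * b = 0
        · have : b = 1 / 2 := by linarith
          subst this
          have : s 3 - 1 / 2 * (s 3 + s 0) ≠ 0 := by intro h; linarith
          positivity
        · positivity
      positivity
    have hG0 : G 0 < 0 := by
      rw [hGp 0 (by norm_num)]
      simpa using hps 3
    have hG1 : G 1 < 0 := by
      rw [hGp 1 (by norm_num)]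
      norm_num
      have : -s 0 / -1 = s 0 := by ring
      simpa [this] using hps 0
    have hb0 : 0 < b := lt_of_le_of_ne hb fun h => by rw [← h] at hGb; exact lt_asymm hGb hG0
    have hb1 : b < 1 := lt_of_le_of_ne (by linarith) fun h => by
      rw [h] at hGb; exact lt_asymm hGb hG1
    -- The positive point found may be the point at infinity, where `1 - 2 * b = 0`. A nearby
    -- parameter avoids it and keeps `G` positive.
    have hev : ∀ᶠ x in 𝓝[≠] b, 0 < G x ∧ 0 < x ∧ x < 1 :=
      ((hGc.continuousAt.eventually (lt_mem_nhds hGb)).and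
        ((lt_mem_nhds hb0).and (gt_mem_nhds hb1))).filter_mono nhdsWithin_le_nhds
    have hev2 : ∀ᶠ x in 𝓝[≠] b, 1 - 2 * x ≠ 0 := by
      by_cases hb2 : 1 - 2 * b = 0
      · filter_upwards [self_mem_nhdsWithin] with x hx h
        exact hx (by simp; linarith)
      · have : ContinuousAt (fun x : ℝ => 1 - 2 * x) b := by fun_prop
        exact (this.eventually_ne hb2).filter_mono nhdsWithin_le_nhds
    obtain ⟨x, ⟨hGx, hx0, hx1⟩, hx⟩ := (hev.and hev2).exists
    rw [hGp x hx] at hGx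
    refine ⟨_, ?_, (mul_pos_iff_of_pos_left (by positivity)).1 hGx⟩
    rcases hx.lt_or_gt with h | h
    · left
      rw [div_lt_iff_of_neg h]
      nlinarith
    · right
      rw [lt_div_iff₀ h]
      nlinarith
  obtain ⟨r, hr, hrp⟩ := houter
  -- Four negative values and four positive ones alternate on the affine line, which makes seven
  -- sign changes.
  have h7 : 7 ≤ p.natDegree := by
    rcases hr with hr | hr
    · refine le_natDegree_of_alternating hp0 (a := ![r, s 0, r0, s 1, r1, s 2, r2, s 3]) ?_ ?_
      · rw [Fin.strictMono_iff_lt_succ]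
        intro i
        fin_cases i
        exacts [hr, hr0.1, hr0.2, hr1.1, hr1.2, hr2.1, hr2.2]
      · intro i
        fin_cases i
        exacts [mul_neg_of_pos_of_neg hrp (hps 0), mul_neg_of_neg_of_pos (hps 0) hr0p,
          mul_neg_of_pos_of_neg hr0p (hps 1), mul_neg_of_neg_of_pos (hps 1) hr1p,
          mul_neg_of_pos_of_neg hr1p (hps 2), mul_neg_of_neg_of_pos (hps 2) hr2p,
          mul_neg_of_pos_of_neg hr2p (hps 3)]
    · refine le_natDegree_of_alternating hp0 (a := ![s 0, r0, s 1, r1, s 2, r2, s 3, r]) ?_ ?_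
      · rw [Fin.strictMono_iff_lt_succ]
        intro i
        fin_cases i
        exacts [hr0.1, hr0.2, hr1.1, hr1.2, hr2.1, hr2.2, hr]
      · intro i
        fin_cases i
        exacts [mul_neg_of_neg_of_pos (hps 0) hr0p,
          mul_neg_of_pos_of_neg hr0p (hps 1), mul_neg_of_neg_of_pos (hps 1) hr1p,
          mul_neg_of_pos_of_neg hr1p (hps 2), mul_neg_of_neg_of_pos (hps 2) hr2p,
          mul_neg_of_pos_of_neg hr2p (hps 3), mul_neg_of_neg_of_pos (hps 3) hrp]
  omega

/-- The negative regions of a pencil of conics that is positive somewhere on every line have at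
most three parts. -/
lemma not_four_regions (h₁ : A₁.IsSymm) (h₂ : A₂.IsSymm) (h₃ : A₃.IsSymm)
    {D : Fin 4 → Set (Fin 3 → ℝ)} (hD : ∀ i, IsOpen (D i))
    (hd : Pairwise fun i j => Disjoint (D i) (D j)) (hDneg : ∀ i, ∀ x ∈ D i, -x ∈ D i)
    (hpl : ∀ t : ℝ × ℝ, t ≠ 0 → ∀ l : Fin 3 → ℝ, l ≠ 0 →
      ∃ y, l ⬝ᵥ y = 0 ∧ 0 < y ⬝ᵥ (pencil A₁ A₂ A₃ t).mulVec y)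
    (hcov : ∀ t x, x ⬝ᵥ (pencil A₁ A₂ A₃ t).mulVec x < 0 → ∃ i, x ∈ D i)
    (hne : ∀ i, ∃ t, ∃ x ∈ D i, x ⬝ᵥ (pencil A₁ A₂ A₃ t).mulVec x < 0) : False := by
  have hsymm : ∀ t, (pencil A₁ A₂ A₃ t).IsSymm := fun t =>
    ((h₁.smul _).add (h₂.smul _)).add (h₃.smul _)
  have hcont : ∀ x : Fin 3 → ℝ, Continuous fun t => x ⬝ᵥ (pencil A₁ A₂ A₃ t).mulVec x := fun x =>
    continuous_const.dotProduct ((continuous_pencil A₁ A₂ A₃).matrix_mulVec continuous_const)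
  refine not_four_arcs (A₁ := A₁) (A₂ := A₂) (A₃ := A₃)
    (T := fun i => {t | ∃ x ∈ D i, x ⬝ᵥ (pencil A₁ A₂ A₃ t).mulVec x < 0}) ?_ hne ?_ ?_ ?_ ?_
  · intro i
    rw [isOpen_iff_mem_nhds]
    rintro t ⟨x, hx, ht⟩
    filter_upwards [(hcont x).continuousAt.eventually (gt_mem_nhds ht)] with t' ht'
    exact ⟨x, hx, ht'⟩
  · intro i j hij
    rw [disjoint_left]
    rintro t ⟨x, hx, htx⟩ ⟨y, hy, hty⟩
    -- Choosing the sign of `y` so that the mixed term is nonpositive puts `x` and `y` in one nappe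
    -- of the negative cone. The form is then negative along the whole segment from `x` to `y`,
    -- which must nevertheless leave all the sets `D k`.
    obtain ⟨y, hy, hty, hxy⟩ : ∃ y ∈ D j, y ⬝ᵥ (pencil A₁ A₂ A₃ t).mulVec y < 0 ∧
        x ⬝ᵥ (pencil A₁ A₂ A₃ t).mulVec y ≤ 0 := by
      rcases le_total (x ⬝ᵥ (pencil A₁ A₂ A₃ t).mulVec y) 0 with h | h
      · exact ⟨y, hy, hty, h⟩
      · exact ⟨-y, hDneg j y hy, by simpa [Matrix.mulVec_neg] using hty,
          by simpa [Matrix.mulVec_neg] using h⟩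
    obtain ⟨z, hz, hzD⟩ := exists_mem_segment_notMem hD hd hij hx hy
    obtain ⟨a, b, ha, hb, hab, rfl⟩ := hz
    have hyx : y ⬝ᵥ (pencil A₁ A₂ A₃ t).mulVec x = x ⬝ᵥ (pencil A₁ A₂ A₃ t).mulVec y := by
      rw [Matrix.dotProduct_mulVec, ← Matrix.mulVec_transpose, (hsymm t).eq, dotProduct_comm]
    obtain ⟨k, hk⟩ := hcov t (a • x + b • y) (by
      simp only [Matrix.mulVec_add, Matrix.mulVec_smul, dotProduct_add, add_dotProduct,
        smul_dotProduct, dotProduct_smul, smul_eq_mul, hyx]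
      have h1 : 0 ≤ a * b := mul_nonneg ha hb
      have h2 : a * b * (x ⬝ᵥ (pencil A₁ A₂ A₃ t).mulVec y) ≤ 0 :=
        mul_nonpos_of_nonneg_of_nonpos h1 hxy
      rcases ha.eq_or_lt with h0 | h0
      · have hb1 : b = 1 := by linarith
        subst h0 hb1
        simpa using hty
      · have h3 : a * (a * (x ⬝ᵥ (pencil A₁ A₂ A₃ t).mulVec x)) < 0 :=
          mul_neg_of_pos_of_neg h0 (mul_neg_of_pos_of_neg h0 htx)
        have h4 : b * (b * (y ⬝ᵥ (pencil A₁ A₂ A₃ t).mulVec y)) ≤ 0 :=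
          mul_nonpos_of_nonneg_of_nonpos hb (mul_nonpos_of_nonneg_of_nonpos hb hty.le)
        linarith)
    exact hzD k hk
  · rintro i t ⟨x, hx, ht⟩ c hc
    refine ⟨x, hx, ?_⟩
    rw [pencil_smul, Matrix.smul_mulVec, dotProduct_smul, smul_eq_mul]
    exact mul_neg_of_pos_of_neg (by positivity) ht
  · rintro i t ⟨x, hx, ht⟩
    refine det_neg_of_forall_plane (hsymm t) ht (hpl t ?_)
    rintro rfl
    simp [pencil] at ht
  · intro t ht
    refine Matrix.PosSemidef.det_nonneg (Matrix.PosSemidef.of_dotProduct_mulVec_nonneg ?_ ?_)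
    · exact (hsymm t)
    · intro x
      by_contra! hx
      obtain ⟨i, hi⟩ := hcov t x hx
      exact ht i ⟨x, hi, hx⟩

end Pencil

/-! ### The sign of the quartic on the outside -/

lemma exists_isSymm_of_isHomogeneous {Q : MvPolynomial (Fin 3) ℝ} (hQ : Q.IsHomogeneous 2) :
    ∃ A : Matrix (Fin 3) (Fin 3) ℝ, A.IsSymm ∧ ∀ x, eval x Q = x ⬝ᵥ A.mulVec x := by
  have key : ∃ a b c d e f : ℝ, ∀ x : Fin 3 → ℝ, eval x Q = a * x 0 ^ 2 + b * x 1 ^ 2 +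
      c * x 2 ^ 2 + d * (x 0 * x 1) + e * (x 0 * x 2) + f * (x 1 * x 2) := by
    rw [← Q.support_sum_monomial_coeff]
    refine Finset.sum_induction _ (fun Q => ∃ a b c d e f : ℝ, ∀ x : Fin 3 → ℝ,
      eval x Q = a * x 0 ^ 2 + b * x 1 ^ 2 + c * x 2 ^ 2 + d * (x 0 * x 1) + e * (x 0 * x 2) +
        f * (x 1 * x 2)) ?_ ⟨0, 0, 0, 0, 0, 0, by simp⟩ ?_
    · rintro p q ⟨a, b, c, d, e, f, hp⟩ ⟨a', b', c', d', e', f', hq⟩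
      refine ⟨a + a', b + b', c + c', d + d', e + e', f + f', fun x => ?_⟩
      rw [map_add, hp, hq]
      ring
    · intro m hm
      have hdeg : m.degree = 2 := by
        by_contra h
        exact mem_support_iff.1 hm (hQ.coeff_eq_zero h)
      rw [Finsupp.degree_eq_sum, Fin.sum_univ_three] at hdeg
      generalize coeff m Q = k
      have hev : ∀ x : Fin 3 → ℝ, eval x (monomial m k) = k * (x 0 ^ m 0 * x 1 ^ m 1 * x 2 ^ m 2) := by
        intro x
        rw [eval_monomial, Finsupp.prod_fintype _ _ (by simp), Fin.prod_univ_three]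
      simp only [hev]
      generalize m 0 = i at hdeg
      generalize m 1 = j at hdeg
      generalize m 2 = n at hdeg
      have : i ≤ 2 := by omega
      have : j ≤ 2 := by omega
      have hn : n = 2 - i - j := by omega
      subst hn
      interval_cases i <;> interval_cases j <;> first | (exfalso; omega) | skip
      · exact ⟨0, 0, k, 0, 0, 0, fun x => by simp⟩
      · exact ⟨0, 0, 0, 0, 0, k, fun x => by simp⟩
      · exact ⟨0, k, 0, 0, 0, 0, fun x => by simp⟩
      · exact ⟨0, 0, 0, 0, k, 0, fun x => by simp⟩
      · exact ⟨0, 0, 0, k, 0, 0, fun x => by simp⟩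
      · exact ⟨k, 0, 0, 0, 0, 0, fun x => by simp⟩
  obtain ⟨a, b, c, d, e, f, h⟩ := key
  refine ⟨!![a, d / 2, e / 2; d / 2, b, f / 2; e / 2, f / 2, c], ?_, fun x => ?_⟩
  · ext i j
    fin_cases i <;> fin_cases j <;> rfl
  · rw [h]
    simp [Matrix.mulVec, dotProduct, Fin.sum_univ_three]
    ring

lemma isHomogeneous_discriminant {Q₁ Q₂ Q₃ : MvPolynomial (Fin 3) ℝ}
    (h₁ : Q₁.IsHomogeneous 2) (h₂ : Q₂.IsHomogeneous 2) (h₃ : Q₃.IsHomogeneous 2) :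
    (Q₁ * Q₃ - Q₂ ^ 2).IsHomogeneous 4 :=
  (h₁.mul h₃).sub (h₂.pow 2)

/-- A quadratic form has constant sign on a connected set on which it has no zeros. -/
lemma exists_unit_mul_pos {Q : MvPolynomial (Fin 3) ℝ} (hQ : Q.IsHomogeneous 2) {O : Set RP2}
    (hO : IsPreconnected O) (h0 : ∀ v, v ≠ 0 → pr v ∈ O → eval v Q ≠ 0) :
    ∃ ε : ℝ, ε * ε = 1 ∧ ∀ v, v ≠ 0 → pr v ∈ O → 0 < ε * eval v Q := by
  have hopen : ∀ ε : ℝ, IsOpen (pr '' {v | v ≠ 0 ∧ 0 < ε * eval v Q}) := by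
    intro ε
    refine isOpen_image_pr ?_ (by simp)
    exact isOpen_ne.inter (isOpen_lt continuous_const
      (continuous_const.mul (continuous_eval Q)))
  have hmem : ∀ ε : ℝ, ∀ v, v ≠ 0 → pr v ∈ pr '' {v | v ≠ 0 ∧ 0 < ε * eval v Q} →
      0 < ε * eval v Q := by
    rintro ε v hv ⟨w, ⟨hw, hpos⟩, hwv⟩
    obtain ⟨c, hc, rfl⟩ := exists_smul_of_pr_eq hw hv hwv
    rw [eval_smul_of_isHomogeneous hQ]
    have : 0 < c ^ 2 := by positivity
    calc 0 < c ^ 2 * (ε * eval w Q) := mul_pos this hpos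
      _ = _ := by ring
  rcases hO.subset_or_subset (hopen 1) (hopen (-1))
    (by
      rw [disjoint_left]
      intro P h1 h2
      obtain ⟨v, hv, rfl⟩ := exists_pr_eq P
      have := hmem _ v hv h1
      have := hmem _ v hv h2
      linarith)
    (by
      intro P hP
      obtain ⟨v, hv, rfl⟩ := exists_pr_eq P
      rcases (h0 v hv hP).lt_or_gt with h | h
      · exact .inr ⟨v, ⟨hv, by linarith⟩, rfl⟩
      · exact .inl ⟨v, ⟨hv, by linarith⟩, rfl⟩) with h | h
  · exact ⟨1, by norm_num, fun v hv hvO => hmem 1 v hv (h hvO)⟩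
  · exact ⟨-1, by norm_num, fun v hv hvO => hmem (-1) v hv (h hvO)⟩

/-- A binary quadratic form with `ac - b² < 0` is indefinite, so it takes values of either sign. -/
lemma exists_unit_mul_neg {ε a b c : ℝ} (hε : ε * ε = 1) (h : a * c - b ^ 2 < 0) :
    ∃ t : ℝ × ℝ, ε * (t.1 ^ 2 * a + 2 * t.1 * t.2 * b + t.2 ^ 2 * c) < 0 := by
  rcases lt_trichotomy (ε * a) 0 with ha | ha | ha
  · exact ⟨(1, 0), by simpa using ha⟩
  · have ha0 : a = 0 := by
      calc a = ε * ε * a := by rw [hε, one_mul]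
        _ = 0 := by rw [mul_assoc, ha, mul_zero]
    subst ha0
    have hb : b ≠ 0 := by rintro rfl; simp at h
    -- With `a = 0` the form is linear in the first parameter; this is where it takes the value
    -- `-ε`.
    refine ⟨(-(c + ε) / (2 * b), 1), ?_⟩
    have : (-(c + ε) / (2 * b)) ^ 2 * 0 + 2 * (-(c + ε) / (2 * b)) * 1 * b + 1 ^ 2 * c = -ε := by
      field_simp
      ring
    simp only [this]
    linarith
  · refine ⟨(-b, a), ?_⟩
    have : ε * ((-b) ^ 2 * a + 2 * -b * a * b + a ^ 2 * c) = ε * a * (a * c - b ^ 2) := by ring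
    simp only [this]
    exact mul_neg_of_pos_of_neg ha h

/-- The discriminant of a conic bundle over `ℙ¹` is not positive outside four ovals. -/
lemma outside_ne_posLocus {Q₁ Q₂ Q₃ : MvPolynomial (Fin 3) ℝ}
    (h₁ : Q₁.IsHomogeneous 2) (h₂ : Q₂.IsHomogeneous 2) (h₃ : Q₃.IsHomogeneous 2)
    (hs : IsSmoothCurve (Q₁ * Q₃ - Q₂ ^ 2)) {D : Fin 4 → Set RP2} {O : Set RP2}
    (hD : ∀ i, IsOpen (D i)) (hne : ∀ i, (D i).Nonempty)
    (hd : Pairwise fun i j => Disjoint (D i) (D j)) (hO : IsPreconnected O)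
    (hline : ∀ l : Fin 3 → ℝ, l ≠ 0 → ∃ P ∈ O, l ⬝ᵥ P.rep = 0)
    (hpos : O = posLocus (Q₁ * Q₃ - Q₂ ^ 2)) (hneg : ⋃ i, D i = negLocus (Q₁ * Q₃ - Q₂ ^ 2)) :
    False := by
  set F := Q₁ * Q₃ - Q₂ ^ 2 with hFdef
  have hF : F.IsHomogeneous 4 := isHomogeneous_discriminant h₁ h₂ h₃
  have hFe : ∀ x, eval x F = eval x Q₁ * eval x Q₃ - eval x Q₂ ^ 2 := fun x => by simp [hFdef]
  have hmemO : ∀ x, x ≠ 0 → (pr x ∈ O ↔ 0 < eval x F) := fun x hx => by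
    rw [hpos, pr_mem_posLocus hF hx]
  -- On `O` one has `Q₁Q₃ > Q₂² ≥ 0`, so `Q₁` has no zeros there and its sign `ε` is constant by
  -- connectedness.
  obtain ⟨ε, hε, hεQ⟩ := exists_unit_mul_pos h₁ hO fun v hv hvO h0 => by
    have := (hmemO v hv).1 hvO
    rw [hFe, h0] at this
    nlinarith [sq_nonneg (eval v Q₂)]
  obtain ⟨A₁, hA₁, hQ₁⟩ := exists_isSymm_of_isHomogeneous h₁
  obtain ⟨A₂, hA₂, hQ₂⟩ := exists_isSymm_of_isHomogeneous h₂
  obtain ⟨A₃, hA₃, hQ₃⟩ := exists_isSymm_of_isHomogeneous h₃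
  have hq : ∀ t x, x ⬝ᵥ (pencil (ε • A₁) (ε • A₂) (ε • A₃) t).mulVec x =
      ε * (t.1 ^ 2 * eval x Q₁ + 2 * t.1 * t.2 * eval x Q₂ + t.2 ^ 2 * eval x Q₃) := by
    intro t x
    rw [hQ₁, hQ₂, hQ₃]
    simp only [pencil, Matrix.add_mulVec, Matrix.smul_mulVec, dotProduct_add, dotProduct_smul,
      smul_eq_mul]
    ring
  have hqpos : ∀ t : ℝ × ℝ, t ≠ 0 → ∀ x, x ≠ 0 → 0 < eval x F →
      0 < ε * (t.1 ^ 2 * eval x Q₁ + 2 * t.1 * t.2 * eval x Q₂ + t.2 ^ 2 * eval x Q₃) := by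
    intro t ht x hx hxF
    have hQ := hεQ x hx ((hmemO x hx).2 hxF)
    rw [hFe] at hxF
    -- Completing the square: this is `Q₁ Q_t`.
    have hprod : 0 < (t.1 * eval x Q₁ + t.2 * eval x Q₂) ^ 2 +
        t.2 ^ 2 * (eval x Q₁ * eval x Q₃ - eval x Q₂ ^ 2) := by
      by_cases h2 : t.2 = 0
      · have h1 : t.1 ≠ 0 := fun h1 => ht (Prod.ext h1 h2)
        have hQ0 : eval x Q₁ ≠ 0 := fun h0 => by rw [h0] at hQ; simp at hQ
        rw [h2]
        simp only [zero_mul, add_zero]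
        positivity
      · positivity
    refine pos_of_mul_pos_left (b := ε * eval x Q₁) ?_ hQ.le
    have : ε * (t.1 ^ 2 * eval x Q₁ + 2 * t.1 * t.2 * eval x Q₂ + t.2 ^ 2 * eval x Q₃) *
        (ε * eval x Q₁) = (ε * ε) * ((t.1 * eval x Q₁ + t.2 * eval x Q₂) ^ 2 +
        t.2 ^ 2 * (eval x Q₁ * eval x Q₃ - eval x Q₂ ^ 2)) := by ring
    rw [this, hε, one_mul]
    exact hprod
  refine not_four_regions (A₁ := ε • A₁) (A₂ := ε • A₂) (A₃ := ε • A₃) (hA₁.smul ε) (hA₂.smul ε)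
    (hA₃.smul ε) (D := fun i => {x | x ≠ 0 ∧ pr x ∈ D i}) ?_ ?_ ?_ ?_ ?_ ?_
  · intro i
    rw [isOpen_iff_mem_nhds]
    rintro x ⟨hx, hxD⟩
    exact inter_mem (isOpen_ne.mem_nhds hx) ((continuousAt_pr hx).eventually ((hD i).mem_nhds hxD))
  · intro i j hij
    exact disjoint_left.2 fun x hx hx' => disjoint_left.1 (hd hij) hx.2 hx'.2
  · rintro i x ⟨hx, hxD⟩
    exact ⟨neg_ne_zero.2 hx, by rwa [pr_neg]⟩
  · intro t ht l hl
    obtain ⟨P, hP, hlP⟩ := hline l hl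
    refine ⟨P.rep, hlP, ?_⟩
    rw [hq]
    exact hqpos t ht _ P.rep_nonzero ((hmemO _ P.rep_nonzero).1 (by rwa [pr_rep]))
  · intro t x hx
    have hx0 : x ≠ 0 := by rintro rfl; simp at hx
    have ht : t ≠ 0 := by rintro rfl; simp [pencil] at hx
    rw [hq] at hx
    -- The conic is positive where `F > 0`. A point with `F = 0` is a limit of such points, so it
    -- cannot lie in the open set where the conic is negative.
    have hxF : eval x F < 0 := by
      by_contra! hcon
      rcases hcon.eq_or_lt with h0 | h0
      · have hc : Continuous fun y : Fin 3 → ℝ =>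
            ε * (t.1 ^ 2 * eval y Q₁ + 2 * t.1 * t.2 * eval y Q₂ + t.2 ^ 2 * eval y Q₃) := by
          have := continuous_eval Q₁
          have := continuous_eval Q₂
          have := continuous_eval Q₃
          fun_prop
        obtain ⟨y, hy, hy', hy0⟩ := ((hs.isSideAt_pos_cone hx0 h0.symm).frequently.and_eventually
          ((hc.continuousAt.eventually (gt_mem_nhds hx)).and (isOpen_ne.mem_nhds hx0))).exists
        exact lt_asymm hy' (hqpos t ht y hy0 hy)
      · exact lt_asymm hx (hqpos t ht x hx0 h0)
    have : pr x ∈ ⋃ i, D i := hneg ▸ (pr_mem_negLocus hF hx0).2 hxF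
    obtain ⟨i, hi⟩ := mem_iUnion.1 this
    exact ⟨i, hx0, hi⟩
  · intro i
    obtain ⟨P, hP⟩ := hne i
    have hPn : P ∈ negLocus F := hneg ▸ mem_iUnion.2 ⟨i, hP⟩
    have hPF : eval P.rep F < 0 := hPn
    rw [hFe] at hPF
    obtain ⟨t, ht⟩ := exists_unit_mul_neg hε hPF
    exact ⟨t, P.rep, ⟨P.rep_nonzero, by rwa [pr_rep]⟩, by rwa [hq]⟩

/-- The first half of the result: the quartic is negative exactly on the outside, which meets
every line. -/
theorem outside_eq_negLocus {Q₁ Q₂ Q₃ : MvPolynomial (Fin 3) ℝ}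
    (h₁ : Q₁.IsHomogeneous 2) (h₂ : Q₂.IsHomogeneous 2) (h₃ : Q₃.IsHomogeneous 2)
    (hs : IsSmoothCurve (Q₁ * Q₃ - Q₂ ^ 2))
    (ho : ConsistsOfOvals 4 (zeroLocus (Q₁ * Q₃ - Q₂ ^ 2))) :
    outside (Q₁ * Q₃ - Q₂ ^ 2) = negLocus (Q₁ * Q₃ - Q₂ ^ 2) ∧
    ∀ l : Fin 3 → ℝ, l ≠ 0 → ∃ v, v ≠ 0 ∧ l ⬝ᵥ v = 0 ∧ eval v (Q₁ * Q₃ - Q₂ ^ 2) < 0 := by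
  obtain ⟨D, O, hD, hne, hd, hO, hline, hout, hcases⟩ :=
    exists_outside_and_insides (isHomogeneous_discriminant h₁ h₂ h₃) hs ho
  rcases hcases with ⟨hpos, hneg⟩ | ⟨hneg, -⟩
  · exact (outside_ne_posLocus h₁ h₂ h₃ hs hD hne hd hO hline hpos hneg).elim
  · refine ⟨hout.trans hneg, fun l hl => ?_⟩
    obtain ⟨P, hP, hlP⟩ := hline l hl
    have hPn : P ∈ negLocus (Q₁ * Q₃ - Q₂ ^ 2) := hneg ▸ hP
    exact ⟨P.rep, P.rep_nonzero, hlP, hPn⟩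

/-! ### Factors of homogeneous polynomials -/

section Factors

variable {σ R : Type*} [CommRing R]

/-- The substitution `X i ↦ X i * T` records the degree of each monomial as a power of `T`. -/
lemma coeff_aeval_C_X_mul_X (p : MvPolynomial σ R) (k : ℕ) :
    (aeval (fun i => Polynomial.C (X i) * Polynomial.X : σ → Polynomial (MvPolynomial σ R))
      p).coeff k = homogeneousComponent k p := by
  induction p using MvPolynomial.induction_on' with
  | monomial d c =>
    have : aeval (fun i => Polynomial.C (X i) * Polynomial.X : σ → Polynomial (MvPolynomial σ R))
        (monomial d c) = Polynomial.monomial d.degree (monomial d c) := by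
      rw [aeval_monomial, ← Polynomial.C_mul_X_pow_eq_monomial, monomial_eq, Finsupp.degree_apply,
        Polynomial.C_mul, mul_assoc]
      simp only [mul_pow, Finsupp.prod]
      rw [Finset.prod_mul_distrib, Finset.prod_pow_eq_pow_sum, map_prod]
      simp only [map_pow]
      rfl
    rw [this, Polynomial.coeff_monomial, homogeneousComponent_of_mem (isHomogeneous_monomial c rfl)]
    simp only [eq_comm]
  | add p q hp hq => simp [hp, hq]

/-- The factors of a nonzero homogeneous polynomial over a domain are homogeneous. -/
lemma exists_isHomogeneous_of_mul [IsDomain R] {p q : MvPolynomial σ R} {n : ℕ}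
    (h : (p * q).IsHomogeneous n) (h0 : p * q ≠ 0) : ∃ k, p.IsHomogeneous k := by
  -- A homogeneous product becomes a monomial in `T`. Degree and trailing degree are additive over a
  -- domain, so they must coincide for each factor, which therefore has only one homogeneous
  -- component.
  let Φ := aeval (R := R) (fun i => Polynomial.C (X i) * Polynomial.X :
    σ → Polynomial (MvPolynomial σ R))
  have hΦ : Φ p * Φ q = Polynomial.monomial n (p * q) := by
    rw [← map_mul]
    ext1 k
    rw [coeff_aeval_C_X_mul_X, Polynomial.coeff_monomial, homogeneousComponent_of_mem h]
    simp only [eq_comm]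
  have hne : Φ p * Φ q ≠ 0 := by
    rw [hΦ]
    simpa using h0
  have hp0 := left_ne_zero_of_mul hne
  have hq0 := right_ne_zero_of_mul hne
  have h1 := Polynomial.natDegree_mul hp0 hq0
  have h2 := Polynomial.natTrailingDegree_mul hp0 hq0
  rw [hΦ, Polynomial.natDegree_monomial_eq n h0] at h1
  rw [hΦ, Polynomial.natTrailingDegree_monomial h0] at h2
  have h3 := Polynomial.natTrailingDegree_le_natDegree (Φ p)
  have h4 := Polynomial.natTrailingDegree_le_natDegree (Φ q)
  refine ⟨(Φ p).natDegree, ?_⟩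
  intro d hd
  have hcoeff : (Φ p).coeff d.degree ≠ 0 := by
    intro h5
    rw [coeff_aeval_C_X_mul_X] at h5
    have := coeff_homogeneousComponent d.degree p d
    rw [h5] at this
    simp at this
    exact hd this.symm
  have h5 := Polynomial.le_natDegree_of_ne_zero hcoeff
  have h6 := Polynomial.natTrailingDegree_le_of_ne_zero hcoeff
  have h7 : d.degree = (Φ p).natDegree := by omega
  rw [← h7]
  exact congrFun (congrArg DFunLike.coe Finsupp.degree_eq_weight_one.symm) d

/-- The relation reads `q₁ q₃ = (q₂ + r)(q₂ - r)`. Unique factorization distributes `q₁` as `a * c`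
with `a ∣ q₂ + r` and `c ∣ q₂ - r`; the cofactors are `d` and `b`. The conclusion says that `t₀² q₁
+ 2 t₀ t₁ q₂ + t₁² q₃ = (t₀ a + t₁ b)(t₀ c + t₁ d)`. -/
lemma exists_factorization {k : Type*} [Field k] [Finite σ]
    {q₁ q₂ q₃ r : MvPolynomial σ k} (h₁ : q₁.IsHomogeneous 2) (h₂ : q₂.IsHomogeneous 2)
    (h₃ : q₃.IsHomogeneous 2) (hr : r.IsHomogeneous 2) (h : q₁ * q₃ - q₂ ^ 2 = -r ^ 2) :
    ∃ (n m : ℕ) (a b c d : MvPolynomial σ k), a.IsHomogeneous n ∧ b.IsHomogeneous n ∧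
      c.IsHomogeneous m ∧ d.IsHomogeneous m ∧ q₁ = a * c ∧ q₃ = b * d ∧ 2 * q₂ = a * d + b * c := by
  by_cases hq₁ : q₁ = 0
  -- For `q₁ = 0` cancellation is not available, but the quadratic is visibly `t₁ (2 t₀ q₂ + t₁
  -- q₃)`.
  · refine ⟨0, 2, 0, 1, C 2 * q₂, q₃, isHomogeneous_zero _ _ _, isHomogeneous_one _ _,
      h₂.C_mul 2, h₃, by simp [hq₁], by simp, ?_⟩
    simp [map_ofNat]
  have hprod : q₁ * q₃ = (q₂ + r) * (q₂ - r) := by linear_combination h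
  obtain ⟨a, c, ⟨d, hd⟩, ⟨b, hb⟩, hac⟩ := exists_dvd_and_dvd_of_dvd_mul (Dvd.intro _ hprod)
  have ha0 : a ≠ 0 := by rintro rfl; simp at hac; exact hq₁ hac
  have hc0 : c ≠ 0 := by rintro rfl; simp at hac; exact hq₁ hac
  have hq₃ : q₃ = b * d := by
    refine mul_left_cancel₀ hq₁ ?_
    rw [hprod, hd, hb, hac]
    ring
  obtain ⟨n, hn⟩ := exists_isHomogeneous_of_mul (hac ▸ h₁) (hac ▸ hq₁)
  obtain ⟨m, hm⟩ := exists_isHomogeneous_of_mul (p := c) (q := a)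
    (by rw [mul_comm, ← hac]; exact h₁) (by rw [mul_comm, ← hac]; exact hq₁)
  have hnm : n + m = 2 := (hac ▸ hn.mul hm).inj_right h₁ hq₁
  have key : ∀ {s e p : MvPolynomial σ k} {i j : ℕ}, s = e * p → s.IsHomogeneous 2 → e ≠ 0 →
      e.IsHomogeneous i → i + j = 2 → p.IsHomogeneous j := by
    intro s e p i j hs hs2 he0 he hij
    by_cases hp : p = 0
    · rw [hp]; exact isHomogeneous_zero _ _ _
    have hs0 : e * p ≠ 0 := mul_ne_zero he0 hp
    obtain ⟨j', hj'⟩ := exists_isHomogeneous_of_mul (p := p) (q := e)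
      (by rw [mul_comm, ← hs]; exact hs2) (by rwa [mul_comm])
    have : i + j' = 2 := (he.mul hj').inj_right (hs ▸ hs2) hs0
    have : j' = j := by omega
    exact this ▸ hj'
  refine ⟨n, m, a, b, c, d, hn, key hb (h₂.sub hr) hc0 hm (by omega), hm,
    key hd (h₂.add hr) ha0 hn hnm, hac, hq₃, ?_⟩
  linear_combination hd + hb

end Factors

/-! ### Real square roots up to sign -/

lemma exists_re_im {σ : Type*} (G : MvPolynomial σ ℂ) {n : ℕ} (hG : G.IsHomogeneous n) :
    ∃ u w : MvPolynomial σ ℝ, u.IsHomogeneous n ∧ w.IsHomogeneous n ∧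
      G = MvPolynomial.map (algebraMap ℝ ℂ) u + C Complex.I * MvPolynomial.map (algebraMap ℝ ℂ) w := by
  classical
  have hc : ∀ g : ℂ → ℝ, g 0 = 0 → ∀ d, coeff d (∑ e ∈ G.support, monomial e (g (coeff e G))) =
      g (coeff d G) := by
    intro g hg d
    simp only [coeff_sum, coeff_monomial, Finset.sum_ite_eq', mem_support_iff, ne_eq,
      ite_not, ite_eq_right_iff]
    intro h
    rw [h, hg]
  have hhom : ∀ g : ℂ → ℝ, g 0 = 0 →
      (∑ e ∈ G.support, monomial e (g (coeff e G))).IsHomogeneous n := by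
    intro g hg d hd
    rw [hc g hg] at hd
    exact hG fun h => hd (by rw [h, hg])
  refine ⟨_, _, hhom Complex.re rfl, hhom Complex.im rfl, ?_⟩
  ext1 d
  rw [coeff_add, coeff_C_mul, coeff_map, coeff_map, hc _ rfl, hc _ rfl]
  simp [mul_comm Complex.I, Complex.re_add_im]

/-- A real polynomial that is a square over `ℂ` is a square over `ℝ`, up to sign. -/
lemma exists_eq_sq_or_eq_neg_sq {σ : Type*} {f : MvPolynomial σ ℝ} {G : MvPolynomial σ ℂ} {n : ℕ}
    (hG : G.IsHomogeneous n) (h : MvPolynomial.map (algebraMap ℝ ℂ) f = G ^ 2) :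
    ∃ r : MvPolynomial σ ℝ, r.IsHomogeneous n ∧ (f = r ^ 2 ∨ f = -r ^ 2) := by
  obtain ⟨u, w, hu, hw, rfl⟩ := exists_re_im G hG
  have hII : (C Complex.I : MvPolynomial σ ℂ) * C Complex.I = -1 := by
    rw [← C_mul, Complex.I_mul_I]; simp
  -- With `G = u + i w`, comparing real and imaginary parts gives `f = u² - w²` and `2uw = 0`, so
  -- one of `u`, `w` vanishes.
  have h' : MvPolynomial.map (algebraMap ℝ ℂ) (f - u ^ 2 + w ^ 2) =
      C Complex.I * MvPolynomial.map (algebraMap ℝ ℂ) (2 * u * w) := by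
    simp only [map_add, map_sub, map_mul, map_pow, h, map_ofNat]
    linear_combination (MvPolynomial.map (algebraMap ℝ ℂ) w) ^ 2 * hII
  have hco : ∀ d, coeff d (f - u ^ 2 + w ^ 2) = 0 ∧ coeff d (2 * u * w) = 0 := by
    intro d
    have := congrArg (coeff d) h'
    rw [coeff_C_mul, coeff_map, coeff_map] at this
    have hre := congrArg Complex.re this
    have him := congrArg Complex.im this
    simp at hre him
    exact ⟨hre, him.symm⟩
  have h1 : f - u ^ 2 + w ^ 2 = 0 := by ext d; simpa using (hco d).1
  have h2 : 2 * u * w = 0 := by ext d; simpa using (hco d).2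
  rcases mul_eq_zero.1 h2 with h3 | h3
  · have hu0 : u = 0 := (mul_eq_zero.1 h3).resolve_left two_ne_zero
    exact ⟨w, hw, .inr (by rw [hu0] at h1; linear_combination h1)⟩
  · exact ⟨u, hu, .inl (by rw [h3] at h1; linear_combination h1)⟩

/-! ### Restriction to a line -/

section Line

variable (l : Fin 3 → ℝ) (k : Fin 3)

/-- The parametrization of the line `l = 0` by the two coordinates other than the `k`-th. -/
def lineParam : Fin 3 → MvPolynomial (Fin 2) ℝ :=
  k.insertNth (-∑ m, C (l (k.succAbove m) / l k) * X m) X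

/-- The restriction of a polynomial to the line `l = 0`. -/
def restrictLine : MvPolynomial (Fin 3) ℝ →ₐ[ℝ] MvPolynomial (Fin 2) ℝ := aeval (lineParam l k)

lemma isHomogeneous_lineParam (i : Fin 3) : (lineParam l k i).IsHomogeneous 1 := by
  rcases Fin.eq_self_or_eq_succAbove k i with rfl | ⟨m, rfl⟩
  · rw [lineParam, Fin.insertNth_apply_same]
    exact (IsHomogeneous.sum _ _ _ fun m _ => (isHomogeneous_X ℝ m).C_mul _).neg
  · rw [lineParam, Fin.insertNth_apply_succAbove]
    exact isHomogeneous_X ℝ m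

lemma isHomogeneous_restrictLine {Q : MvPolynomial (Fin 3) ℝ} {n : ℕ} (hQ : Q.IsHomogeneous n) :
    (restrictLine l k Q).IsHomogeneous n := by
  have := hQ.aeval (lineParam l k) (isHomogeneous_lineParam l k)
  rwa [one_mul] at this

variable {l k}

lemma aeval_restrictLine {A : Type*} [CommRing A] [Algebra ℝ A] (hk : l k ≠ 0) {x : Fin 3 → A}
    (hx : ∑ i, algebraMap ℝ A (l i) * x i = 0) (Q : MvPolynomial (Fin 3) ℝ) :
    aeval (x ∘ k.succAbove) (restrictLine l k Q) = aeval x Q := by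
  have hpar : ∀ i, aeval (x ∘ k.succAbove) (lineParam l k i) = x i := by
    intro i
    rcases Fin.eq_self_or_eq_succAbove k i with rfl | ⟨m, rfl⟩
    · rw [lineParam, Fin.insertNth_apply_same]
      rw [Fin.sum_univ_succAbove _ i] at hx
      simp only [map_neg, map_sum, map_mul, aeval_C, aeval_X, Function.comp_apply]
      have hu : algebraMap ℝ A (l i)⁻¹ * algebraMap ℝ A (l i) = 1 := by
        rw [← map_mul, inv_mul_cancel₀ hk, map_one]
      have hsum : ∑ m, algebraMap ℝ A (l (i.succAbove m) / l i) * x (i.succAbove m) =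
          algebraMap ℝ A (l i)⁻¹ * ∑ m, algebraMap ℝ A (l (i.succAbove m)) * x (i.succAbove m) := by
        rw [Finset.mul_sum]
        refine Finset.sum_congr rfl fun m _ => ?_
        rw [div_eq_inv_mul, map_mul, mul_assoc]
      rw [hsum]
      linear_combination (-algebraMap ℝ A (l i)⁻¹) * hx + x i * hu
    · rw [lineParam, Fin.insertNth_apply_succAbove, aeval_X]
      rfl
  rw [restrictLine, comp_aeval_apply]
  simp only [hpar]

lemma IsRealBitangent.exists_map_restrictLine_eq_sq {F : MvPolynomial (Fin 3) ℝ}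
    (h : IsRealBitangent F l) (hk : l k ≠ 0) :
    ∃ G : MvPolynomial (Fin 2) ℂ, G.IsHomogeneous 2 ∧
      MvPolynomial.map (algebraMap ℝ ℂ) (restrictLine l k F) = G ^ 2 := by
  obtain ⟨-, g, q, hg, hF⟩ := h
  let Ψ : MvPolynomial (Fin 3) ℂ →ₐ[ℂ] MvPolynomial (Fin 2) ℂ :=
    aeval fun i => MvPolynomial.map (algebraMap ℝ ℂ) (lineParam l k i)
  have hΨ : ∀ Q : MvPolynomial (Fin 3) ℝ, Ψ (MvPolynomial.map (algebraMap ℝ ℂ) Q) =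
      MvPolynomial.map (algebraMap ℝ ℂ) (restrictLine l k Q) := by
    intro Q
    induction Q using MvPolynomial.induction_on with
    | C a => simp [Ψ, restrictLine, MvPolynomial.algebraMap_eq]
    | add p q hp hq => simp only [map_add, hp, hq]
    | mul_X p i hp =>
      simp only [map_mul, hp, map_X]
      simp [Ψ, restrictLine]
  have hL : Ψ (∑ i, C (l i : ℂ) * X i) = 0 := by
    have h1 : (∑ i, C (l i : ℂ) * X i : MvPolynomial (Fin 3) ℂ) =
        MvPolynomial.map (algebraMap ℝ ℂ) (∑ i, C (l i) * X i) := by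
      simp
    have h2 : restrictLine l k (∑ i, C (l i) * X i) = 0 := by
      rw [Fin.sum_univ_succAbove _ k]
      simp only [restrictLine, map_add, map_mul, map_sum, aeval_X, lineParam,
        Fin.insertNth_apply_same, Fin.insertNth_apply_succAbove, aeval_C,
        MvPolynomial.algebraMap_eq, mul_neg, Finset.mul_sum, ← mul_assoc, ← C_mul,
        mul_div_cancel₀ _ hk]
      simp
    rw [h1, hΨ, h2, map_zero]
  refine ⟨Ψ g, ?_, ?_⟩
  · have := hg.aeval _ fun i => (isHomogeneous_lineParam l k i).map (algebraMap ℝ ℂ)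
    rwa [one_mul] at this
  · rw [← hΨ, hF, map_add, map_mul, hL, zero_mul, add_zero, map_pow]

end Line

/-! ### Splitting of bitangents -/

/-- The partial derivatives of `Q₁Q₃ - Q₂²` lie in the ideal of the three forms, so a common zero
would be a singular point. -/
lemma IsSmoothCurve.ne_zero_of_discriminant {Q₁ Q₂ Q₃ : MvPolynomial (Fin 3) ℝ}
    (hs : IsSmoothCurve (Q₁ * Q₃ - Q₂ ^ 2)) {x : Fin 3 → ℂ} (hx : x ≠ 0) (h₁ : aeval x Q₁ = 0)
    (h₂ : aeval x Q₂ = 0) (h₃ : aeval x Q₃ = 0) : False := by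
  obtain ⟨i, hi⟩ := hs x hx (by simp [h₁, h₂])
  exact hi (by simp [Derivation.leibniz, pow_two, h₁, h₂, h₃])

/-- The curve `t₀ a + t₁ b = 0` over the line `l`. -/
lemma isRealLineOver_of_forms {l : Fin 3 → ℝ} {k : Fin 3} {n : ℕ} {a b : MvPolynomial (Fin 2) ℝ}
    (ha : a.IsHomogeneous n) (hb : b.IsHomogeneous n)
    (h0 : ∀ P ∈ complexLine l, aeval (P.rep ∘ k.succAbove) a ≠ 0 ∨
      aeval (P.rep ∘ k.succAbove) b ≠ 0) :
    IsRealLineOver l {p | p.2 ∈ complexLine l ∧ p.1.rep 0 * aeval (p.2.rep ∘ k.succAbove) a +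
      p.1.rep 1 * aeval (p.2.rep ∘ k.succAbove) b = 0} := by
  -- The equation `t₀ a + t₁ b = 0` has the solution `[-b : a]`, lifted to three variables by
  -- ignoring the `k`-th.
  refine ⟨n, ![-rename k.succAbove b, rename k.succAbove a], ?_, ?_, ?_⟩
  · intro i
    fin_cases i
    · exact (hb.rename_isHomogeneous).neg
    · exact ha.rename_isHomogeneous
  · intro P hP
    rcases h0 P hP with h | h
    · exact ⟨1, by simpa [aeval_rename] using h⟩
    · exact ⟨0, by simpa [aeval_rename] using h⟩
  · ext p
    simp only [mem_ofPred_eq, Matrix.cons_val_zero, Matrix.cons_val_one, map_neg, aeval_rename,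
      mul_neg, eq_neg_iff_add_eq_zero]

/-- The point `v` with negative value excludes the possibility that the restricted quartic is `+r²`,
so the factorization applies. Smoothness ensures that neither pair of coefficients `a, b` or `c, d`
has a common zero on the line, so each factor defines a graph. -/
theorem IsRealBitangent.splitsOn {Q₁ Q₂ Q₃ : MvPolynomial (Fin 3) ℝ}
    (h₁ : Q₁.IsHomogeneous 2) (h₂ : Q₂.IsHomogeneous 2) (h₃ : Q₃.IsHomogeneous 2)
    (hs : IsSmoothCurve (Q₁ * Q₃ - Q₂ ^ 2)) {l : Fin 3 → ℝ}
    (hl : IsRealBitangent (Q₁ * Q₃ - Q₂ ^ 2) l) {v : Fin 3 → ℝ} (hv : v ≠ 0) (hlv : l ⬝ᵥ v = 0)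
    (hvF : eval v (Q₁ * Q₃ - Q₂ ^ 2) < 0) : SplitsOn Q₁ Q₂ Q₃ l := by
  obtain ⟨k, hk⟩ : ∃ k, l k ≠ 0 := Function.ne_iff.1 hl.1
  obtain ⟨G, hG, hFG⟩ := hl.exists_map_restrictLine_eq_sq hk
  obtain ⟨r, hr, hFr⟩ := exists_eq_sq_or_eq_neg_sq hG hFG
  have hFneg : restrictLine l k (Q₁ * Q₃ - Q₂ ^ 2) = -r ^ 2 := by
    refine hFr.resolve_left fun h => ?_
    have h1 := aeval_restrictLine (A := ℝ) hk (x := v) hlv (Q₁ * Q₃ - Q₂ ^ 2)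
    rw [h, map_pow] at h1
    replace hvF : aeval v (Q₁ * Q₃ - Q₂ ^ 2) < 0 := hvF
    rw [← h1] at hvF
    exact absurd hvF (not_lt.2 (sq_nonneg _))
  obtain ⟨n, m, a, b, c, d, ha, hb, hc, hd, hac, hbd, habcd⟩ := exists_factorization
    (isHomogeneous_restrictLine l k h₁) (isHomogeneous_restrictLine l k h₂)
    (isHomogeneous_restrictLine l k h₃) hr (by simpa using hFneg)
  have hev : ∀ P ∈ complexLine l,
      aeval P.rep Q₁ = aeval (P.rep ∘ k.succAbove) a * aeval (P.rep ∘ k.succAbove) c ∧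
      aeval P.rep Q₃ = aeval (P.rep ∘ k.succAbove) b * aeval (P.rep ∘ k.succAbove) d ∧
      2 * aeval P.rep Q₂ = aeval (P.rep ∘ k.succAbove) a * aeval (P.rep ∘ k.succAbove) d +
        aeval (P.rep ∘ k.succAbove) b * aeval (P.rep ∘ k.succAbove) c := by
    intro P hP
    have hP' : ∑ i, algebraMap ℝ ℂ (l i) * P.rep i = 0 := hP
    have e := fun Q => aeval_restrictLine hk hP' Q
    refine ⟨?_, ?_, ?_⟩
    · rw [← e, hac, map_mul]
    · rw [← e, hbd, map_mul]
    · have := congrArg (aeval (P.rep ∘ k.succAbove)) habcd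
      simpa only [map_mul, map_add, map_ofNat, e] using this
  have hab0 : ∀ P ∈ complexLine l, aeval (P.rep ∘ k.succAbove) a ≠ 0 ∨
      aeval (P.rep ∘ k.succAbove) b ≠ 0 := by
    intro P hP
    by_contra! hcon
    obtain ⟨e1, e3, e2⟩ := hev P hP
    rw [hcon.1, hcon.2] at e2
    exact hs.ne_zero_of_discriminant P.rep_nonzero (by rw [e1, hcon.1, zero_mul])
      (by simpa using e2) (by rw [e3, hcon.2, zero_mul])
  have hcd0 : ∀ P ∈ complexLine l, aeval (P.rep ∘ k.succAbove) c ≠ 0 ∨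
      aeval (P.rep ∘ k.succAbove) d ≠ 0 := by
    intro P hP
    by_contra! hcon
    obtain ⟨e1, e3, e2⟩ := hev P hP
    rw [hcon.1, hcon.2] at e2
    exact hs.ne_zero_of_discriminant P.rep_nonzero (by rw [e1, hcon.1, mul_zero])
      (by simpa using e2) (by rw [e3, hcon.2, mul_zero])
  refine ⟨_, _, isRealLineOver_of_forms ha hb hab0, isRealLineOver_of_forms hc hd hcd0, ?_, ?_⟩
  · -- Over a point at which the quartic does not vanish the two curves differ.
    let w : Fin 3 → ℂ := fun i => (v i : ℂ)
    have hw : w ≠ 0 := fun h => hv (by ext i; simpa [w] using congrFun h i)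
    let P : ℙ ℂ (Fin 3 → ℂ) := Projectivization.mk ℂ w hw
    obtain ⟨μ, hμ⟩ := Projectivization.exists_smul_eq_mk_rep ℂ w hw
    have hPrep : P.rep = (μ : ℂ) • w := hμ.symm
    have hP : P ∈ complexLine l := by
      have h1 : ∑ i, (l i : ℂ) * w i = 0 := by
        have : ((l ⬝ᵥ v : ℝ) : ℂ) = 0 := by rw [hlv]; simp
        simpa [dotProduct, w] using this
      change ∑ i, (l i : ℂ) * P.rep i = 0
      simp only [hPrep, Pi.smul_apply, smul_eq_mul, mul_left_comm _ (μ : ℂ), ← Finset.mul_sum, h1,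
        mul_zero]
    have hFP : aeval P.rep (Q₁ * Q₃ - Q₂ ^ 2) ≠ 0 := by
      rw [hPrep, aeval_smul_of_isHomogeneous (isHomogeneous_discriminant h₁ h₂ h₃)]
      have := aeval_algebraMap_apply ℂ v (Q₁ * Q₃ - Q₂ ^ 2)
      have hwv : aeval w (Q₁ * Q₃ - Q₂ ^ 2) = ((eval v (Q₁ * Q₃ - Q₂ ^ 2) : ℝ) : ℂ) := this
      rw [hwv]
      exact mul_ne_zero (pow_ne_zero _ μ.ne_zero) (Complex.ofReal_ne_zero.2 hvF.ne)
    obtain ⟨e1, e3, e2⟩ := hev P hP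
    have hvec : ![-aeval (P.rep ∘ k.succAbove) b, aeval (P.rep ∘ k.succAbove) a] ≠ 0 := by
      intro h
      have h0 := congrFun h 0
      have h1 := congrFun h 1
      simp at h0 h1
      exact (hab0 P hP).elim (fun h => h h1) (fun h => h h0)
    let T : ℙ ℂ (Fin 2 → ℂ) := Projectivization.mk ℂ _ hvec
    obtain ⟨ν, hν⟩ := Projectivization.exists_smul_eq_mk_rep ℂ _ hvec
    have hT0 : T.rep 0 = ν * -aeval (P.rep ∘ k.succAbove) b := (congrFun hν 0).symm
    have hT1 : T.rep 1 = ν * aeval (P.rep ∘ k.succAbove) a := (congrFun hν 1).symm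
    intro hZ
    have hmem : (T, P) ∈ {p : ℙ ℂ (Fin 2 → ℂ) × ℙ ℂ (Fin 3 → ℂ) | p.2 ∈ complexLine l ∧
        p.1.rep 0 * aeval (p.2.rep ∘ k.succAbove) a +
        p.1.rep 1 * aeval (p.2.rep ∘ k.succAbove) b = 0} := by
      refine ⟨hP, ?_⟩
      simp only [hT0, hT1]
      ring
    rw [hZ] at hmem
    have h2 := hmem.2
    simp only [hT0, hT1] at h2
    have h3 : aeval (P.rep ∘ k.succAbove) a * aeval (P.rep ∘ k.succAbove) d -
        aeval (P.rep ∘ k.succAbove) b * aeval (P.rep ∘ k.succAbove) c = 0 := by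
      refine (mul_eq_zero.1 (?_ : (ν : ℂ) * _ = 0)).resolve_left ν.ne_zero
      linear_combination h2
    apply hFP
    -- The identity behind this is `4 (Q₁Q₃ - Q₂²) = -(ad - bc)²` on the line: the two curves meet
    -- only over zeros of the quartic.
    have h4 : (4 : ℂ) * aeval P.rep (Q₁ * Q₃ - Q₂ ^ 2) = 0 := by
      simp only [map_sub, map_mul, map_pow, e1, e3]
      linear_combination (-(aeval (P.rep ∘ k.succAbove) a * aeval (P.rep ∘ k.succAbove) d -
        aeval (P.rep ∘ k.succAbove) b * aeval (P.rep ∘ k.succAbove) c)) * h3 -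
        (2 * aeval P.rep Q₂ + aeval (P.rep ∘ k.succAbove) a * aeval (P.rep ∘ k.succAbove) d +
          aeval (P.rep ∘ k.succAbove) b * aeval (P.rep ∘ k.succAbove) c) * e2
    simpa using h4
  · ext p
    simp only [mem_inter_iff, mem_preimage, mem_union, mem_ofPred_eq, delPezzo, ← and_or_left]
    rw [and_comm]
    refine and_congr_right fun hp => ?_
    obtain ⟨e1, e3, e2⟩ := hev p.2 hp
    rw [← mul_eq_zero, e1, e3]
    refine Eq.congr_left ?_
    linear_combination p.1.rep 0 * p.1.rep 1 * e2

end RealQuartic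

end

theorem lemma3p6 (Q₁ Q₂ Q₃ : MvPolynomial (Fin 3) ℝ)
    (h₁ : Q₁.IsHomogeneous 2) (h₂ : Q₂.IsHomogeneous 2) (h₃ : Q₃.IsHomogeneous 2)
    (hsmooth : RealQuartic.IsSmoothCurve (Q₁ * Q₃ - Q₂ ^ 2))
    (hovals : RealQuartic.ConsistsOfOvals 4 (RealQuartic.zeroLocus (Q₁ * Q₃ - Q₂ ^ 2))) :
    RealQuartic.outside (Q₁ * Q₃ - Q₂ ^ 2) = RealQuartic.negLocus (Q₁ * Q₃ - Q₂ ^ 2) ∧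
    ∀ l : Fin 3 → ℝ, RealQuartic.IsRealBitangent (Q₁ * Q₃ - Q₂ ^ 2) l →
      RealQuartic.SplitsOn Q₁ Q₂ Q₃ l := by
  obtain ⟨hout, hline⟩ := RealQuartic.outside_eq_negLocus h₁ h₂ h₃ hsmooth hovals
  refine ⟨hout, fun l hl => ?_⟩
  obtain ⟨v, hv, hlv, hvF⟩ := hline l hl.1
  exact hl.splitsOn h₁ h₂ h₃ hsmooth hv hlv hvF
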